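/- Let $M$ be a connected smooth manifold of dimension $2n+1$ with a paracontact metric structure $(\varphi,\xi,\eta,g)$: $g$ is a semi-Riemannian metric, $\xi$ a smooth vector field, $\eta$ a smooth 1-form and $\varphi$ a smooth $(1,1)$-tensor field such that $$\eta(\xi)=1,\quad d\eta(\xi,\cdot)=0,\quad \eta=g(\xi,\cdot),\quad d\eta(X,Y)=g(X,\varphi Y),\quad \varphi^2=I-\eta\otimes\xi ,$$ where $2\,d\eta(X,Y)=X\eta(Y)-Y\eta(X)-\eta([X,Y])$ (so that $\eta\wedge(d\eta)^n\neq 0$). Let $\nabla$ be the Levi-Civita connection of $g$ and $Q$ its Ricci operator, $g(QX,Y)=\varrho(X,Y)=\sum_i\varepsilon_i\,g(R(X,E_i)Y,E_i)$ with $R(X,Y)=\nabla_{[X,Y]}-[\nabla_X,\nabla_Y]$ and $\{E_i\}$ a local pseudo-orthonormal frame, $\varepsilon_i=g(E_i,E_i)=\pm1$. Let $\bar\Delta V=\sum_i\varepsilon_i(\nabla_{\nabla_{E_i}E_i}V-\nabla_{E_i}\nabla_{E_i}V)$ be the rough Laplacian and let $h=\frac12\mathcal L_\xi\varphi$. A vector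 field $V$ is called an infinitesimal harmonic transformation (or $1$-harmonic) if $\operatorname{tr}_g(\mathcal L_V\nabla)=0$, where $(\mathcal L_V\nabla)(X,Y)=[V,\nabla_XY]-\nabla_{[V,X]}Y-\nabla_X[V,Y]$. A smooth vector field $V$ of constant length $g(V,V)=r\neq0$ is called harmonic if it is a critical point of the energy among vector fields of the same length: for every relatively compact open set $D\subseteq M$ and every smooth variation $V_t$, $|t|<\varepsilon$, of $V_0=V$ with $g(V_t,V_t)=r$ and with $V_t=V$ outside a fixed compact subset of $D$, one has $\frac{d}{dt}\big|_{t=0}E_D(V_t)=0$, where $E_D(V)=\frac12\int_D\operatorname{tr}_g(V^*g^s)\,dv_g$ and $g^s$ is the Sasaki metric on $TM$, so that $(V^*g^s)(X,Y)=g(X,Y)+g(\nabla_XV,\nabla_YV)$. The manifold $M$ is called $H$-paracontact if $\xi$ is a harmonic vector field. Then the following assertions are equivalent: (1) $Q\xi=-2n\,\xi$; (2) $\xi$ is an infinitesimal harmonic transformation, i.e. $\operatorname{tr}_g(\mathcal L_\xi\nabla)=0$; (2') $\bar\Delta\xi=Q\xi$; (3) $M$ is $H$-paracontact and $\operatorname{tr}h^2=0$.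 -/

import Mathlib

open scoped Manifold ContDiff Topology
open Bundle VectorField MeasureTheory

noncomputable section

/-! ## Semi-Riemannian manifolds of dimension `m` -/

namespace SemiRiem

/-- Vector fields on an `m`-dimensional manifold (no regularity required). -/
abbrev VF (m : ℕ) (M : Type*) [TopologicalSpace M]
    [ChartedSpace (EuclideanSpace ℝ (Fin m)) M] := Π x : M, TangentSpace (𝓡 m) x

variable {m : ℕ} {M : Type*} [TopologicalSpace M]
  [ChartedSpace (EuclideanSpace ℝ (Fin m)) M] [IsManifold (𝓡 m) ∞ M]

/-- The vector field `X` is differentiable at `x`. -/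
abbrev DiffAt (X : VF m M) (x : M) : Prop :=
  MDifferentiableAt (𝓡 m) ((𝓡 m).prod 𝓘(ℝ, EuclideanSpace ℝ (Fin m)))
    (fun y ↦ TotalSpace.mk' (EuclideanSpace ℝ (Fin m)) y (X y)) x

/-- The vector field `X` is smooth. -/
def IsSmooth (X : VF m M) : Prop :=
  ContMDiff (𝓡 m) ((𝓡 m).prod 𝓘(ℝ, EuclideanSpace ℝ (Fin m))) ∞
    (fun y ↦ TotalSpace.mk' (EuclideanSpace ℝ (Fin m)) y (X y))

/-- An extension of the tangent vector `v` at `x` to a vector field, smooth near `x` (it has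
constant components in the preferred chart at `x`). -/
abbrev ext {x : M} (v : TangentSpace (𝓡 m) x) : VF m M :=
  FiberBundle.extend (EuclideanSpace ℝ (Fin m)) v

lemma diffAt_ext {x : M} (v : TangentSpace (𝓡 m) x) : DiffAt (ext v) x :=
  FiberBundle.mdifferentiableAt_extend ..

instance (x : M) : FiniteDimensional ℝ (TangentSpace (𝓡 m) x) :=
  inferInstanceAs (FiniteDimensional ℝ (EuclideanSpace ℝ (Fin m)))

/-- A smooth semi-Riemannian metric: a smooth field of nondegenerate symmetric bilinear forms on
the tangent spaces. -/
structure Metric (m : ℕ) (M : Type*) [TopologicalSpace M]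
    [ChartedSpace (EuclideanSpace ℝ (Fin m)) M] [IsManifold (𝓡 m) ∞ M] where
  val (x : M) : TangentSpace (𝓡 m) x →L[ℝ] TangentSpace (𝓡 m) x →L[ℝ] ℝ
  symm (x : M) (v w : TangentSpace (𝓡 m) x) : val x v w = val x w v
  nondegenerate (x : M) (v : TangentSpace (𝓡 m) x) (hv : ∀ w, val x v w = 0) : v = 0
  smooth : ContMDiff (𝓡 m)
    ((𝓡 m).prod 𝓘(ℝ, EuclideanSpace ℝ (Fin m) →L[ℝ] EuclideanSpace ℝ (Fin m) →L[ℝ] ℝ)) ∞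
    (fun x ↦ TotalSpace.mk'
      (EuclideanSpace ℝ (Fin m) →L[ℝ] EuclideanSpace ℝ (Fin m) →L[ℝ] ℝ)
      (E := fun x : M ↦ TangentSpace (𝓡 m) x →L[ℝ] TangentSpace (𝓡 m) x →L[ℝ] ℝ) x (val x))

variable (g : Metric m M)

/-- The function `g(X, Y)`. -/
def pair (X Y : VF m M) (x : M) : ℝ := g.val x (X x) (Y x)

lemma mdiffAt_pair {X Y : VF m M} {x : M} (hX : DiffAt X x) (hY : DiffAt Y x) :
    MDifferentiableAt (𝓡 m) 𝓘(ℝ) (pair g X Y) x := by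
  have : MDifferentiableAt (𝓡 m) ((𝓡 m).prod 𝓘(ℝ))
      (fun y ↦ TotalSpace.mk' ℝ (E := Bundle.Trivial M ℝ) y (g.val y (X y) (Y y))) x := by
    apply MDifferentiableAt.clm_bundle_apply₂ (F₁ := EuclideanSpace ℝ (Fin m))
      (F₂ := EuclideanSpace ℝ (Fin m))
    · exact g.smooth.mdifferentiableAt (by simp)
    · exact hX
    · exact hY
  simp only [mdifferentiableAt_totalSpace] at this
  exact this.2

lemma pair_add_left (X X' Y : VF m M) : pair g (X + X') Y = pair g X Y + pair g X' Y := by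
  ext y; simp [pair]

lemma pair_add_right (X X' Y : VF m M) : pair g Y (X + X') = pair g Y X + pair g Y X' := by
  ext y; simp [pair]

lemma pair_smul_left (f : M → ℝ) (X Y : VF m M) : pair g (f • X) Y = f * pair g X Y := by
  ext y; simp [pair]

lemma pair_smul_right (f : M → ℝ) (X Y : VF m M) : pair g X (f • Y) = f * pair g X Y := by
  ext y; simp [pair]

/-! ### The Levi-Civita connection, from the Koszul formula -/

/-- The right-hand side of the Koszul formula for `2 g(∇_X Y, Z)`. -/
def koszul (X Y Z : VF m M) (x : M) : ℝ :=
  mvfderiv (𝓡 m) (pair g Y Z) x (X x) + mvfderiv (𝓡 m) (pair g X Z) x (Y x)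
    - mvfderiv (𝓡 m) (pair g X Y) x (Z x)
    + g.val x (mlieBracket (𝓡 m) X Y x) (Z x)
    - g.val x (mlieBracket (𝓡 m) X Z x) (Y x)
    - g.val x (mlieBracket (𝓡 m) Y Z x) (X x)

lemma koszul_tensorial₁ {Y Z : VF m M} {x : M} (hY : DiffAt Y x) (hZ : DiffAt Z x) :
    TensorialAt (𝓡 m) (EuclideanSpace ℝ (Fin m)) (fun X ↦ koszul g X Y Z x) x where
  smul {f X} hf hX := by
    simp only [koszul, pair_smul_left]
    rw [mvfderiv_mul hf (mdiffAt_pair g hX hZ), mvfderiv_mul hf (mdiffAt_pair g hX hY),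
      mlieBracket_smul_left hf hX, mlieBracket_smul_left hf hX]
    simp [pair]
    ring
  add {X X'} hX hX' := by
    simp only [koszul, pair_add_left]
    rw [mvfderiv_add (mdiffAt_pair g hX hZ) (mdiffAt_pair g hX' hZ),
      mvfderiv_add (mdiffAt_pair g hX hY) (mdiffAt_pair g hX' hY),
      mlieBracket_add_left hX hX', mlieBracket_add_left hX hX']
    simp
    ring

lemma koszul_tensorial₂ {X Y : VF m M} {x : M} (hX : DiffAt X x) (hY : DiffAt Y x) :
    TensorialAt (𝓡 m) (EuclideanSpace ℝ (Fin m)) (fun Z ↦ koszul g X Y Z x) x where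
  smul {f Z} hf hZ := by
    simp only [koszul, pair_smul_right]
    rw [mvfderiv_mul hf (mdiffAt_pair g hX hZ), mvfderiv_mul hf (mdiffAt_pair g hY hZ),
      mlieBracket_smul_right hf hZ, mlieBracket_smul_right hf hZ]
    simp [pair]
    rw [g.symm x (Z x) (X x), g.symm x (Z x) (Y x)]
    ring
  add {Z Z'} hZ hZ' := by
    simp only [koszul, pair_add_right]
    rw [mvfderiv_add (mdiffAt_pair g hX hZ) (mdiffAt_pair g hX hZ'),
      mvfderiv_add (mdiffAt_pair g hY hZ) (mdiffAt_pair g hY hZ'),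
      mlieBracket_add_right hZ hZ', mlieBracket_add_right hZ hZ']
    simp
    ring

/-- The musical isomorphism `v ↦ g(v, ·)`. -/
def flatEquiv (x : M) : TangentSpace (𝓡 m) x ≃ₗ[ℝ] Module.Dual ℝ (TangentSpace (𝓡 m) x) :=
  LinearMap.linearEquivOfInjective
    { toFun := fun v ↦ (g.val x v : TangentSpace (𝓡 m) x →ₗ[ℝ] ℝ)
      map_add' := fun v w ↦ by ext; simp
      map_smul' := fun c v ↦ by ext; simp }
    (by
      rw [← LinearMap.ker_eq_bot, LinearMap.ker_eq_bot']
      intro v hv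
      exact g.nondegenerate x v fun w ↦ by simpa using! congr($hv w))
    (Subspace.dual_finrank_eq).symm

/-- The tangent vector `v` with `g(v, ·) = α`. -/
def sharp (x : M) (α : TangentSpace (𝓡 m) x →L[ℝ] ℝ) : TangentSpace (𝓡 m) x :=
  (flatEquiv g x).symm (α : TangentSpace (𝓡 m) x →ₗ[ℝ] ℝ)

lemma val_sharp (x : M) (α : TangentSpace (𝓡 m) x →L[ℝ] ℝ) (w : TangentSpace (𝓡 m) x) :
    g.val x (sharp g x α) w = α w := by
  have := (flatEquiv g x).apply_symm_apply (α : TangentSpace (𝓡 m) x →ₗ[ℝ] ℝ)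
  exact congr($this w)

lemma ext_val {x : M} {v v' : TangentSpace (𝓡 m) x} (h : ∀ w, g.val x v w = g.val x v' w) :
    v = v' := by
  rw [← sub_eq_zero]
  exact g.nondegenerate x _ fun w ↦ by simp [h w]

/-- The Koszul expression `(X, Z) ↦ koszul g X Y Z x` as a bilinear form on the tangent space. -/
def koszulHom (Y : VF m M) (x : M) (hY : DiffAt Y x) :
    TangentSpace (𝓡 m) x →L[ℝ] TangentSpace (𝓡 m) x →L[ℝ] ℝ :=
  TensorialAt.mkHom₂ (fun X Z ↦ koszul g X Y Z x) x
    (fun _ hZ ↦ koszul_tensorial₁ g hY hZ) (fun _ hX ↦ koszul_tensorial₂ g hX hY)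

lemma koszulHom_apply {X Y Z : VF m M} {x : M} (hX : DiffAt X x) (hY : DiffAt Y x)
    (hZ : DiffAt Z x) : koszulHom g Y x hY (X x) (Z x) = koszul g X Y Z x :=
  TensorialAt.mkHom₂_apply (fun _ hZ ↦ koszul_tensorial₁ g hY hZ)
    (fun _ hX ↦ koszul_tensorial₂ g hX hY) hX hZ

open Classical in
/-- The underlying map of the Levi-Civita connection: `v ↦ ∇_v Y` at `x` is obtained by solving the
Koszul formula; it is `0` if `Y` is not differentiable at `x`. -/
def lcFun (Y : VF m M) (x : M) : TangentSpace (𝓡 m) x →L[ℝ] TangentSpace (𝓡 m) x :=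
  have : T2Space (TangentSpace (𝓡 m) x) :=
    FiberBundle.t2Space (EuclideanSpace ℝ (Fin m)) (TangentSpace (𝓡 m)) x
  if hY : DiffAt Y x then
    LinearMap.toContinuousLinearMap
      { toFun := fun v ↦ sharp g x ((2⁻¹ : ℝ) • koszulHom g Y x hY v)
        map_add' := fun v w ↦ ext_val g fun u ↦ by simp [val_sharp]
        map_smul' := fun c v ↦ ext_val g fun u ↦ by simp [val_sharp]; ring }
  else 0

lemma val_lcFun {X Y Z : VF m M} {x : M} (hX : DiffAt X x) (hY : DiffAt Y x) (hZ : DiffAt Z x) :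
    g.val x (lcFun g Y x (X x)) (Z x) = 2⁻¹ * koszul g X Y Z x := by
  rw [← koszulHom_apply g hX hY hZ]
  simp only [lcFun, dif_pos hY]
  exact (val_sharp g x _ _).trans (by simp)

lemma ext_endo {x : M} {A B : TangentSpace (𝓡 m) x →L[ℝ] TangentSpace (𝓡 m) x}
    (h : ∀ X Z : VF m M, DiffAt X x → DiffAt Z x →
      g.val x (A (X x)) (Z x) = g.val x (B (X x)) (Z x)) : A = B := by
  ext1 v
  apply ext_val g
  intro w
  simpa using h _ _ (diffAt_ext v) (diffAt_ext w)

/-- The Levi-Civita connection of `g`; `leviCivita g Y x v` is `∇_v Y` at `x`. -/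
def leviCivita : CovariantDerivative (𝓡 m) (EuclideanSpace ℝ (Fin m))
    (TangentSpace (𝓡 m) : M → Type _) where
  toFun := lcFun g
  isCovariantDerivativeOnUniv :=
    { add := fun {Y Y' x} hY hY' _ ↦ by
        apply ext_endo g
        intro X Z hX hZ
        have hYY' : DiffAt (Y + Y') x := mdifferentiableAt_add_section hY hY'
        rw [add_apply, map_add, add_apply,
          val_lcFun g hX hYY' hZ, val_lcFun g hX hY hZ, val_lcFun g hX hY' hZ]
        simp only [koszul, pair_add_left, pair_add_right]
        rw [mvfderiv_add (mdiffAt_pair g hY hZ) (mdiffAt_pair g hY' hZ),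
          mvfderiv_add (mdiffAt_pair g hX hY) (mdiffAt_pair g hX hY'),
          mlieBracket_add_left hY hY', mlieBracket_add_right hY hY']
        simp
        ring
      leibniz := fun {Y f x} hY hf _ ↦ by
        apply ext_endo g
        intro X Z hX hZ
        have hfY : DiffAt (f • Y) x := hf.smul_section hY
        rw [add_apply, map_add, add_apply,
          val_lcFun g hX hfY hZ, smul_apply, map_smul, smul_apply, val_lcFun g hX hY hZ]
        simp only [koszul, pair_smul_left, pair_smul_right]
        rw [mvfderiv_mul hf (mdiffAt_pair g hY hZ),
          mvfderiv_mul hf (mdiffAt_pair g hX hY),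
          mlieBracket_smul_left hf hY, mlieBracket_smul_right hf hY]
        simp [pair]
        rw [g.symm x (Y x) (X x)]
        ring }

/-- The Koszul formula. -/
lemma val_leviCivita {X Y Z : VF m M} {x : M} (hX : DiffAt X x) (hY : DiffAt Y x)
    (hZ : DiffAt Z x) :
    g.val x (leviCivita g Y x (X x)) (Z x) = 2⁻¹ * koszul g X Y Z x :=
  val_lcFun g hX hY hZ

/-- The Levi-Civita connection is torsion-free. -/
theorem leviCivita_torsion : (leviCivita g).torsion = 0 := by
  rw [CovariantDerivative.torsion_eq_zero_iff]
  intro X Y x hX hY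
  apply ext_val g
  intro w
  have hZ := diffAt_ext w
  have h1 := val_leviCivita g hX hY hZ
  have h2 := val_leviCivita g hY hX hZ
  simp only [FiberBundle.extend_apply_self] at h1 h2
  have e : pair g X Y = pair g Y X := by ext; simp [pair, g.symm]
  rw [map_sub, sub_apply, h1, h2, koszul, koszul, e, mlieBracket_swap_apply (V := Y) (W := X)]
  simp
  ring

/-- The Levi-Civita connection is compatible with the metric. -/
theorem leviCivita_metric {X Y Z : VF m M} {x : M} (hX : DiffAt X x) (hY : DiffAt Y x)
    (hZ : DiffAt Z x) : mvfderiv (𝓡 m) (pair g Y Z) x (X x) =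
      g.val x (leviCivita g Y x (X x)) (Z x) + g.val x (Y x) (leviCivita g Z x (X x)) := by
  have e : pair g Z Y = pair g Y Z := by ext; simp [pair, g.symm]
  rw [g.symm x (Y x), val_leviCivita g hX hY hZ, val_leviCivita g hX hZ hY, koszul, koszul, e,
    mlieBracket_swap_apply (V := Z) (W := Y)]
  simp
  ring

/-! ### Metric traces, curvature, Laplacian -/

/-- The `i`-th vector of the standard basis of the tangent space at `x`. -/
def basisVec (x : M) (i : Fin m) : TangentSpace (𝓡 m) x :=
  (EuclideanSpace.single i 1 : EuclideanSpace ℝ (Fin m))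

/-- The Gram matrix `g_ij` of the metric in the standard basis of the tangent space at `x`. -/
def gram (x : M) : Matrix (Fin m) (Fin m) ℝ :=
  Matrix.of fun i j ↦ g.val x (basisVec x i) (basisVec x j)

/-- The metric trace `tr_g B = ∑ g^{ij} B(b_i, b_j)` of a bilinear map `B` on the tangent space at
`x`. It equals `∑ ε_i B(E_i, E_i)` for a pseudo-orthonormal basis `E_i` with `ε_i = g(E_i, E_i)`. -/
def trace {F : Type*} [AddCommGroup F] [Module ℝ F] (x : M)
    (B : TangentSpace (𝓡 m) x → TangentSpace (𝓡 m) x → F) : F :=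
  ∑ i, ∑ j, (gram g x)⁻¹ i j • B (basisVec x i) (basisVec x j)

/-- The vector field `∇_X Y`. -/
def nabla (X Y : VF m M) : VF m M := fun x ↦ leviCivita g Y x (X x)

/-- The curvature `R_{XY} Z = ∇_{[X,Y]} Z - [∇_X, ∇_Y] Z`. -/
def curvature (X Y Z : VF m M) : VF m M :=
  nabla g (mlieBracket (𝓡 m) X Y) Z - (nabla g X (nabla g Y Z) - nabla g Y (nabla g X Z))

/-- The Ricci tensor `ϱ(u, v) = ∑ ε_i g(R(u, E_i) v, E_i)`. -/
def ricci (x : M) (u v : TangentSpace (𝓡 m) x) : ℝ :=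
  trace g x fun w w' ↦ g.val x (curvature g (ext u) (ext w) (ext v) x) w'

/-- The Ricci operator `Q`, with `g(Q u, v) = ϱ(u, v)`. -/
def ricciOp (x : M) (u : TangentSpace (𝓡 m) x) : TangentSpace (𝓡 m) x :=
  trace g x fun w w' ↦ ricci g x u w • w'

/-- The rough Laplacian `Δ̄V = -tr ∇²V = ∑ ε_i (∇_{∇_{E_i} E_i} V - ∇_{E_i} ∇_{E_i} V)`. -/
def roughLaplacian (V : VF m M) (x : M) : TangentSpace (𝓡 m) x :=
  trace g x fun u v ↦
    nabla g (nabla g (ext u) (ext v)) V x - nabla g (ext u) (nabla g (ext v) V) x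

/-! ### Infinitesimal harmonic transformations -/

/-- The Lie derivative of the Levi-Civita connection along `V`:
`(L_V ∇)(X, Y) = [V, ∇_X Y] - ∇_{[V, X]} Y - ∇_X [V, Y]`. -/
def lieDerivConnection (V X Y : VF m M) : VF m M :=
  mlieBracket (𝓡 m) V (nabla g X Y) - nabla g (mlieBracket (𝓡 m) V X) Y
    - nabla g X (mlieBracket (𝓡 m) V Y)

/-- `V` is an infinitesimal harmonic transformation (a 1-harmonic vector field):
`tr (L_V ∇) = 0`. -/
def IsInfinitesimalHarmonic (V : VF m M) : Prop :=
  ∀ x, (trace g x fun u v ↦ lieDerivConnection g V (ext u) (ext v) x) = 0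

/-! ### Volume, energy, harmonic vector fields -/

/-- The Gram matrix of the metric in the coordinate frame of the preferred chart at `p`, at the
point with coordinates `y`. -/
def chartGram (p : M) (y : EuclideanSpace ℝ (Fin m)) : Matrix (Fin m) (Fin m) ℝ :=
  Matrix.of fun i j ↦ g.val ((extChartAt (𝓡 m) p).symm y)
    (mfderiv 𝓘(ℝ, EuclideanSpace ℝ (Fin m)) (𝓡 m) (extChartAt (𝓡 m) p).symm y
      (EuclideanSpace.single i (1 : ℝ) : EuclideanSpace ℝ (Fin m)))
    (mfderiv 𝓘(ℝ, EuclideanSpace ℝ (Fin m)) (𝓡 m) (extChartAt (𝓡 m) p).symm y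
      (EuclideanSpace.single j (1 : ℝ) : EuclideanSpace ℝ (Fin m)))

/-- The measure `√|det g_ij| dy` on the domain of the preferred chart at `p`, as a measure on `M`
vanishing outside that domain. -/
def chartVolume [MeasurableSpace M] (p : M) : Measure M :=
  (((volume : Measure (EuclideanSpace ℝ (Fin m))).restrict
      (extChartAt (𝓡 m) p).target).withDensity
    fun y ↦ ENNReal.ofReal √|(chartGram g p y).det|).map (extChartAt (𝓡 m) p).symm

/-- The semi-Riemannian volume measure. The measures `chartVolume g p` agree on overlaps of chart
domains, and their supremum is the measure which is equal to `√|det g_ij| dy` in each chart. -/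
def volumeMeasure [MeasurableSpace M] : Measure M := ⨆ p : M, chartVolume g p

/-- The pullback `V^* g^s` of the Sasaki metric by a vector field, seen as a map `V : M → TM`:
`(V^* g^s)(u, v) = g(u, v) + g(∇_u V, ∇_v V)`, the horizontal and vertical parts of `dV(u)` being
`u` and `∇_u V`. -/
def sasakiPullback (V : VF m M) (x : M) (u v : TangentSpace (𝓡 m) x) : ℝ :=
  g.val x u v + g.val x (leviCivita g V x u) (leviCivita g V x v)

/-- The energy of the vector field `V` on `D`: `½ ∫_D tr_g (V^* g^s) dv`. -/
def energy [MeasurableSpace M] (D : Set M) (V : VF m M) : ℝ :=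
  2⁻¹ * ∫ x in D, trace g x (sasakiPullback g V x) ∂(volumeMeasure g)

/-- `V` is a harmonic vector field: it has constant length `g(V, V) = r ≠ 0` and is a critical point
of the energy among vector fields of the same length, i.e. for every relatively compact open set
`D`, the derivative at `t = 0` of the energy on `D` vanishes along every smooth variation `W t` of
`V` through vector fields of the same length which agree with `V` outside a compact subset
of `D`. -/
def IsHarmonicVF [MeasurableSpace M] (V : VF m M) : Prop :=
  IsSmooth V ∧ ∃ r : ℝ, r ≠ 0 ∧ (∀ x, g.val x (V x) (V x) = r) ∧
    ∀ D K : Set M, IsOpen D → IsCompact (closure D) → IsCompact K → K ⊆ D →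
    ∀ ε : ℝ, 0 < ε → ∀ W : ℝ → VF m M,
      ContMDiffOn (𝓘(ℝ).prod (𝓡 m)) ((𝓡 m).prod 𝓘(ℝ, EuclideanSpace ℝ (Fin m))) ∞
        (fun p : ℝ × M ↦ TotalSpace.mk' (EuclideanSpace ℝ (Fin m)) p.2 (W p.1 p.2))
        (Set.Ioo (-ε) ε ×ˢ Set.univ) →
      (∀ x, W 0 x = V x) →
      (∀ t ∈ Set.Ioo (-ε) ε, ∀ x, g.val x (W t x) (W t x) = r) →
      (∀ t ∈ Set.Ioo (-ε) ε, ∀ x ∉ K, W t x = V x) →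
      HasDerivAt (fun t ↦ energy g D (W t)) 0 0

/-- The exterior derivative of a 1-form, with the convention
`2 dη(X, Y) = X η(Y) - Y η(X) - η([X, Y])`. -/
def extDerivOne (η : Π x : M, TangentSpace (𝓡 m) x →L[ℝ] ℝ) (X Y : VF m M) (x : M) : ℝ :=
  2⁻¹ * (mvfderiv (𝓡 m) (fun y ↦ η y (Y y)) x (X x) - mvfderiv (𝓡 m) (fun y ↦ η y (X y)) x (Y x)
    - η x (mlieBracket (𝓡 m) X Y x))

end SemiRiem

/-! ## Paracontact metric manifolds -/

open SemiRiem in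
/-- A paracontact metric structure `(φ, ξ, η, g)` on a `(2n+1)`-dimensional manifold. (The contact
condition `η ∧ (dη)^n ≠ 0` follows from the last two fields: if `v ∈ ker η` and `dη(v, ·) = 0`, then
`dη(·, v) = g(·, φ v) = 0`, so `φ v = 0` and `v = φ² v = 0`; thus `dη` is nondegenerate on
`ker η`.) -/
structure ParacontactMetric (n : ℕ) (M : Type*) [TopologicalSpace M]
    [ChartedSpace (EuclideanSpace ℝ (Fin (2 * n + 1))) M]
    [IsManifold (𝓡 (2 * n + 1)) ∞ M] where
  /-- The associated semi-Riemannian metric. -/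
  g : Metric (2 * n + 1) M
  /-- The Reeb vector field. -/
  ξ : VF (2 * n + 1) M
  /-- The contact form. -/
  η : Π x : M, TangentSpace (𝓡 (2 * n + 1)) x →L[ℝ] ℝ
  /-- The structure tensor of type (1,1). -/
  φ : Π x : M, TangentSpace (𝓡 (2 * n + 1)) x →L[ℝ] TangentSpace (𝓡 (2 * n + 1)) x
  smooth_ξ : IsSmooth ξ
  smooth_η : ContMDiff (𝓡 (2 * n + 1))
    ((𝓡 (2 * n + 1)).prod 𝓘(ℝ, EuclideanSpace ℝ (Fin (2 * n + 1)) →L[ℝ] ℝ)) ∞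
    (fun x ↦ TotalSpace.mk' (EuclideanSpace ℝ (Fin (2 * n + 1)) →L[ℝ] ℝ)
      (E := fun x : M ↦ TangentSpace (𝓡 (2 * n + 1)) x →L[ℝ] ℝ) x (η x))
  smooth_φ : ContMDiff (𝓡 (2 * n + 1))
    ((𝓡 (2 * n + 1)).prod 𝓘(ℝ, EuclideanSpace ℝ (Fin (2 * n + 1)) →L[ℝ]
      EuclideanSpace ℝ (Fin (2 * n + 1)))) ∞
    (fun x ↦ TotalSpace.mk'
      (EuclideanSpace ℝ (Fin (2 * n + 1)) →L[ℝ] EuclideanSpace ℝ (Fin (2 * n + 1)))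
      (E := fun x : M ↦ TangentSpace (𝓡 (2 * n + 1)) x →L[ℝ] TangentSpace (𝓡 (2 * n + 1)) x)
      x (φ x))
  η_ξ (x : M) : η x (ξ x) = 1
  dη_ξ (Y : VF (2 * n + 1) M) (x : M) (hY : DiffAt Y x) : extDerivOne η ξ Y x = 0
  η_eq (x : M) (v : TangentSpace (𝓡 (2 * n + 1)) x) : η x v = g.val x (ξ x) v
  dη_eq (X Y : VF (2 * n + 1) M) (x : M) (hX : DiffAt X x) (hY : DiffAt Y x) :
    extDerivOne η X Y x = g.val x (X x) (φ x (Y x))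
  φ_sq (x : M) (v : TangentSpace (𝓡 (2 * n + 1)) x) : φ x (φ x v) = v - η x v • ξ x

namespace ParacontactMetric

open SemiRiem

variable {n : ℕ} {M : Type*} [TopologicalSpace M]
  [ChartedSpace (EuclideanSpace ℝ (Fin (2 * n + 1))) M]
  [IsManifold (𝓡 (2 * n + 1)) ∞ M] (S : ParacontactMetric n M)

lemma diffAt_φ {X : VF (2 * n + 1) M} {x : M} (hX : DiffAt X x) :
    DiffAt (fun y ↦ S.φ y (X y)) x :=
  MDifferentiableAt.clm_bundle_apply (F₁ := EuclideanSpace ℝ (Fin (2 * n + 1)))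
    (S.smooth_φ.mdifferentiableAt (by simp)) hX

/-- The Lie derivative `(L_ξ φ) X = [ξ, φ X] - φ [ξ, X]` at the point `x`. -/
def lieφ (X : VF (2 * n + 1) M) (x : M) : TangentSpace (𝓡 (2 * n + 1)) x :=
  mlieBracket (𝓡 (2 * n + 1)) S.ξ (fun y ↦ S.φ y (X y)) x
    - S.φ x (mlieBracket (𝓡 (2 * n + 1)) S.ξ X x)

lemma lieφ_tensorial (x : M) :
    TensorialAt (𝓡 (2 * n + 1)) (EuclideanSpace ℝ (Fin (2 * n + 1))) (fun X ↦ S.lieφ X x) x where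
  smul {f X} hf hX := by
    have e : (fun y ↦ S.φ y ((f • X) y)) = f • fun y ↦ S.φ y (X y) := by ext1 y; simp
    simp only [lieφ, e]
    rw [mlieBracket_smul_right hf (S.diffAt_φ hX), mlieBracket_smul_right hf hX]
    simp
    module
  add {X X'} hX hX' := by
    have e : (fun y ↦ S.φ y ((X + X') y)) = (fun y ↦ S.φ y (X y)) + fun y ↦ S.φ y (X' y) := by
      ext1 y; simp
    simp only [lieφ, e]
    rw [mlieBracket_add_right (S.diffAt_φ hX) (S.diffAt_φ hX'), mlieBracket_add_right hX hX']
    simp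
    module

/-- The tensor `h = ½ L_ξ φ`. -/
def h (x : M) : TangentSpace (𝓡 (2 * n + 1)) x →L[ℝ] TangentSpace (𝓡 (2 * n + 1)) x :=
  (2⁻¹ : ℝ) • TensorialAt.mkHom (fun X ↦ S.lieφ X x) x (S.lieφ_tensorial x)

/-- The function `tr h²`. -/
def trhSq (x : M) : ℝ :=
  LinearMap.trace ℝ (TangentSpace (𝓡 (2 * n + 1)) x)
    (S.h x ∘L S.h x : TangentSpace (𝓡 (2 * n + 1)) x →L[ℝ] TangentSpace (𝓡 (2 * n + 1)) x)

/-- `M` is H-paracontact: its Reeb vector field is a harmonic vector field. -/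
def IsHParacontact [MeasurableSpace M] : Prop := IsHarmonicVF S.g S.ξ

end ParacontactMetric

end

set_option linter.unusedSectionVars false

noncomputable section

/-! ### Smooth vector fields, coordinate frames and directional derivatives -/

namespace SemiRiem

variable {m : ℕ} {M : Type*} [TopologicalSpace M]
  [ChartedSpace (EuclideanSpace ℝ (Fin m)) M] [IsManifold (𝓡 m) ∞ M] (g : Metric m M)

/-! Everything reduces to the vector field Δ̄ξ. Write A = ∇ξ (`gradξ`). Two identities carry the
theorem: Qξ = -Δ̄ξ - 4nξ (`ricciOp_ξ`) and g(Δ̄ξ, ξ) = -2n - tr h² (`val_roughLaplacian_ξ`). By the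
first, the conditions Qξ = -2nξ, Δ̄ξ = -2nξ and Δ̄ξ = Qξ agree at every point, and tr(L_V ∇) = QV -
Δ̄V (`trace_lieDerivConnection`) brings in infinitesimal harmonicity. Harmonicity of ξ forces Δ̄ξ to
be collinear with ξ; by the second identity the factor is then -2n exactly when tr h² = 0.
Conversely, an eigenvector of Δ̄ of constant nonzero length is harmonic.

The tensor identities come from differentiating the axioms. The relation dη = g(·, φ·) says A* = A +
2φ. Closedness of dη is a cyclic identity for ∇φ (`val_dφ_cyclic`); with the derivative of φ² = I -
η⊗ξ it gives φAφ = -A - 2φ, ∇_ξ φ = 0 and tr_g ∇φ = -2nξ (`trace_dφ`). Differentiating A* = A + 2φ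
and contracting the Ricci identity yields Qξ: the trace of ∇²ξ contributes -Δ̄ξ, the term 2 tr_g ∇φ
contributes -4nξ, and tr(∇_w A) vanishes (`tr_hessξ`). The ξ-component of Δ̄ξ is tr(A*A) = tr A² + 2
tr(φA), where A² = φ² - h² and tr(φA) = -2n.

The analytic half starts from E(V + X) - E(V) = ∫ g(Δ̄V, X) + ½ ∫ ⟨∇X, ∇X⟩ for compactly supported X
(`energy_add_sub`), a consequence of the divergence theorem, which is proved here through charts and
a partition of unity. Along a smooth variation the last term is O(t²). If Δ̄V = cV, the linear term
is O(t²) as well, because equal lengths give 2g(V, W - V) = -g(W - V, W - V). Conversely, every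
compactly supported X orthogonal to V is the velocity of a variation of constant length, and testing
with X = FY, F = g(Δ̄V, Y), gives ∫ F² = 0. Squaring a function instead of a vector keeps this
argument valid for indefinite g. -/

lemma two_le_infty : (2 : ℕ∞ω) ≤ ∞ :=
  WithTop.coe_le_coe.2 (le_top : (2 : ℕ∞) ≤ ⊤)

/-- The vector field `X` is smooth at `x`. -/
abbrev SmoothAt (X : VF m M) (x : M) : Prop :=
  ContMDiffAt (𝓡 m) ((𝓡 m).prod 𝓘(ℝ, EuclideanSpace ℝ (Fin m))) ∞
    (fun y ↦ TotalSpace.mk' (EuclideanSpace ℝ (Fin m)) y (X y)) x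

/-- The function `f` is smooth at `x`. -/
abbrev FunSmoothAt (m : ℕ) {M : Type*} [TopologicalSpace M]
    [ChartedSpace (EuclideanSpace ℝ (Fin m)) M] (f : M → ℝ) (x : M) : Prop := ContMDiffAt (𝓡 m) 𝓘(ℝ)
        ∞ f x

/-- The `i`-th coordinate vector field of the preferred chart at `p`. -/
abbrev frame (p : M) (i : Fin m) : VF m M := ext (basisVec p i)

/-- The preferred trivialization of the tangent bundle at `p`. -/
abbrev triv (p : M) := trivializationAt (EuclideanSpace ℝ (Fin m)) (TangentSpace (𝓡 m) : M → Type _)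
    p

/-- The tangent space at `p`, identified with the model space through the preferred chart. -/
def toModel (p : M) : TangentSpace (𝓡 m) p →L[ℝ] EuclideanSpace ℝ (Fin m) :=
  ContinuousLinearMap.id ℝ (EuclideanSpace ℝ (Fin m))

lemma triv_snd_self (p : M) (v : TangentSpace (𝓡 m) p) :
    (triv p (⟨p, v⟩ : TangentBundle (𝓡 m) M)).2 = toModel p v := by
  rw [triv, TangentBundle.trivializationAt_apply]
  exact tangentCoordChange_self (I := 𝓡 m) (x := p) (z := p) (mem_extChartAt_source p)

lemma mem_triv_baseSet {p y : M} : y ∈ (triv p : Trivialization (EuclideanSpace ℝ (Fin m)) 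
      (TotalSpace.proj : TangentBundle (𝓡 m) M → M)).baseSet ↔
    y ∈ (chartAt (EuclideanSpace ℝ (Fin m)) p).source := by
  rw [triv, TangentBundle.trivializationAt_baseSet]

lemma ext_apply {p y : M} (hy : y ∈ (chartAt (EuclideanSpace ℝ (Fin m)) p).source)
    (v : TangentSpace (𝓡 m) p) :
    ext v y = (triv p).symmL ℝ y (toModel p v) := by
  rw [Trivialization.symmL_apply _ (mem_triv_baseSet.2 hy), ← triv_snd_self]
  rfl

/-- This presents `ext v` as the push-forward of a constant field under the inverse chart. It
reduces derivatives and brackets of coordinate fields to Euclidean calculus, and identifies the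
vectors used in `chartGram`. -/
lemma ext_apply_mfderiv {p y : M} (hy : y ∈ (chartAt (EuclideanSpace ℝ (Fin m)) p).source)
    (v : TangentSpace (𝓡 m) p) :
    (ext v y : EuclideanSpace ℝ (Fin m)) =
      mfderiv 𝓘(ℝ, EuclideanSpace ℝ (Fin m)) (𝓡 m) (extChartAt (𝓡 m) p).symm
      (extChartAt (𝓡 m) p y) (toModel p v) := by
  rw [ext_apply hy, TangentBundle.symmL_trivializationAt hy]
  rw [modelWithCornersSelf_coe, Set.range_id, mfderivWithin_univ]
  rfl

lemma triv_ext {p y : M} (hy : y ∈ (chartAt (EuclideanSpace ℝ (Fin m)) p).source)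
    (v : TangentSpace (𝓡 m) p) :
    (triv p (⟨y, ext v y⟩ : TangentBundle (𝓡 m) M)).2 = toModel p v := by
  rw [ext_apply hy, Trivialization.symmL_apply _ (mem_triv_baseSet.2 hy),
    Trivialization.apply_mk_symm _ (mem_triv_baseSet.2 hy)]

lemma smoothAt_iff {X : VF m M} {p y : M}
    (hy : y ∈ (chartAt (EuclideanSpace ℝ (Fin m)) p).source) :
    SmoothAt X y ↔ ContMDiffAt (𝓡 m) 𝓘(ℝ, EuclideanSpace ℝ (Fin m)) ∞
      (fun z ↦ (triv p (⟨z, X z⟩ : TangentBundle (𝓡 m) M)).2) y :=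
  (triv p).contMDiffAt_section_iff (mem_triv_baseSet.2 hy)

lemma source_mem_nhds {p y : M} (hy : y ∈ (chartAt (EuclideanSpace ℝ (Fin m)) p).source) :
    (chartAt (EuclideanSpace ℝ (Fin m)) p).source ∈ 𝓝 y :=
  (chartAt (EuclideanSpace ℝ (Fin m)) p).open_source.mem_nhds hy

lemma smoothAt_ext {p y : M} (hy : y ∈ (chartAt (EuclideanSpace ℝ (Fin m)) p).source)
    (v : TangentSpace (𝓡 m) p) : SmoothAt (ext v) y := by
  rw [smoothAt_iff hy]
  refine (contMDiffAt_const (c := toModel p v)).congr_of_eventuallyEq ?_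
  filter_upwards [source_mem_nhds hy] with z hz using triv_ext hz v

/-- The components of `v` in the coordinate frame of the chart at `p`. -/
def coord (p : M) (i : Fin m) (y : M) (v : TangentSpace (𝓡 m) y) : ℝ :=
  (triv p (⟨y, v⟩ : TangentBundle (𝓡 m) M)).2 i

/-- The basis of the tangent space at `y` given by the coordinate frame of the chart at `p`. -/
def frameBasis {p y : M} (hy : y ∈ (chartAt (EuclideanSpace ℝ (Fin m)) p).source) :
    Module.Basis (Fin m) ℝ (TangentSpace (𝓡 m) y) :=
  (triv p).basisAt (EuclideanSpace.basisFun (Fin m) ℝ).toBasis (mem_triv_baseSet.2 hy)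

lemma frameBasis_apply {p y : M} (hy : y ∈ (chartAt (EuclideanSpace ℝ (Fin m)) p).source)
    (i : Fin m) : frameBasis hy i = frame p i y := by
  rw [frame, ext_apply hy, Trivialization.symmL_apply _ (mem_triv_baseSet.2 hy)]
  simp [frameBasis, Trivialization.basisAt, basisVec]
  rfl

lemma frameBasis_repr {p y : M} (hy : y ∈ (chartAt (EuclideanSpace ℝ (Fin m)) p).source)
    (v : TangentSpace (𝓡 m) y) (i : Fin m) : (frameBasis hy).repr v i = coord p i y v := by
  simp [frameBasis, Trivialization.basisAt, coord, triv]

lemma eq_sum_coord {p y : M} (hy : y ∈ (chartAt (EuclideanSpace ℝ (Fin m)) p).source)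
    (v : TangentSpace (𝓡 m) y) : v = ∑ i, coord p i y v • frame p i y := by
  conv_lhs => rw [← (frameBasis hy).sum_repr v]
  simp only [frameBasis_repr, frameBasis_apply]

lemma smoothAt_iff_coord {X : VF m M} {p y : M}
    (hy : y ∈ (chartAt (EuclideanSpace ℝ (Fin m)) p).source) :
    SmoothAt X y ↔ ∀ i, FunSmoothAt m (fun z ↦ coord p i z (X z)) y := by
  rw [smoothAt_iff hy]
  refine ⟨fun h i ↦
      ((EuclideanSpace.proj i : (EuclideanSpace ℝ (Fin m)) →L[ℝ] ℝ).contMDiff.contMDiffAt.comp y h),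
    fun h ↦ ?_⟩
  have : ContMDiffAt (𝓡 m) 𝓘(ℝ, EuclideanSpace ℝ (Fin m)) ∞
      (fun z ↦ (EuclideanSpace.equiv (Fin m) ℝ).symm fun i ↦ coord p i z (X z)) y :=
    ((EuclideanSpace.equiv (Fin m) ℝ).symm : (Fin m → ℝ) →L[ℝ] EuclideanSpace ℝ
        (Fin m)).contMDiff.contMDiffAt.comp y (contMDiffAt_pi_space.2 h)
  exact this

lemma SmoothAt.add {X Y : VF m M} {x : M} (hX : SmoothAt X x) (hY : SmoothAt Y x) :
    SmoothAt (X + Y) x := ContMDiffAt.add_section hX hY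

lemma SmoothAt.sub {X Y : VF m M} {x : M} (hX : SmoothAt X x) (hY : SmoothAt Y x) :
    SmoothAt (X - Y) x := ContMDiffAt.sub_section hX hY

lemma SmoothAt.smul {f : M → ℝ} {X : VF m M} {x : M} (hf : FunSmoothAt m f x) (hX : SmoothAt X x) :
    SmoothAt (f • X) x := ContMDiffAt.smul_section hf hX

lemma SmoothAt.diffAt {X : VF m M} {x : M} (hX : SmoothAt X x) : DiffAt X x :=
  hX.mdifferentiableAt (by simp)

lemma SmoothAt.eventually_diffAt {X : VF m M} {x : M} (hX : SmoothAt X x) :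
    ∀ᶠ y in 𝓝 x, DiffAt X y := by
  -- Being C^∞ at a point is not an open condition, since the neighbourhood may shrink with the
  -- order; being C¹ there is.
  have : ContMDiffAt (𝓡 m) ((𝓡 m).prod 𝓘(ℝ, EuclideanSpace ℝ (Fin m))) 1
    (fun y ↦ TotalSpace.mk' (EuclideanSpace ℝ (Fin m)) y (X y)) x := hX.of_le (by simp)
  filter_upwards [(contMDiffAt_iff_contMDiffAt_nhds (by simp)).1 this] with y hy using
      hy.mdifferentiableAt (by simp)

lemma FunSmoothAt.mdiffAt {f : M → ℝ} {x : M} (hf : FunSmoothAt m f x) :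
    MDifferentiableAt (𝓡 m) 𝓘(ℝ) f x := hf.mdifferentiableAt (by simp)

lemma FunSmoothAt.eventually_mdiffAt {f : M → ℝ} {x : M} (hf : FunSmoothAt m f x) :
    ∀ᶠ y in 𝓝 x, MDifferentiableAt (𝓡 m) 𝓘(ℝ) f y := by
  have : ContMDiffAt (𝓡 m) 𝓘(ℝ) 1 f x := hf.of_le (by simp)
  filter_upwards [(contMDiffAt_iff_contMDiffAt_nhds (by simp)).1 this] with y hy using
      hy.mdifferentiableAt (by simp)

lemma SmoothAt.pair {X Y : VF m M} {x : M} (hX : SmoothAt X x) (hY : SmoothAt Y x) :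
    FunSmoothAt m (pair g X Y) x := by
  have : ContMDiffAt (𝓡 m) ((𝓡 m).prod 𝓘(ℝ)) ∞
      (fun y ↦ TotalSpace.mk' ℝ (E := Bundle.Trivial M ℝ) y (g.val y (X y) (Y y))) x :=
    ContMDiffAt.clm_bundle_apply₂ (F₁ := (EuclideanSpace ℝ (Fin m)))
      (F₂ := (EuclideanSpace ℝ (Fin m))) (g.smooth x) hX hY
  rw [contMDiffAt_totalSpace] at this
  exact this.2

lemma SmoothAt.lieBracket {X Y : VF m M} {x : M} (hX : SmoothAt X x) (hY : SmoothAt Y x) :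
    SmoothAt (mlieBracket (𝓡 m) X Y) x := by
  have : IsManifold (𝓡 m) (minSmoothness ℝ 2) M := by
    rw [minSmoothness_of_isRCLikeNormedField]
    exact IsManifold.of_le two_le_infty
  have : IsManifold (𝓡 m) (((⊤ : ℕ∞) : ℕ∞ω) + 1) M := by simpa
  exact ContMDiffAt.mlieBracket_vectorField (m := ⊤) (n := ⊤) hX hY (by simp)

/-- The derivative of the function `f` along the vector field `X`. -/
def deriv (X : VF m M) (f : M → ℝ) (y : M) : ℝ := mvfderiv (𝓡 m) f y (X y)

lemma extChartAt_target_mem_nhds' {p y : M} (hy : y ∈ (chartAt (EuclideanSpace ℝ (Fin m)) p).source)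
    :
    (extChartAt (𝓡 m) p).target ∈ 𝓝 (extChartAt (𝓡 m) p y) :=
  (isOpen_extChartAt_target p).mem_nhds
    ((extChartAt (𝓡 m) p).map_source (by rwa [extChartAt_source]))

lemma contMDiffAt_extChartAt_symm {p y : M} (hy : y ∈ (chartAt (EuclideanSpace ℝ (Fin m)) p).source)
    :
    ContMDiffAt 𝓘(ℝ, EuclideanSpace ℝ (Fin m)) (𝓡 m) ∞ (extChartAt (𝓡 m) p).symm
        (extChartAt (𝓡 m) p y) :=
  (contMDiffOn_extChartAt_symm p).contMDiffAt (extChartAt_target_mem_nhds' hy)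

lemma left_inv_extChartAt {p y : M} (hy : y ∈ (chartAt (EuclideanSpace ℝ (Fin m)) p).source) :
    (extChartAt (𝓡 m) p).symm (extChartAt (𝓡 m) p y) = y :=
  (extChartAt (𝓡 m) p).left_inv (by rwa [extChartAt_source])

lemma FunSmoothAt.contDiffAt {f : M → ℝ} {p y : M}
    (hy : y ∈ (chartAt (EuclideanSpace ℝ (Fin m)) p).source)
    (hf : FunSmoothAt m f y) :
    ContDiffAt ℝ ∞ (f ∘ (extChartAt (𝓡 m) p).symm) (extChartAt (𝓡 m) p y) := by
  rw [← contMDiffAt_iff_contDiffAt]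
  exact ContMDiffAt.comp_of_eq hf (contMDiffAt_extChartAt_symm hy) (left_inv_extChartAt hy)

lemma mvfderiv_ext {f : M → ℝ} {p y : M} (hy : y ∈ (chartAt (EuclideanSpace ℝ (Fin m)) p).source)
    (hf : MDifferentiableAt (𝓡 m) 𝓘(ℝ) f y) (v : TangentSpace (𝓡 m) p) :
    mvfderiv (𝓡 m) f y (ext v y) =
      fderiv ℝ (f ∘ (extChartAt (𝓡 m) p).symm) (extChartAt (𝓡 m) p y) (toModel p v) := by
  have h1 := (contMDiffAt_extChartAt_symm hy).mdifferentiableAt (by simp)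
  have h2 := mvfderiv_comp_apply_of_eq (I := 𝓘(ℝ, EuclideanSpace ℝ (Fin m))) (extChartAt (𝓡 m) p y)
      hf h1
    (left_inv_extChartAt hy) (toModel p v)
  rw [mvfderiv, mfderiv_eq_fderiv] at h2
  exact (congr(mvfderiv (𝓡 m) f y $(ext_apply_mfderiv hy v))).trans h2.symm

lemma FunSmoothAt.fderiv {f : M → ℝ} {p y : M}
    (hy : y ∈ (chartAt (EuclideanSpace ℝ (Fin m)) p).source)
    (hf : FunSmoothAt m f y) (v : EuclideanSpace ℝ (Fin m)) :
    FunSmoothAt m (fun z ↦ fderiv ℝ (f ∘ (extChartAt (𝓡 m) p).symm) (extChartAt (𝓡 m) p z) v) y :=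
        by
  have h1 : ContDiffAt ℝ ∞ (fun w ↦ _root_.fderiv ℝ (f ∘ (extChartAt (𝓡 m) p).symm) w v)
      (extChartAt (𝓡 m) p y) :=
    ((hf.contDiffAt hy).fderiv_right (by simp)).clm_apply contDiffAt_const
  exact h1.contMDiffAt.comp y (contMDiffAt_extChartAt' hy)

/-- In a chart the derivative is ∑ Xⁱ ∂ᵢf, a sum of products of smooth functions. -/
lemma FunSmoothAt.deriv {X : VF m M} {f : M → ℝ} {x : M} (hX : SmoothAt X x)
    (hf : FunSmoothAt m f x) : FunSmoothAt m (deriv X f) x := by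
  have hx := mem_chart_source (EuclideanSpace ℝ (Fin m)) x
  have h2 : FunSmoothAt m (fun y ↦ ∑ i, coord x i y (X y) *
      _root_.fderiv ℝ (f ∘ (extChartAt (𝓡 m) x).symm) (extChartAt (𝓡 m) x y)
        (toModel x (basisVec x i))) x :=
    ContMDiffAt.sum fun i _ ↦ ((smoothAt_iff_coord hx).1 hX i).mul (hf.fderiv hx _)
  refine h2.congr_of_eventuallyEq ?_
  filter_upwards [source_mem_nhds hx, hf.eventually_mdiffAt] with y hy hfy
  rw [SemiRiem.deriv, eq_sum_coord hy (X y), map_sum]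
  refine Finset.sum_congr rfl fun i _ ↦ ?_
  rw [map_smul, frame, mvfderiv_ext hy hfy, smul_eq_mul]
  simp only [← eq_sum_coord hy (X y)]

/-- Both sides are the second derivative of the chart expression of f, which is symmetric. The skew
symmetries of curvature and the closedness of dη rest on this. -/
lemma deriv_ext_comm {f : M → ℝ} {p : M} (hf : FunSmoothAt m f p)
    (u v : TangentSpace (𝓡 m) p) :
    SemiRiem.deriv (ext u) (SemiRiem.deriv (ext v) f) p =
      SemiRiem.deriv (ext v) (SemiRiem.deriv (ext u) f) p := by
  have hp := mem_chart_source (EuclideanSpace ℝ (Fin m)) p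
  have key (u v : TangentSpace (𝓡 m) p) : SemiRiem.deriv (ext u) (SemiRiem.deriv (ext v) f) p =
      _root_.fderiv ℝ (_root_.fderiv ℝ (f ∘ (extChartAt (𝓡 m) p).symm)) (extChartAt (𝓡 m) p p)
        (toModel p u) (toModel p v) := by
    rw [SemiRiem.deriv, mvfderiv_ext hp (FunSmoothAt.deriv (smoothAt_ext hp v) hf).mdiffAt]
    have hd : DifferentiableAt ℝ (_root_.fderiv ℝ (f ∘ (extChartAt (𝓡 m) p).symm))
        (extChartAt (𝓡 m) p p) :=
      ((hf.contDiffAt hp).fderiv_right (m := 1) (by rw [one_add_one_eq_two]; exact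
          two_le_infty)).differentiableAt (by simp)
    have : SemiRiem.deriv (ext v) f ∘ (extChartAt (𝓡 m) p).symm =ᶠ[𝓝 (extChartAt (𝓡 m) p p)]
        fun w ↦ _root_.fderiv ℝ (f ∘ (extChartAt (𝓡 m) p).symm) w (toModel p v) := by
      have hc : Filter.Tendsto (extChartAt (𝓡 m) p).symm (𝓝 (extChartAt (𝓡 m) p p)) (𝓝 p) := by
        have := (contMDiffAt_extChartAt_symm hp).continuousAt.tendsto
        rwa [left_inv_extChartAt hp] at this
      filter_upwards [hc.eventually hf.eventually_mdiffAt, extChartAt_target_mem_nhds' hp]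
        with w hw hwt
      have hs : (extChartAt (𝓡 m) p).symm w ∈ (chartAt (EuclideanSpace ℝ (Fin m)) p).source := by
        rw [← extChartAt_source (𝓡 m)]
        exact (extChartAt (𝓡 m) p).map_target hwt
      rw [Function.comp_apply, SemiRiem.deriv, mvfderiv_ext hs hw,
        (extChartAt (𝓡 m) p).right_inv hwt]
    rw [this.fderiv_eq, fderiv_clm_apply hd (differentiableAt_const _)]
    simp
  rw [key, key]
  exact ((hf.contDiffAt hp).isSymmSndFDerivAt (by simpa using two_le_infty)).eq _ _

/-- The inverse chart pulls coordinate fields back to constant fields, whose bracket is zero, and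
brackets are natural under pullback. -/
lemma lieBracket_ext_ext {p y : M} (hy : y ∈ (chartAt (EuclideanSpace ℝ (Fin m)) p).source)
    (u v : TangentSpace (𝓡 m) p) : mlieBracket (𝓡 m) (ext u) (ext v) y = 0 := by
  have : IsManifold (𝓡 m) (minSmoothness ℝ 3) M := by
    rw [minSmoothness_of_isRCLikeNormedField]
    exact IsManifold.of_le (n := ∞) (WithTop.coe_le_coe.2 (le_top : (3 : ℕ∞) ≤ ⊤))
  set w := extChartAt (𝓡 m) p y with hw
  have hwy : (extChartAt (𝓡 m) p).symm w = y := left_inv_extChartAt hy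
  have hinv (z : EuclideanSpace ℝ (Fin m)) (hz : z ∈ (extChartAt (𝓡 m) p).target) :
      (mfderiv 𝓘(ℝ, EuclideanSpace ℝ (Fin m)) (𝓡 m) (extChartAt (𝓡 m) p).symm z).IsInvertible := by
    have := isInvertible_mfderivWithin_extChartAt_symm (I := 𝓡 m) hz
    rwa [modelWithCornersSelf_coe, Set.range_id, mfderivWithin_univ] at this
  have hpull (v : TangentSpace (𝓡 m) p) :
      mpullback 𝓘(ℝ, EuclideanSpace ℝ (Fin m)) (𝓡 m) (extChartAt (𝓡 m) p).symm (ext v) =ᶠ[𝓝 w]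
        fun _ ↦ toModel p v := by
    filter_upwards [extChartAt_target_mem_nhds' hy] with z hz
    have hs : (extChartAt (𝓡 m) p).symm z ∈ (chartAt (EuclideanSpace ℝ (Fin m)) p).source := by
      rw [← extChartAt_source (𝓡 m)]
      exact (extChartAt (𝓡 m) p).map_target hz
    have h := ext_apply_mfderiv hs v
    rw [(extChartAt (𝓡 m) p).right_inv hz] at h
    rw [mpullback_apply]
    refine (congrArg _ h).trans ?_
    exact (hinv z hz).inverse_apply_eq.2 rfl
  have h1 := mpullback_mlieBracket (I := 𝓘(ℝ, EuclideanSpace ℝ (Fin m))) (I' := 𝓡 m)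
      (f := (extChartAt (𝓡 m) p).symm)
    (V := ext u) (W := ext v) (x₀ := w) (n := ∞)
    (by rw [hwy]; exact (smoothAt_ext hy u).diffAt)
    (by rw [hwy]; exact (smoothAt_ext hy v).diffAt)
    (contMDiffAt_extChartAt_symm hy) (by simpa using two_le_infty)
  rw [Filter.EventuallyEq.mlieBracket_vectorField_eq (hpull u) (hpull v)] at h1
  have h2 : mlieBracketWithin 𝓘(ℝ, EuclideanSpace ℝ (Fin m)) (fun z : (EuclideanSpace ℝ (Fin m)) ↦
      (toModel p u : TangentSpace 𝓘(ℝ, EuclideanSpace ℝ (Fin m)) z))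
      (fun _ ↦ toModel p v) Set.univ w = 0 := by
    refine (congrFun mlieBracketWithin_eq_lieBracketWithin w).trans ?_
    rw [lieBracketWithin_univ]
    simp [lieBracket_eq]
    rfl
  rw [← mlieBracketWithin_univ] at h1
  replace h1 := h1.trans h2
  rw [mpullback_apply] at h1
  have h3 := (hinv w (mem_of_mem_nhds (extChartAt_target_mem_nhds' (M := M) hy))).inverse_apply_eq.1
      h1
  rw [map_zero, hwy] at h3
  exact h3

end SemiRiem

namespace SemiRiem

variable {m : ℕ} {M : Type*} [TopologicalSpace M]
  [ChartedSpace (EuclideanSpace ℝ (Fin m)) M] [IsManifold (𝓡 m) ∞ M] (g : Metric m M)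

/-! ### Gram matrices, metric traces and adjoints at a point -/

section LinearAlgebra

variable {p y : M}

/-- The Gram matrix of a family of tangent vectors. -/
def gramOf (y : M) (e : Fin m → TangentSpace (𝓡 m) y) : Matrix (Fin m) (Fin m) ℝ :=
  Matrix.of fun i j ↦ g.val y (e i) (e j)

lemma gramOf_transpose (e : Fin m → TangentSpace (𝓡 m) y) :
    (gramOf g y e).transpose = gramOf g y e := by
  ext i j; simp [gramOf, g.symm y (e i)]

/-- A kernel vector of the Gram matrix would give a nontrivial combination of the basis orthogonal
to the whole tangent space. -/
lemma gramOf_det_ne_zero (e : Module.Basis (Fin m) ℝ (TangentSpace (𝓡 m) y)) :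
    (gramOf g y e).det ≠ 0 := by
  intro h
  obtain ⟨c, hc, h⟩ := Matrix.exists_mulVec_eq_zero_iff.2 h
  have h0 : ∑ j, c j • e j = 0 := by
    apply g.nondegenerate y
    intro w
    rw [← e.sum_repr w, map_sum]
    refine Finset.sum_eq_zero fun i _ ↦ ?_
    have := congrFun h i
    simp only [Matrix.mulVec, dotProduct, gramOf, Matrix.of_apply, Pi.zero_apply] at this
    rw [map_smul, g.symm, map_sum]
    simp only [map_smul, smul_eq_mul, mul_comm (c _)]
    rw [this, mul_zero]
  exact hc (funext fun i ↦ Fintype.linearIndependent_iff.1 e.linearIndependent c h0 i)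

lemma gramOf_inv_symm (e : Fin m → TangentSpace (𝓡 m) y) (i j : Fin m) :
    (gramOf g y e)⁻¹ i j = (gramOf g y e)⁻¹ j i := by
  conv_lhs => rw [← gramOf_transpose, ← Matrix.transpose_nonsing_inv, Matrix.transpose_apply]

/-- Components in a basis are obtained by pairing with the dual basis. -/
lemma repr_eq_sum_gramOf_inv (e : Module.Basis (Fin m) ℝ (TangentSpace (𝓡 m) y))
    (v : TangentSpace (𝓡 m) y) (i : Fin m) :
    e.repr v i = ∑ j, (gramOf g y e)⁻¹ i j * g.val y v (e j) := by
  have h : ∀ k, ∑ j, (gramOf g y e)⁻¹ i j * g.val y (e k) (e j) = if i = k then 1 else 0 := by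
    intro k
    have := congrFun (congrFun (Matrix.nonsing_inv_mul (gramOf g y e)
      (isUnit_iff_ne_zero.2 (gramOf_det_ne_zero g e))) i) k
    rw [Matrix.mul_apply, Matrix.one_apply] at this
    rw [← this]
    exact Finset.sum_congr rfl fun j _ ↦ by rw [gramOf, Matrix.of_apply, g.symm]
  conv_rhs => rw [← e.sum_repr v]
  simp only [map_sum, map_smul, sum_apply, smul_apply, smul_eq_mul,
    Finset.mul_sum]
  rw [Finset.sum_comm]
  have : ∀ k, ∑ j, (gramOf g y e)⁻¹ i j * (e.repr v k * g.val y (e k) (e j)) =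
      e.repr v k * if i = k then 1 else 0 := by
    intro k
    rw [← h k, Finset.mul_sum]
    exact Finset.sum_congr rfl fun j _ ↦ by ring
  simp [this]

lemma sum_gramOf_inv_eq_trace (e : Module.Basis (Fin m) ℝ (TangentSpace (𝓡 m) y))
    (L : TangentSpace (𝓡 m) y →ₗ[ℝ] TangentSpace (𝓡 m) y) :
    ∑ i, ∑ j, (gramOf g y e)⁻¹ i j * g.val y (L (e i)) (e j) =
      LinearMap.trace ℝ (TangentSpace (𝓡 m) y) L := by
  rw [LinearMap.trace_eq_matrix_trace ℝ e L, Matrix.trace]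
  refine Finset.sum_congr rfl fun i _ ↦ ?_
  rw [Matrix.diag_apply, LinearMap.toMatrix_apply, repr_eq_sum_gramOf_inv g e]

/-- The standard basis of the tangent space. -/
def stdBasis (y : M) : Module.Basis (Fin m) ℝ (TangentSpace (𝓡 m) y) :=
  frameBasis (mem_chart_source (EuclideanSpace ℝ (Fin m)) y)

lemma stdBasis_apply (y : M) (i : Fin m) : stdBasis y i = basisVec y i := by
  rw [stdBasis, frameBasis_apply]
  exact FiberBundle.extend_apply_self ..

lemma gram_eq (y : M) : gram g y = gramOf g y (stdBasis y) := by
  ext i j; simp [gram, gramOf, stdBasis_apply]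

lemma trace_eq_stdBasis {F : Type*} [AddCommGroup F] [Module ℝ F] (y : M)
    (b : TangentSpace (𝓡 m) y → TangentSpace (𝓡 m) y → F) :
    trace g y b = ∑ i, ∑ j, (gramOf g y (stdBasis y))⁻¹ i j • b (stdBasis y i) (stdBasis y j) := by
  rw [trace, gram_eq]; simp only [stdBasis_apply]

lemma trace_val (L : TangentSpace (𝓡 m) y →ₗ[ℝ] TangentSpace (𝓡 m) y) :
    trace g y (fun u v ↦ g.val y (L u) v) = LinearMap.trace ℝ (TangentSpace (𝓡 m) y) L := by
  rw [trace_eq_stdBasis, ← sum_gramOf_inv_eq_trace g (stdBasis y)]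
  rfl

lemma trace_swap {F : Type*} [AddCommGroup F] [Module ℝ F]
    (b : TangentSpace (𝓡 m) y → TangentSpace (𝓡 m) y → F) :
    trace g y (fun u v ↦ b v u) = trace g y b := by
  rw [trace_eq_stdBasis, trace_eq_stdBasis, Finset.sum_comm]
  refine Finset.sum_congr rfl fun i _ ↦ Finset.sum_congr rfl fun j _ ↦ ?_
  rw [gramOf_inv_symm]

lemma trace_add {F : Type*} [AddCommGroup F] [Module ℝ F]
    (b b' : TangentSpace (𝓡 m) y → TangentSpace (𝓡 m) y → F) :
    trace g y (fun u v ↦ b u v + b' u v) = trace g y b + trace g y b' := by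
  simp only [trace, smul_add, Finset.sum_add_distrib]

lemma trace_smul {F : Type*} [AddCommGroup F] [Module ℝ F] (c : ℝ)
    (b : TangentSpace (𝓡 m) y → TangentSpace (𝓡 m) y → F) :
    trace g y (fun u v ↦ c • b u v) = c • trace g y b := by
  simp only [trace, Finset.smul_sum, smul_comm c]

lemma trace_neg {F : Type*} [AddCommGroup F] [Module ℝ F]
    (b : TangentSpace (𝓡 m) y → TangentSpace (𝓡 m) y → F) :
    trace g y (fun u v ↦ -b u v) = -trace g y b := by
  simp only [trace, smul_neg, Finset.sum_neg_distrib]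

lemma trace_sub {F : Type*} [AddCommGroup F] [Module ℝ F]
    (b b' : TangentSpace (𝓡 m) y → TangentSpace (𝓡 m) y → F) :
    trace g y (fun u v ↦ b u v - b' u v) = trace g y b - trace g y b' := by
  simp only [trace, smul_sub, Finset.sum_sub_distrib]

lemma map_trace {F F' : Type*} [AddCommGroup F] [Module ℝ F] [AddCommGroup F'] [Module ℝ F']
    (L : F →ₗ[ℝ] F') (b : TangentSpace (𝓡 m) y → TangentSpace (𝓡 m) y → F) :
    L (trace g y b) = trace g y (fun u v ↦ L (b u v)) := by
  simp only [trace, map_sum, map_smul]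

lemma val_trace (b : TangentSpace (𝓡 m) y → TangentSpace (𝓡 m) y → TangentSpace (𝓡 m) y)
    (w : TangentSpace (𝓡 m) y) :
    g.val y (trace g y b) w = trace g y (fun u v ↦ g.val y (b u v) w) := by
  simp only [trace, map_sum, map_smul, sum_apply, smul_apply]

/-- The reproducing formula ∑ εᵢ g(v, Eᵢ) L(Eᵢ) = L(v). -/
lemma trace_val_smul (L : TangentSpace (𝓡 m) y →ₗ[ℝ] ℝ) (v : TangentSpace (𝓡 m) y) :
    trace g y (fun u w ↦ g.val y v w * L u) = L v := by
  conv_rhs => rw [← (stdBasis y).sum_repr v, map_sum]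
  rw [trace_eq_stdBasis]
  refine Finset.sum_congr rfl fun i _ ↦ ?_
  rw [map_smul, repr_eq_sum_gramOf_inv g, Finset.sum_smul]
  simp [mul_assoc]

/-- The endomorphism representing a bilinear form. -/
def endoOf (B : TangentSpace (𝓡 m) y →ₗ[ℝ] TangentSpace (𝓡 m) y →ₗ[ℝ] ℝ) :
    TangentSpace (𝓡 m) y →ₗ[ℝ] TangentSpace (𝓡 m) y :=
  (flatEquiv g y).symm.toLinearMap ∘ₗ B

lemma val_endoOf (B : TangentSpace (𝓡 m) y →ₗ[ℝ] TangentSpace (𝓡 m) y →ₗ[ℝ] ℝ)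
    (u v : TangentSpace (𝓡 m) y) : g.val y (endoOf g B u) v = B u v :=
  congr($((flatEquiv g y).apply_symm_apply (B u)) v)

/-- Rewriting the metric trace as the trace of an endomorphism makes it independent of the basis and
gives access to cyclicity. -/
lemma trace_bilin (B : TangentSpace (𝓡 m) y →ₗ[ℝ] TangentSpace (𝓡 m) y →ₗ[ℝ] ℝ) :
    trace g y (fun u v ↦ B u v) = LinearMap.trace ℝ (TangentSpace (𝓡 m) y) (endoOf g B) := by
  rw [← trace_val g]; simp only [val_endoOf]

/-- The metric trace of a bilinear form can be computed in any coordinate frame. -/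
lemma trace_eq_frame (hy : y ∈ (chartAt (EuclideanSpace ℝ (Fin m)) p).source)
    (B : TangentSpace (𝓡 m) y →ₗ[ℝ] TangentSpace (𝓡 m) y →ₗ[ℝ] ℝ) :
    trace g y (fun u v ↦ B u v) =
      ∑ i, ∑ j, (gramOf g y (frame p · y))⁻¹ i j * B (frame p i y) (frame p j y) := by
  have : (frame p · y) = frameBasis hy := by funext i; rw [frameBasis_apply]
  rw [trace_bilin, ← sum_gramOf_inv_eq_trace g (frameBasis hy), this]
  simp only [val_endoOf, frameBasis_apply]

/-- The adjoint of an endomorphism with respect to the metric. -/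
def adjoint (L : TangentSpace (𝓡 m) y →ₗ[ℝ] TangentSpace (𝓡 m) y) :
    TangentSpace (𝓡 m) y →ₗ[ℝ] TangentSpace (𝓡 m) y :=
  endoOf g (LinearMap.mk₂ ℝ (fun u v ↦ g.val y u (L v)) (by simp) (by simp) (by simp) (by simp))

lemma val_adjoint (L : TangentSpace (𝓡 m) y →ₗ[ℝ] TangentSpace (𝓡 m) y)
    (u v : TangentSpace (𝓡 m) y) : g.val y (adjoint g L u) v = g.val y u (L v) := by
  rw [adjoint, val_endoOf]; rfl

/-- Once B is represented by an endomorphism, this is tr(BL) = tr(LB). -/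
lemma trace_bilin_comp_left (B : TangentSpace (𝓡 m) y →ₗ[ℝ] TangentSpace (𝓡 m) y →ₗ[ℝ] ℝ)
    (L : TangentSpace (𝓡 m) y →ₗ[ℝ] TangentSpace (𝓡 m) y) :
    trace g y (fun u v ↦ B (L u) v) = trace g y (fun u v ↦ B u (adjoint g L v)) := by
  have h1 : trace g y (fun u v ↦ B (L u) v) =
      LinearMap.trace ℝ (TangentSpace (𝓡 m) y) (endoOf g B ∘ₗ L) := by
    rw [← trace_val g]; simp only [LinearMap.comp_apply, val_endoOf]
  have h2 : trace g y (fun u v ↦ B u (adjoint g L v)) =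
      LinearMap.trace ℝ (TangentSpace (𝓡 m) y) (L ∘ₗ endoOf g B) := by
    rw [← trace_val g]
    simp only [LinearMap.comp_apply]
    congr; funext u v
    rw [← val_endoOf g B, g.symm, val_adjoint, g.symm]
  rw [h1, h2, LinearMap.trace_comp_comm']

end LinearAlgebra

/-! ### Smoothness of ∇_X Y and of adjoint fields -/

section Smoothness

lemma FunSmoothAt.det {ι : Type*} [Fintype ι] [DecidableEq ι] {G : M → Matrix ι ι ℝ} {x : M}
    (hG : ∀ i j, FunSmoothAt m (fun y ↦ G y i j) x) : FunSmoothAt m (fun y ↦ (G y).det) x := by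
  simp only [Matrix.det_apply']
  refine ContMDiffAt.sum fun σ _ ↦ ?_
  exact contMDiffAt_const.mul (contMDiffAt_finsetProd fun i _ ↦ hG _ _)

lemma FunSmoothAt.matrix_inv {ι : Type*} [Fintype ι] [DecidableEq ι] {G : M → Matrix ι ι ℝ} {x : M}
    (hG : ∀ i j, FunSmoothAt m (fun y ↦ G y i j) x) (hx : (G x).det ≠ 0) (i j : ι) :
    FunSmoothAt m (fun y ↦ (G y)⁻¹ i j) x := by
  simp only [Matrix.inv_def, Ring.inverse_eq_inv', Matrix.smul_apply, smul_eq_mul,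
    Matrix.adjugate_apply]
  refine ((FunSmoothAt.det hG).inv₀ hx).mul (FunSmoothAt.det fun k l ↦ ?_)
  simp only [Matrix.updateRow_apply]
  split_ifs
  · exact contMDiffAt_const
  · exact hG _ _

variable {g} {p y : M}

lemma smoothAt_frame (hy : y ∈ (chartAt (EuclideanSpace ℝ (Fin m)) p).source) (i : Fin m) :
    SmoothAt (frame p i) y := smoothAt_ext hy _

lemma gramOf_frame_det_ne_zero (hy : y ∈ (chartAt (EuclideanSpace ℝ (Fin m)) p).source) :
    (gramOf g y (frame p · y)).det ≠ 0 := by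
  have : (frame p · y) = frameBasis hy := by funext i; rw [frameBasis_apply]
  rw [this]; exact gramOf_det_ne_zero g _

lemma smoothAt_gramOf_frame (hy : y ∈ (chartAt (EuclideanSpace ℝ (Fin m)) p).source) (i j : Fin m) :
    FunSmoothAt m (fun z ↦ gramOf g z (frame p · z) i j) y :=
  (smoothAt_frame hy i).pair g (smoothAt_frame hy j)

lemma smoothAt_gramOf_frame_inv (hy : y ∈ (chartAt (EuclideanSpace ℝ (Fin m)) p).source)
    (i j : Fin m) :
    FunSmoothAt m (fun z ↦ (gramOf g z (frame p · z))⁻¹ i j) y :=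
  FunSmoothAt.matrix_inv (smoothAt_gramOf_frame hy) (gramOf_frame_det_ne_zero hy) i j

lemma coord_eq_sum (hy : y ∈ (chartAt (EuclideanSpace ℝ (Fin m)) p).source)
    (v : TangentSpace (𝓡 m) y) (i : Fin m) :
    coord p i y v = ∑ j, (gramOf g y (frame p · y))⁻¹ i j * g.val y v (frame p j y) := by
  have : (frame p · y) = frameBasis hy := by funext i; rw [frameBasis_apply]
  rw [← frameBasis_repr hy, repr_eq_sum_gramOf_inv g, this]
  simp only [frameBasis_apply]

/-- A vector field is smooth if its products with the vectors of a coordinate frame are. -/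
lemma smoothAt_of_pair {Z : VF m M} (hy : y ∈ (chartAt (EuclideanSpace ℝ (Fin m)) p).source)
    (h : ∀ i, FunSmoothAt m (pair g Z (frame p i)) y) : SmoothAt Z y := by
  rw [smoothAt_iff_coord hy]
  intro i
  have : FunSmoothAt m (fun z ↦ ∑ j, (gramOf g z (frame p · z))⁻¹ i j * pair g Z (frame p j) z) y :=
    ContMDiffAt.sum fun j _ ↦ (smoothAt_gramOf_frame_inv hy i j).mul (h j)
  refine this.congr_of_eventuallyEq ?_
  filter_upwards [source_mem_nhds hy] with z hz using coord_eq_sum hz _ _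

/-- Paired with a coordinate field, ∇_X Y becomes the right-hand side of the Koszul formula, which
is visibly smooth. -/
lemma SmoothAt.nabla {X Y : VF m M} {x : M} (hX : SmoothAt X x) (hY : SmoothAt Y x) :
    SmoothAt (nabla g X Y) x := by
  have hx := mem_chart_source (EuclideanSpace ℝ (Fin m)) x
  refine smoothAt_of_pair (g := g) hx fun i ↦ ?_
  have hZ := smoothAt_frame (m := m) hx i
  have h : FunSmoothAt m (fun y ↦ 2⁻¹ * (SemiRiem.deriv X (SemiRiem.pair g Y (frame x i)) y
      + SemiRiem.deriv Y (SemiRiem.pair g X (frame x i)) y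
      - SemiRiem.deriv (frame x i) (SemiRiem.pair g X Y) y
      + SemiRiem.pair g (mlieBracket (𝓡 m) X Y) (frame x i) y
      - SemiRiem.pair g (mlieBracket (𝓡 m) X (frame x i)) Y y
      - SemiRiem.pair g (mlieBracket (𝓡 m) Y (frame x i)) X y)) x :=
    contMDiffAt_const.mul ((((((FunSmoothAt.deriv hX (hY.pair g hZ)).add
      (FunSmoothAt.deriv hY (hX.pair g hZ))).sub (FunSmoothAt.deriv hZ (hX.pair g hY))).add
      ((hX.lieBracket hY).pair g hZ)).sub ((hX.lieBracket hZ).pair g hY)).sub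
      ((hY.lieBracket hZ).pair g hX))
  refine h.congr_of_eventuallyEq ?_
  filter_upwards [hX.eventually_diffAt, hY.eventually_diffAt, hZ.eventually_diffAt] with y h1 h2 h3
  exact val_leviCivita g h1 h2 h3

variable (g) in
/-- The vector field `(∇Z)^* W`, where `(∇Z)^*` is the adjoint of `v ↦ ∇_v Z`. -/
def adjField (Z W : VF m M) : VF m M := fun y ↦
    adjoint g (leviCivita g Z y : TangentSpace (𝓡 m) y →ₗ[ℝ] _) (W y)

lemma pair_adjField (Z W Y : VF m M) :
    pair g (adjField g Z W) Y = pair g W (nabla g Y Z) := by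
  funext y
  rw [pair, adjField, val_adjoint]
  rfl

lemma SmoothAt.adjField {Z W : VF m M} {x : M} (hZ : SmoothAt Z x) (hW : SmoothAt W x) :
    SmoothAt (adjField g Z W) x := by
  have hx := mem_chart_source (EuclideanSpace ℝ (Fin m)) x
  refine smoothAt_of_pair (g := g) hx fun i ↦ ?_
  rw [pair_adjField]
  exact hW.pair g ((smoothAt_frame hx i).nabla hZ)

end Smoothness

end SemiRiem

namespace SemiRiem

variable {m : ℕ} {M : Type*} [TopologicalSpace M]
  [ChartedSpace (EuclideanSpace ℝ (Fin m)) M] [IsManifold (𝓡 m) ∞ M] (g : Metric m M)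

/-! ### Calculus of the Levi-Civita connection -/

section Calculus

variable {p : M}

lemma ext_self (v : TangentSpace (𝓡 m) p) : ext v p = v := FiberBundle.extend_apply_self ..

lemma smoothAt_ext_self (v : TangentSpace (𝓡 m) p) : SmoothAt (ext v) p :=
  smoothAt_ext (mem_chart_source _ p) v

lemma deriv_congr {X : VF m M} {f f' : M → ℝ} (h : f =ᶠ[𝓝 p] f') : deriv X f p = deriv X f' p := by
  rw [deriv, deriv, mvfderiv, mvfderiv, h.mfderiv_eq, h.eq_of_nhds]

lemma deriv_add {X : VF m M} {f f' : M → ℝ} (hf : FunSmoothAt m f p) (hf' : FunSmoothAt m f' p) :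
    deriv X (f + f') p = deriv X f p + deriv X f' p := by
  rw [deriv, mvfderiv_add hf.mdiffAt hf'.mdiffAt]; rfl

lemma deriv_sub {X : VF m M} {f f' : M → ℝ} (hf : FunSmoothAt m f p) (hf' : FunSmoothAt m f' p) :
    deriv X (f - f') p = deriv X f p - deriv X f' p := by
  rw [deriv, mvfderiv_sub hf.mdiffAt hf'.mdiffAt]; rfl

lemma deriv_mul {X : VF m M} {f f' : M → ℝ} (hf : FunSmoothAt m f p) (hf' : FunSmoothAt m f' p) :
    deriv X (f * f') p = f p * deriv X f' p + f' p * deriv X f p := by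
  rw [deriv, mvfderiv_mul hf.mdiffAt hf'.mdiffAt]; rfl

lemma deriv_const {X : VF m M} (c : ℝ) : deriv X (fun _ ↦ c) p = 0 := by
  rw [deriv, mvfderiv_const]; rfl

lemma pair_comm (X Y : VF m M) : pair g X Y = pair g Y X := by
  funext y; exact g.symm y _ _

lemma deriv_pair {X Y Z : VF m M} (hY : DiffAt Y p) (hZ : DiffAt Z p) :
    deriv X (pair g Y Z) p =
      g.val p (leviCivita g Y p (X p)) (Z p) + g.val p (Y p) (leviCivita g Z p (X p)) := by
  have := leviCivita_metric g (X := ext (X p)) (diffAt_ext _) hY hZ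
  rwa [ext_self] at this

lemma leviCivita_add {Y Z : VF m M} (hY : DiffAt Y p) (hZ : DiffAt Z p) :
    leviCivita g (Y + Z) p = leviCivita g Y p + leviCivita g Z p :=
  (leviCivita g).isCovariantDerivativeOnUniv.add hY hZ

lemma leviCivita_smul {f : M → ℝ} {Z : VF m M} (hf : FunSmoothAt m f p) (hZ : DiffAt Z p)
    (u : TangentSpace (𝓡 m) p) :
    leviCivita g (f • Z) p u = f p • leviCivita g Z p u + mvfderiv (𝓡 m) f p u • Z p := by
  rw [(leviCivita g).isCovariantDerivativeOnUniv.leibniz hZ hf.mdiffAt]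
  rfl

lemma leviCivita_const_smul {Z : VF m M} (c : ℝ) (hZ : DiffAt Z p) :
    leviCivita g (c • Z) p = c • leviCivita g Z p :=
  (leviCivita g).isCovariantDerivativeOnUniv.smul_const c hZ

lemma leviCivita_neg {Z : VF m M} (hZ : DiffAt Z p) :
    leviCivita g (-Z) p = -leviCivita g Z p := by
  simpa using leviCivita_const_smul g (-1) hZ

lemma SmoothAt.neg {Z : VF m M} (hZ : SmoothAt Z p) : SmoothAt (-Z) p := ContMDiffAt.neg_section hZ

lemma SmoothAt.const_smul {Z : VF m M} (c : ℝ) (hZ : SmoothAt Z p) : SmoothAt (c • Z) p :=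
  ContMDiffAt.const_smul_section hZ

lemma leviCivita_sub {Y Z : VF m M} (hY : SmoothAt Y p) (hZ : SmoothAt Z p) :
    leviCivita g (Y - Z) p = leviCivita g Y p - leviCivita g Z p := by
  rw [sub_eq_add_neg, leviCivita_add g hY.diffAt hZ.neg.diffAt, leviCivita_neg g hZ.diffAt,
    sub_eq_add_neg]

lemma leviCivita_congr {Y Z : VF m M} (hY : SmoothAt Y p) (h : ∀ᶠ y in 𝓝 p, Y y = Z y) :
    leviCivita g Y p = leviCivita g Z p := by
  have hZ : SmoothAt Z p := hY.congr_of_eventuallyEq (h.mono fun y hy ↦ by simp only [hy])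
  exact (leviCivita g).isCovariantDerivativeOnUniv.congr_of_eventuallyEq hY.diffAt hZ.diffAt
    Filter.univ_mem h

lemma leviCivita_zero : leviCivita g (0 : VF m M) p = 0 := by
  rw [CovariantDerivative.zero]; rfl

lemma torsion_eq {X Y : VF m M} (hX : DiffAt X p) (hY : DiffAt Y p) :
    leviCivita g Y p (X p) - leviCivita g X p (Y p) = mlieBracket (𝓡 m) X Y p :=
  (leviCivita g).torsion_eq_zero_iff.1 (leviCivita_torsion g) hX hY

/-- Zero torsion applied to commuting coordinate fields: the symmetry of the Christoffel symbols. -/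
lemma leviCivita_ext_comm {y : M} (hy : y ∈ (chartAt (EuclideanSpace ℝ (Fin m)) p).source)
    (u v : TangentSpace (𝓡 m) p) :
    leviCivita g (ext v) y (ext u y) = leviCivita g (ext u) y (ext v y) := by
  rw [← sub_eq_zero, torsion_eq g (smoothAt_ext hy u).diffAt (smoothAt_ext hy v).diffAt,
    lieBracket_ext_ext hy]

lemma leviCivita_ext_comm_self (u v : TangentSpace (𝓡 m) p) :
    leviCivita g (ext v) p u = leviCivita g (ext u) p v := by
  simpa only [ext_self] using leviCivita_ext_comm g (mem_chart_source _ p) u v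

end Calculus

/-! ### Second covariant derivative, curvature symmetries and the rough Laplacian -/

section Hessian

variable {p : M}

/-- Where Y vanishes, the derivative of v ↦ ∇_v Z cannot contribute. Writing g(∇_Y Z, W) = g((∇Z)*W,
Y) makes this visible without expanding Y in a frame: only the derivative of Y survives. This is the
source of the tensoriality of `hess`. -/
lemma leviCivita_nabla_of_eq_zero {Y Z : VF m M} (hY : SmoothAt Y p) (hZ : SmoothAt Z p)
    (h0 : Y p = 0) (u : TangentSpace (𝓡 m) p) :
    leviCivita g (nabla g Y Z) p u = leviCivita g Z p (leviCivita g Y p u) := by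
  apply ext_val g
  intro w
  have hW := smoothAt_ext_self w
  have h1 := deriv_pair g (X := ext u) (hY.nabla (g := g) hZ).diffAt hW.diffAt
  have h2 := deriv_pair g (X := ext u) (hZ.adjField (g := g) hW).diffAt hY.diffAt
  rw [pair_adjField, pair_comm, h1] at h2
  have h3 : nabla g Y Z p = 0 := by simp only [nabla, h0, map_zero]
  simp only [h0, h3, map_zero, zero_apply, ext_self, add_zero, zero_add] at h2
  rw [h2, adjField, val_adjoint, ext_self, g.symm]
  rfl

/-- The second covariant derivative `∇²_{u,v} Z = ∇_u ∇_v Z - ∇_{∇_u v} Z`. -/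
def hess (Z : VF m M) (p : M) (u v : TangentSpace (𝓡 m) p) : TangentSpace (𝓡 m) p :=
  leviCivita g (nabla g (ext v) Z) p u - leviCivita g Z p (leviCivita g (ext v) p u)

lemma nabla_sub_left (X Y Z : VF m M) : nabla g (X - Y) Z = nabla g X Z - nabla g Y Z := by
  funext y; exact map_sub _ _ _

lemma nabla_add_left (X Y Z : VF m M) : nabla g (X + Y) Z = nabla g X Z + nabla g Y Z := by
  funext y; exact map_add _ _ _

lemma nabla_smul_left (c : ℝ) (Y Z : VF m M) : nabla g (c • Y) Z = c • nabla g Y Z := by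
  funext y; exact (leviCivita g Z y).map_smul c (Y y)

/-- The difference of Y and `ext (Y p)` vanishes at p, so the preceding lemma applies to it; hence
any smooth field with the given value may replace the extension in `hess`. -/
lemma leviCivita_nabla {Y Z : VF m M} (hY : SmoothAt Y p) (hZ : SmoothAt Z p)
    (u : TangentSpace (𝓡 m) p) :
    leviCivita g (nabla g Y Z) p u =
      hess g Z p u (Y p) + leviCivita g Z p (leviCivita g Y p u) := by
  have hE := smoothAt_ext_self (Y p)
  have h := leviCivita_nabla_of_eq_zero g (hY.sub hE) hZ (by simp) u
  rw [nabla_sub_left, leviCivita_sub g (hY.nabla hZ) (hE.nabla hZ), leviCivita_sub g hY hE] at h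
  simp only [sub_apply, map_sub] at h
  rw [hess, eq_add_of_sub_eq h]
  abel

lemma hess_add_right {Z : VF m M} (hZ : SmoothAt Z p) (u v w : TangentSpace (𝓡 m) p) :
    hess g Z p u (v + w) = hess g Z p u v + hess g Z p u w := by
  have hv := smoothAt_ext_self v
  have hw := smoothAt_ext_self w
  have h := leviCivita_nabla g (hv.add hw) hZ u
  rw [Pi.add_apply, ext_self, ext_self] at h
  rw [← sub_eq_iff_eq_add.2 h, nabla_add_left,
    leviCivita_add g (hv.nabla hZ).diffAt (hw.nabla hZ).diffAt, leviCivita_add g hv.diffAt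
        hw.diffAt,
    hess, hess]
  simp only [add_apply, map_add]
  abel

lemma hess_smul_right {Z : VF m M} (hZ : SmoothAt Z p) (c : ℝ) (u v : TangentSpace (𝓡 m) p) :
    hess g Z p u (c • v) = c • hess g Z p u v := by
  have hv := smoothAt_ext_self v
  have h := leviCivita_nabla g (hv.const_smul c) hZ u
  rw [Pi.smul_apply, ext_self] at h
  rw [← sub_eq_iff_eq_add.2 h, nabla_smul_left,
    leviCivita_const_smul g c (hv.nabla hZ).diffAt, leviCivita_const_smul g c hv.diffAt, hess]
  simp only [smul_apply, map_smul, smul_sub]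

/-- The second covariant derivative as a bilinear map. -/
def hessHom (Z : VF m M) (p : M) (hZ : SmoothAt Z p) :
    TangentSpace (𝓡 m) p →ₗ[ℝ] TangentSpace (𝓡 m) p →ₗ[ℝ] TangentSpace (𝓡 m) p :=
  LinearMap.mk₂ ℝ (hess g Z p) (fun u u' v ↦ by simp only [hess, map_add]; abel)
    (fun c u v ↦ by simp only [hess, map_smul, smul_sub]) (hess_add_right g hZ)
    (fun c u v ↦ hess_smul_right g hZ c u v)

lemma roughLaplacian_eq (V : VF m M) : roughLaplacian g V p = -trace g p (hess g V p) := by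
  rw [← trace_neg, roughLaplacian]
  congr; funext u v
  simp only [nabla, ext_self, hess, neg_sub]

/-- The Ricci identity in the sign convention of `curvature`: zero torsion absorbs the bracket term
into the two Hessians. -/
lemma curvature_eq_hess {X Y Z : VF m M} (hX : SmoothAt X p) (hY : SmoothAt Y p)
    (hZ : SmoothAt Z p) :
    curvature g X Y Z p = hess g Z p (Y p) (X p) - hess g Z p (X p) (Y p) := by
  have h : curvature g X Y Z p = leviCivita g Z p (mlieBracket (𝓡 m) X Y p) -
    (leviCivita g (nabla g Y Z) p (X p) - leviCivita g (nabla g X Z) p (Y p)) := rfl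
  rw [h, leviCivita_nabla g hY hZ, leviCivita_nabla g hX hZ, ← torsion_eq g hX.diffAt hY.diffAt,
    map_sub]
  abel

lemma hess_sub_swap {Z : VF m M} (u v : TangentSpace (𝓡 m) p) :
    hess g Z p u v - hess g Z p v u =
      leviCivita g (nabla g (ext v) Z) p u - leviCivita g (nabla g (ext u) Z) p v := by
  rw [hess, hess, leviCivita_ext_comm_self g u v]
  abel

lemma deriv_deriv_pair {Z W : VF m M} (hZ : SmoothAt Z p) (hW : SmoothAt W p)
    (u v : TangentSpace (𝓡 m) p) :
    deriv (ext u) (deriv (ext v) (pair g Z W)) p =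
      g.val p (leviCivita g (nabla g (ext v) Z) p u) (W p)
        + g.val p (leviCivita g Z p v) (leviCivita g W p u)
        + (g.val p (leviCivita g Z p u) (leviCivita g W p v)
        + g.val p (Z p) (leviCivita g (nabla g (ext v) W) p u)) := by
  have hv := smoothAt_ext_self v
  have h : deriv (ext v) (pair g Z W) =ᶠ[𝓝 p]
      pair g (nabla g (ext v) Z) W + pair g Z (nabla g (ext v) W) := by
    filter_upwards [hZ.eventually_diffAt, hW.eventually_diffAt] with y h1 h2 using
      deriv_pair g h1 h2
  rw [deriv_congr h, deriv_add ((hv.nabla hZ).pair g hW) (hZ.pair g (hv.nabla hW)),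
    deriv_pair g (hv.nabla hZ).diffAt hW.diffAt, deriv_pair g hZ.diffAt (hv.nabla hW).diffAt]
  simp only [nabla, ext_self]

/-- The second derivatives of g(Z, W) along coordinate fields commute; the products of first
derivatives cancel, leaving the skewness of the curvature operator. -/
lemma val_hess_sub_swap {Z W : VF m M} (hZ : SmoothAt Z p) (hW : SmoothAt W p)
    (u v : TangentSpace (𝓡 m) p) :
    g.val p (hess g Z p u v - hess g Z p v u) (W p) =
      -g.val p (Z p) (hess g W p u v - hess g W p v u) := by
  have h := deriv_ext_comm (hZ.pair g hW) u v
  rw [deriv_deriv_pair g hZ hW, deriv_deriv_pair g hZ hW] at h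
  rw [hess_sub_swap, hess_sub_swap]
  simp only [map_sub, sub_apply]
  linarith

/-- The curvature tensor `g(R(u, v) w, z)`. -/
def riem (p : M) (u v w z : TangentSpace (𝓡 m) p) : ℝ :=
  g.val p (curvature g (ext u) (ext v) (ext w) p) z

lemma riem_eq (u v w z : TangentSpace (𝓡 m) p) :
    riem g p u v w z = g.val p (hess g (ext w) p v u - hess g (ext w) p u v) z := by
  rw [riem, curvature_eq_hess g (smoothAt_ext_self u) (smoothAt_ext_self v) (smoothAt_ext_self w),
    ext_self, ext_self]

lemma riem_antisymm_left (u v w z : TangentSpace (𝓡 m) p) :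
    riem g p u v w z = -riem g p v u w z := by
  rw [riem_eq, riem_eq, ← neg_sub, map_neg]; rfl

/-- Skewness moves the antisymmetrized Hessian from W to the extension of z, after which W enters
only through its value at p. This gives tensoriality of the curvature in its third argument. -/
lemma riem_eq_of_smoothAt {W : VF m M} (hW : SmoothAt W p) (u v z : TangentSpace (𝓡 m) p) :
    g.val p (hess g W p v u - hess g W p u v) z = riem g p u v (W p) z := by
  have h1 := val_hess_sub_swap g hW (smoothAt_ext_self z) v u
  have h2 := val_hess_sub_swap g (smoothAt_ext_self (W p)) (smoothAt_ext_self z) v u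
  rw [ext_self] at h1 h2
  rw [ext_self] at h2
  rw [riem_eq, h1, h2]

lemma riem_antisymm_right (u v w z : TangentSpace (𝓡 m) p) :
    riem g p u v w z = -riem g p u v z w := by
  have h := val_hess_sub_swap g (smoothAt_ext_self w) (smoothAt_ext_self z) v u
  rw [ext_self, ext_self, g.symm p w] at h
  rw [riem_eq, riem_eq, h]

/-- For coordinate fields ∇_v w = ∇_w v near p, so the six terms of the cyclic sum cancel in pairs.
-/
lemma riem_bianchi (u v w z : TangentSpace (𝓡 m) p) :
    riem g p u v w z + riem g p v w u z + riem g p w u v z = 0 := by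
  have key (u v w : TangentSpace (𝓡 m) p) : leviCivita g (nabla g (ext v) (ext w)) p u =
      leviCivita g (nabla g (ext w) (ext v)) p u := by
    rw [leviCivita_congr g ((smoothAt_ext_self v).nabla (smoothAt_ext_self w))]
    filter_upwards [source_mem_nhds (mem_chart_source (EuclideanSpace ℝ (Fin m)) p)] with y hy using
      leviCivita_ext_comm g hy v w
  simp only [riem_eq, hess_sub_swap, map_sub, sub_apply]
  rw [key u v w, key v u w, key w u v]
  ring

/-- The classical octahedron argument: a linear combination of four Bianchi identities, using both
skew symmetries. -/
lemma riem_pair_symm (u v w z : TangentSpace (𝓡 m) p) :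
    riem g p u v w z = riem g p w z u v := by
  have h1 := riem_bianchi g u v w z
  have h2 := riem_bianchi g v w z u
  have h3 := riem_bianchi g w z u v
  have h4 := riem_bianchi g z u v w
  have a := riem_antisymm_left (p := p) g
  have b := riem_antisymm_right (p := p) g
  linarith [a u v w z, a v w u z, a w u v z, a u v z w, b u v w z, b v w u z, b w u v z,
    a v w z u, a w z v u, a z v w u, b v w z u, b w z v u, b z v w u,
    a w z u v, a z u w v, a u w z v, b w z u v, b z u w v, b u w z v,
    a z u v w, a u v z w, a v z u w, b z u v w, b u v z w, b v z u w,
    a v w u z, a u w v z, b u w v z, a w u z v, b w u z v, a v z w u, b v z w u]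

lemma ricci_eq (u v : TangentSpace (𝓡 m) p) :
    ricci g p u v = -g.val p (trace g p fun a b ↦ curvature g (ext u) (ext a) (ext b) p) v := by
  rw [val_trace, ← trace_neg, ricci]
  congr; funext a b
  exact riem_antisymm_right g u a v b

/-- Skewness in the last pair moves the contraction onto the third argument, so that no linearity of
the Ricci form has to be proved separately. -/
lemma ricciOp_eq (u : TangentSpace (𝓡 m) p) :
    ricciOp g p u = -trace g p fun a b ↦ curvature g (ext u) (ext a) (ext b) p := by
  apply ext_val g
  intro w
  rw [ricciOp, val_trace, map_neg, neg_apply, ← ricci_eq]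
  let L : TangentSpace (𝓡 m) p →ₗ[ℝ] ℝ :=
    -(g.val p (trace g p fun a b ↦ curvature g (ext u) (ext a) (ext b) p) :
      TangentSpace (𝓡 m) p →ₗ[ℝ] ℝ)
  have hL : ∀ v, ricci g p u v = L v := fun v ↦ ricci_eq g u v
  rw [hL, ← trace_val_smul g L w]
  congr; funext a b
  rw [map_smul, smul_apply, hL, g.symm, smul_eq_mul, mul_comm]

/-- The contracted Ricci identity: pair symmetry turns Q(V) into antisymmetrized second derivatives
of V alone. -/
lemma val_ricciOp {V : VF m M} (hV : SmoothAt V p) (w : TangentSpace (𝓡 m) p) :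
    g.val p (ricciOp g p (V p)) w =
      trace g p (fun a b ↦ g.val p (hess g V p b w) a) -
      trace g p (fun a b ↦ g.val p (hess g V p w b) a) := by
  rw [ricciOp_eq, map_neg, neg_apply, val_trace, ← trace_neg, ← trace_sub]
  congr; funext a b
  rw [← sub_apply, ← map_sub, riem_eq_of_smoothAt g hV]
  change -riem g p (V p) a b w = _
  rw [riem_pair_symm, riem_antisymm_left, neg_neg]

/-- Before tracing, (L_V ∇)(u, v) = ∇²_{u,v} V - R(V, u)v in the present sign convention, obtained
by replacing brackets by differences of covariant derivatives. -/
lemma trace_lieDerivConnection {V : VF m M} (hV : SmoothAt V p) :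
    trace g p (fun u v ↦ lieDerivConnection g V (ext u) (ext v) p) =
      ricciOp g p (V p) - roughLaplacian g V p := by
  rw [ricciOp_eq, roughLaplacian_eq, sub_neg_eq_add, ← trace_neg, ← trace_add]
  congr; funext u v
  have hu := smoothAt_ext_self u
  have hv := smoothAt_ext_self v
  have hc : curvature g (ext (V p)) (ext u) (ext v) p = curvature g V (ext u) (ext v) p := by
    rw [curvature_eq_hess g (smoothAt_ext_self _) hu hv, curvature_eq_hess g hV hu hv]
    simp only [ext_self]
  have h1 : lieDerivConnection g V (ext u) (ext v) p =
      mlieBracket (𝓡 m) V (nabla g (ext u) (ext v)) p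
      - leviCivita g (ext v) p (mlieBracket (𝓡 m) V (ext u) p)
      - leviCivita g (mlieBracket (𝓡 m) V (ext v)) p (ext u p) := rfl
  have h2 : leviCivita g (mlieBracket (𝓡 m) V (ext v)) p =
      leviCivita g (nabla g V (ext v)) p - leviCivita g (nabla g (ext v) V) p := by
    rw [← leviCivita_sub g (hV.nabla hv) (hv.nabla hV)]
    refine leviCivita_congr g (hV.lieBracket hv) ?_
    filter_upwards [hV.eventually_diffAt, hv.eventually_diffAt] with y h1 h2 using
      (torsion_eq g h1 h2).symm
  have h3 : curvature g V (ext u) (ext v) p =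
      leviCivita g (ext v) p (mlieBracket (𝓡 m) V (ext u) p) -
      (leviCivita g (nabla g (ext u) (ext v)) p (V p) -
        leviCivita g (nabla g V (ext v)) p (ext u p)) := rfl
  rw [hc, h1, h2, h3, ← torsion_eq g hV.diffAt (hu.nabla hv).diffAt, hess]
  simp only [sub_apply, nabla, ext_self]
  abel

/-- The inner product `⟨∇X, ∇Y⟩` of the covariant derivatives of two vector fields. -/
def gradInner (X Y : VF m M) (y : M) : ℝ :=
  trace g y fun u v ↦ g.val y (leviCivita g X y u) (leviCivita g Y y v)

/-- The divergence of a vector field. -/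
def divergence (Z : VF m M) (y : M) : ℝ :=
  LinearMap.trace ℝ (TangentSpace (𝓡 m) y)
    (leviCivita g Z y : TangentSpace (𝓡 m) y →ₗ[ℝ] TangentSpace (𝓡 m) y)

lemma divergence_eq_trace (Z : VF m M) (y : M) :
    divergence g Z y = trace g y fun u v ↦ g.val y (leviCivita g Z y u) v :=
  (trace_val g _).symm

/-- Green's identity in pointwise form: ⟨∇V, ∇X⟩ and g(Δ̄V, X) differ by the divergence of (∇V)*X,
which comes from the product rule for g(X, ∇_w V). -/
lemma divergence_adjField {V X : VF m M} (hV : SmoothAt V p) (hX : SmoothAt X p) :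
    divergence g (adjField g V X) p =
      gradInner g V X p - g.val p (roughLaplacian g V p) (X p) := by
  rw [divergence_eq_trace, roughLaplacian_eq, map_neg, neg_apply, sub_neg_eq_add, val_trace,
    gradInner, ← trace_swap, ← trace_swap (b := fun u v ↦ g.val p (hess g V p u v) (X p)),
    ← trace_add]
  congr; funext w u
  have hw := smoothAt_ext_self w
  have h1 := deriv_pair g (X := ext u) (hV.adjField (g := g) hX).diffAt hw.diffAt
  rw [pair_adjField, deriv_pair g hX.diffAt (hw.nabla hV).diffAt, adjField, val_adjoint] at h1
  simp only [ext_self, nabla] at h1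
  rw [leviCivita_nabla g hw hV, ext_self, map_add] at h1
  rw [g.symm p (hess g V p u w), g.symm p (leviCivita g V p w)]
  simp only [ContinuousLinearMap.coe_coe] at h1
  linarith

end Hessian

end SemiRiem

namespace SemiRiem

variable {m : ℕ} {M : Type*} [TopologicalSpace M]
  [ChartedSpace (EuclideanSpace ℝ (Fin m)) M] [IsManifold (𝓡 m) ∞ M] (g : Metric m M)

lemma trace_smulRight (g : Metric m M) {y : M} (L : TangentSpace (𝓡 m) y →ₗ[ℝ] ℝ)
    (v : TangentSpace (𝓡 m) y) :
    LinearMap.trace ℝ (TangentSpace (𝓡 m) y) (L.smulRight v) = L v := by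
  rw [← trace_val g, ← trace_val_smul g]
  congr; funext a b
  simp [mul_comm]

lemma trace_eq_zero_of_skew {y : M} {L : TangentSpace (𝓡 m) y →ₗ[ℝ] TangentSpace (𝓡 m) y}
    (h : ∀ u v, g.val y (L u) v = -g.val y (L v) u) :
    LinearMap.trace ℝ (TangentSpace (𝓡 m) y) L = 0 := by
  have : trace g y (fun u v ↦ g.val y (L u) v) = -trace g y (fun u v ↦ g.val y (L u) v) := by
    conv_lhs => rw [← trace_swap]
    rw [← trace_neg]
    congr; funext u v; exact h v u
  rw [← trace_val g]; linarith

lemma trace_one (y : M) : LinearMap.trace ℝ (TangentSpace (𝓡 m) y) 1 = m := by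
  rw [LinearMap.trace_one]
  exact congrArg _ (finrank_euclideanSpace_fin (𝕜 := ℝ) (n := m))

end SemiRiem

/-! ### First-order identities for ξ, φ and ∇φ -/

namespace ParacontactMetric

open SemiRiem

variable {n : ℕ} {M : Type*} [TopologicalSpace M]
  [ChartedSpace (EuclideanSpace ℝ (Fin (2 * n + 1))) M]
  [IsManifold (𝓡 (2 * n + 1)) ∞ M] (S : ParacontactMetric n M)

section Pointwise

variable {p : M}

lemma smoothAt_ξ : SmoothAt S.ξ p := S.smooth_ξ p

lemma smoothAt_φ {X : VF (2 * n + 1) M} (hX : SmoothAt X p) :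
    SmoothAt (fun y ↦ S.φ y (X y)) p :=
  ContMDiffAt.clm_bundle_apply (F₁ := EuclideanSpace ℝ (Fin (2 * n + 1))) (S.smooth_φ p) hX

/-- The endomorphism `v ↦ ∇_v ξ`. -/
def gradξ (p : M) : Module.End ℝ (TangentSpace (𝓡 (2 * n + 1)) p) := leviCivita S.g S.ξ p

/-- The structure tensor as an endomorphism. -/
def φEnd (p : M) : Module.End ℝ (TangentSpace (𝓡 (2 * n + 1)) p) := S.φ p

/-- The contact form as a linear form. -/
def ηDual (p : M) : TangentSpace (𝓡 (2 * n + 1)) p →ₗ[ℝ] ℝ := S.η p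

lemma ηDual_apply (v : TangentSpace (𝓡 (2 * n + 1)) p) : S.ηDual p v = S.g.val p (S.ξ p) v :=
  S.η_eq p v

lemma val_ξ_ξ : S.g.val p (S.ξ p) (S.ξ p) = 1 := by rw [← S.η_eq, S.η_ξ]

lemma η_eq_pair (Y : VF (2 * n + 1) M) : (fun y ↦ S.η y (Y y)) = pair S.g S.ξ Y := by
  funext y; exact S.η_eq y _

/-- Since the torsion vanishes, dη is the skew part of ∇η, that is of g(∇ξ, ·). -/
lemma extDerivOne_eq {X Y : VF (2 * n + 1) M} (hX : DiffAt X p) (hY : DiffAt Y p) :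
    2 * extDerivOne S.η X Y p =
      S.g.val p (S.gradξ p (X p)) (Y p) - S.g.val p (S.gradξ p (Y p)) (X p) := by
  have h1 := deriv_pair S.g (X := X) S.smoothAt_ξ.diffAt hY
  have h2 := deriv_pair S.g (X := Y) S.smoothAt_ξ.diffAt hX
  have h3 := congrArg (S.g.val p (S.ξ p)) (torsion_eq S.g hX hY)
  rw [map_sub] at h3
  rw [SemiRiem.deriv] at h1 h2
  rw [extDerivOne, S.η_eq_pair, S.η_eq_pair, S.η_eq, h1, h2, ← h3]
  simp only [gradξ, ContinuousLinearMap.coe_coe]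
  ring

lemma val_gradξ_sub (u v : TangentSpace (𝓡 (2 * n + 1)) p) :
    S.g.val p (S.gradξ p u) v - S.g.val p (S.gradξ p v) u = 2 * S.g.val p u (S.φEnd p v) := by
  have h := S.extDerivOne_eq (diffAt_ext u) (diffAt_ext v)
  rw [S.dη_eq _ _ _ (diffAt_ext u) (diffAt_ext v)] at h
  simp only [ext_self] at h
  exact h.symm

lemma val_φ_skew (u v : TangentSpace (𝓡 (2 * n + 1)) p) :
    S.g.val p u (S.φEnd p v) = -S.g.val p v (S.φEnd p u) := by
  have h1 := S.val_gradξ_sub u v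
  have h2 := S.val_gradξ_sub v u
  linarith

lemma val_φ_skew' (u v : TangentSpace (𝓡 (2 * n + 1)) p) :
    S.g.val p (S.φEnd p u) v = -S.g.val p u (S.φEnd p v) := by
  rw [S.g.symm, val_φ_skew]

lemma val_gradξ_ξ (u : TangentSpace (𝓡 (2 * n + 1)) p) :
    S.g.val p (S.gradξ p u) (S.ξ p) = 0 := by
  have h1 := deriv_pair S.g (X := ext u) S.smoothAt_ξ.diffAt (S.smoothAt_ξ (p := p)).diffAt
  have h2 : pair S.g S.ξ S.ξ = fun _ ↦ 1 := by funext y; exact S.val_ξ_ξ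
  rw [h2, SemiRiem.deriv_const, ext_self, S.g.symm p (S.ξ p)] at h1
  simp only [gradξ, ContinuousLinearMap.coe_coe]
  linarith

/-- The field ξ is geodesic because dη(ξ, ·) = 0 and its length is constant. -/
lemma gradξ_ξ : S.gradξ p (S.ξ p) = 0 := by
  apply S.g.nondegenerate
  intro w
  have h := S.extDerivOne_eq (S.smoothAt_ξ (p := p)).diffAt (diffAt_ext w)
  rw [S.dη_ξ _ _ (diffAt_ext w), val_gradξ_ξ] at h
  simpa [ext_self] using h.symm

lemma φEnd_ξ : S.φEnd p (S.ξ p) = 0 := by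
  apply S.g.nondegenerate
  intro w
  have h := S.val_gradξ_sub w (S.ξ p)
  rw [val_gradξ_ξ, gradξ_ξ, S.g.symm p w] at h
  simpa using h

lemma val_ξ_φEnd (v : TangentSpace (𝓡 (2 * n + 1)) p) : S.g.val p (S.ξ p) (S.φEnd p v) = 0 := by
  rw [val_φ_skew, φEnd_ξ]; simp

lemma φEnd_φEnd (v : TangentSpace (𝓡 (2 * n + 1)) p) :
    S.φEnd p (S.φEnd p v) = v - S.g.val p (S.ξ p) v • S.ξ p := by
  rw [← S.η_eq]; exact S.φ_sq p v

/-- The covariant derivative `(∇_u φ) Z = ∇_u (φ Z) - φ ∇_u Z` on vector fields. -/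
def dφField (p : M) (u : TangentSpace (𝓡 (2 * n + 1)) p) (Z : VF (2 * n + 1) M) :
    TangentSpace (𝓡 (2 * n + 1)) p :=
  leviCivita S.g (fun y ↦ S.φ y (Z y)) p u - S.φEnd p (leviCivita S.g Z p u)

/-- This differentiates the skewness of φ. It also yields tensoriality: the right-hand side depends
on Z only through Z p, so linearity in the argument comes for free in `dφ` and `dφField_eq`. -/
lemma val_dφField {Z W : VF (2 * n + 1) M} (hZ : SmoothAt Z p) (hW : SmoothAt W p)
    (u : TangentSpace (𝓡 (2 * n + 1)) p) :
    S.g.val p (S.dφField p u Z) (W p) = -S.g.val p (Z p) (S.dφField p u W) := by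
  have h1 := deriv_pair S.g (X := ext u) (S.smoothAt_φ hZ).diffAt hW.diffAt
  have h2 := deriv_pair S.g (X := ext u) hZ.diffAt (S.smoothAt_φ hW).diffAt
  have h3 : pair S.g (fun y ↦ S.φ y (Z y)) W = -pair S.g Z (fun y ↦ S.φ y (W y)) := by
    funext y; exact S.val_φ_skew' _ _
  have h4 : SemiRiem.deriv (ext u) (-pair S.g Z (fun y ↦ S.φ y (W y))) p =
      -SemiRiem.deriv (ext u) (pair S.g Z (fun y ↦ S.φ y (W y))) p := by
    rw [SemiRiem.deriv, mvfderiv_neg]; rfl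
  rw [h3, h4, h2] at h1
  simp only [ext_self] at h1
  rw [dφField, dφField, map_sub, map_sub, sub_apply, val_φ_skew']
  have h5 := S.val_φ_skew' (Z p) (leviCivita S.g W p u)
  have h6 := S.val_φ_skew' (leviCivita S.g Z p u) (W p)
  simp only [φEnd, ContinuousLinearMap.coe_coe] at *
  linarith

/-- The covariant derivative `∇φ` as a bilinear map. -/
def dφ (p : M) : TangentSpace (𝓡 (2 * n + 1)) p →ₗ[ℝ] Module.End ℝ (TangentSpace (𝓡 (2 * n + 1)) p)
    :=
  LinearMap.mk₂ ℝ (fun u v ↦ S.dφField p u (ext v))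
    (fun u u' v ↦ by simp only [dφField, map_add]; abel)
    (fun c u v ↦ by simp only [dφField, map_smul, smul_sub])
    (fun u v v' ↦ by
      apply ext_val S.g
      intro w
      have h1 := S.val_dφField (smoothAt_ext_self v) (smoothAt_ext_self w) u
      have h2 := S.val_dφField (smoothAt_ext_self v') (smoothAt_ext_self w) u
      have h3 := S.val_dφField (smoothAt_ext_self (v + v')) (smoothAt_ext_self w) u
      simp only [ext_self] at h1 h2 h3
      simp only [map_add, add_apply] at *
      linarith)
    (fun c u v ↦ by
      apply ext_val S.g
      intro w
      have h1 := S.val_dφField (smoothAt_ext_self v) (smoothAt_ext_self w) u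
      have h3 := S.val_dφField (smoothAt_ext_self (c • v)) (smoothAt_ext_self w) u
      simp only [ext_self] at h1 h3
      simp only [map_smul, smul_apply] at *
      rw [h3, h1, smul_neg])

lemma val_dφ_skew (u v w : TangentSpace (𝓡 (2 * n + 1)) p) :
    S.g.val p (S.dφ p u v) w = -S.g.val p v (S.dφ p u w) := by
  have h := S.val_dφField (smoothAt_ext_self v) (smoothAt_ext_self w) u
  rwa [ext_self, ext_self] at h

lemma dφField_eq {Z : VF (2 * n + 1) M} (hZ : SmoothAt Z p)
    (u : TangentSpace (𝓡 (2 * n + 1)) p) : S.dφField p u Z = S.dφ p u (Z p) := by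
  apply ext_val S.g
  intro w
  have h := S.val_dφField hZ (smoothAt_ext_self w) u
  rw [ext_self] at h
  rw [h, val_dφ_skew]; rfl

lemma leviCivita_φ {Z : VF (2 * n + 1) M} (hZ : SmoothAt Z p)
    (u : TangentSpace (𝓡 (2 * n + 1)) p) :
    leviCivita S.g (fun y ↦ S.φ y (Z y)) p u =
      S.dφ p u (Z p) + S.φEnd p (leviCivita S.g Z p u) := by
  rw [← S.dφField_eq hZ, dφField, sub_add_cancel]

lemma dφ_ξ (u : TangentSpace (𝓡 (2 * n + 1)) p) :
    S.dφ p u (S.ξ p) = -S.φEnd p (S.gradξ p u) := by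
  have h : (fun y ↦ S.φ y (S.ξ y)) = 0 := by funext y; exact S.φEnd_ξ
  rw [← S.dφField_eq S.smoothAt_ξ, dφField, h, leviCivita_zero, gradξ, zero_apply, zero_sub]
  rfl

/-- The covariant derivative of φ² = I - η⊗ξ. -/
lemma φ_dφ_add (u v : TangentSpace (𝓡 (2 * n + 1)) p) :
    S.φEnd p (S.dφ p u v) + S.dφ p u (S.φEnd p v) =
      -(S.g.val p (S.gradξ p u) v • S.ξ p) - S.g.val p (S.ξ p) v • S.gradξ p u := by
  have hv := smoothAt_ext_self v
  have hξ := S.smoothAt_ξ (p := p)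
  have h1 := S.leviCivita_φ (S.smoothAt_φ hv) u
  have h2 := S.leviCivita_φ hv u
  have hp := hξ.pair S.g hv
  have h3 : (fun y ↦ S.φ y (S.φ y (ext v y))) = ext v - pair S.g S.ξ (ext v) • S.ξ := by
    funext y; exact S.φEnd_φEnd _
  have h4 := deriv_pair S.g (X := ext u) hξ.diffAt hv.diffAt
  rw [SemiRiem.deriv] at h4
  rw [h3, leviCivita_sub S.g hv (SmoothAt.smul hp hξ), sub_apply,
    leviCivita_smul S.g hp hξ.diffAt, h2, map_add, φEnd_φEnd] at h1
  simp only [ext_self] at h1 h4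
  rw [h4] at h1
  have h5 : pair S.g S.ξ (ext v) p = S.g.val p (S.ξ p) v := by rw [pair, ext_self]
  rw [h5] at h1
  have h6 : S.gradξ p u = leviCivita S.g S.ξ p u := rfl
  have h7 : S.φ p v = S.φEnd p v := rfl
  rw [h6]
  rw [h7] at h1
  linear_combination (norm := module) (-1 : ℝ) • h1

/-- This is d(dη) = 0 with dη = g(·, φ·). In coordinate fields dη is half a difference of first
derivatives of η; in the cyclic sum the second derivatives cancel by symmetry, and the connection
terms cancel because ∇_x y = ∇_y x. -/
lemma val_dφ_cyclic (x y z : TangentSpace (𝓡 (2 * n + 1)) p) :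
    S.g.val p y (S.dφ p x z) + S.g.val p z (S.dφ p y x) + S.g.val p x (S.dφ p z y) = 0 := by
  have key (x y z : TangentSpace (𝓡 (2 * n + 1)) p) :
      2⁻¹ * (SemiRiem.deriv (ext x) (SemiRiem.deriv (ext y) (pair S.g S.ξ (ext z))) p
        - SemiRiem.deriv (ext x) (SemiRiem.deriv (ext z) (pair S.g S.ξ (ext y))) p) =
      S.g.val p (leviCivita S.g (ext y) p x) (S.φEnd p z) + S.g.val p y (S.dφ p x z)
        - S.g.val p (leviCivita S.g (ext z) p x) (S.φEnd p y) := by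
    have hy := smoothAt_ext_self y
    have hz := smoothAt_ext_self z
    have hξ := S.smoothAt_ξ (p := p)
    have h1 : pair S.g (ext y) (fun w ↦ S.φ w (ext z w)) =ᶠ[𝓝 p] (fun _ ↦ 2⁻¹) *
        (SemiRiem.deriv (ext y) (pair S.g S.ξ (ext z)) - SemiRiem.deriv (ext z)
            (pair S.g S.ξ (ext y))) := by
      filter_upwards [source_mem_nhds (mem_chart_source (EuclideanSpace ℝ (Fin (2 * n + 1))) p)]
        with w hw
      rw [pair, ← S.dη_eq _ _ _ (smoothAt_ext hw y).diffAt (smoothAt_ext hw z).diffAt, extDerivOne,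
        lieBracket_ext_ext hw, map_zero, sub_zero, S.η_eq_pair, S.η_eq_pair]
      rfl
    have h2 := deriv_congr (X := ext x) h1
    have hs1 := FunSmoothAt.deriv hy (hξ.pair S.g hz)
    have hs2 := FunSmoothAt.deriv hz (hξ.pair S.g hy)
    have hs : FunSmoothAt _ (SemiRiem.deriv (ext y) (pair S.g S.ξ (ext z)) -
        SemiRiem.deriv (ext z) (pair S.g S.ξ (ext y))) p := hs1.sub hs2
    rw [SemiRiem.deriv_mul contMDiffAt_const hs, SemiRiem.deriv_sub hs1 hs2, SemiRiem.deriv_const,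
      deriv_pair S.g hy.diffAt (S.smoothAt_φ hz).diffAt, S.leviCivita_φ (by simpa only [ext_self]),
      map_add] at h2
    simp only [ext_self, mul_zero, add_zero] at h2
    rw [← h2, S.val_φ_skew y]
    simp only [φEnd, ContinuousLinearMap.coe_coe]
    ring
  have hξ := S.smoothAt_ξ (p := p)
  have k1 := key x y z
  have k2 := key y z x
  have k3 := key z x y
  rw [deriv_ext_comm (hξ.pair S.g (smoothAt_ext_self y)) x z] at k1
  rw [deriv_ext_comm (hξ.pair S.g (smoothAt_ext_self z)) y x] at k2
  rw [deriv_ext_comm (hξ.pair S.g (smoothAt_ext_self x)) z y] at k3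
  rw [leviCivita_ext_comm_self S.g x y, leviCivita_ext_comm_self S.g x z] at k1
  rw [leviCivita_ext_comm_self S.g y z] at k2
  linarith

end Pointwise

end ParacontactMetric

namespace ParacontactMetric

open SemiRiem

variable {n : ℕ} {M : Type*} [TopologicalSpace M]
  [ChartedSpace (EuclideanSpace ℝ (Fin (2 * n + 1))) M]
  [IsManifold (𝓡 (2 * n + 1)) ∞ M] (S : ParacontactMetric n M)

/-! ### Algebra of A = ∇ξ, traces of ∇φ, and the formula for Qξ -/

section Structure

variable {p : M}

/-- In operator form A* = A + 2φ. -/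
lemma val_gradξ_eq (u v : TangentSpace (𝓡 (2 * n + 1)) p) :
    S.g.val p (S.gradξ p u) v = S.g.val p u (S.gradξ p v + (2 : ℝ) • S.φEnd p v) := by
  have h := S.val_gradξ_sub u v
  rw [map_add, map_smul, smul_eq_mul, S.g.symm p u]
  linarith

lemma val_ξ_gradξ (u : TangentSpace (𝓡 (2 * n + 1)) p) :
    S.g.val p (S.ξ p) (S.gradξ p u) = 0 := by
  rw [S.g.symm, val_gradξ_ξ]

lemma φEnd_φEnd_φEnd (v : TangentSpace (𝓡 (2 * n + 1)) p) :
    S.φEnd p (S.φEnd p (S.φEnd p v)) = S.φEnd p v := by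
  rw [φEnd_φEnd, val_ξ_φEnd, zero_smul, sub_zero]

lemma φEnd_φEnd_gradξ (v : TangentSpace (𝓡 (2 * n + 1)) p) :
    S.φEnd p (S.φEnd p (S.gradξ p v)) = S.gradξ p v := by
  rw [φEnd_φEnd, val_ξ_gradξ, zero_smul, sub_zero]

lemma gradξ_φEnd_φEnd (v : TangentSpace (𝓡 (2 * n + 1)) p) :
    S.gradξ p (S.φEnd p (S.φEnd p v)) = S.gradξ p v := by
  rw [φEnd_φEnd, map_sub, map_smul, gradξ_ξ, smul_zero, sub_zero]

/-- With ξ in one slot of the cyclic identity, the other two terms are known from (∇_u φ)ξ = -φAu.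
The right-hand side turns out to be zero, but this needs the next two lemmas. -/
lemma dφ_ξ_left_aux (z : TangentSpace (𝓡 (2 * n + 1)) p) :
    S.dφ p (S.ξ p) z = -S.gradξ p (S.φEnd p z) - (2 : ℝ) • S.φEnd p (S.φEnd p z)
      - S.φEnd p (S.gradξ p z) := by
  apply ext_val S.g
  intro y
  have h := S.val_dφ_cyclic (S.ξ p) y z
  rw [S.g.symm p (S.ξ p), val_dφ_skew, dφ_ξ, dφ_ξ, map_neg, map_neg, S.val_φ_skew z,
      S.g.symm p _ (S.φEnd p z),
    S.g.symm p (S.φEnd p z), val_gradξ_eq, S.g.symm p y] at h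
  simp only [map_add, map_sub, map_neg, map_smul, sub_apply, neg_apply, smul_apply] at h ⊢
  rw [S.g.symm p (S.gradξ p (S.φEnd p z)), S.g.symm p (S.φEnd p (S.φEnd p z)),
    S.g.symm p (S.φEnd p (S.gradξ p z))]
  linarith

/-- Along ξ the right-hand side of `φ_dφ_add` vanishes since Aξ = 0; inserting the auxiliary
expression for ∇_ξ φ leaves φAφ = -A - 2φ. -/
lemma φ_gradξ_φ (u : TangentSpace (𝓡 (2 * n + 1)) p) :
    S.φEnd p (S.gradξ p (S.φEnd p u)) = -S.gradξ p u - (2 : ℝ) • S.φEnd p u := by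
  have h := S.φ_dφ_add (S.ξ p) u
  rw [dφ_ξ_left_aux, dφ_ξ_left_aux, gradξ_ξ] at h
  simp only [map_sub, map_neg, map_smul, φEnd_φEnd_φEnd, φEnd_φEnd_gradξ, gradξ_φEnd_φEnd, map_zero,
    zero_apply, zero_smul, smul_zero, neg_zero, sub_zero] at h
  linear_combination (norm := module) (-2⁻¹ : ℝ) • h

lemma gradξ_φ_add (u : TangentSpace (𝓡 (2 * n + 1)) p) :
    S.gradξ p (S.φEnd p u) = -S.φEnd p (S.gradξ p u) - (2 : ℝ) • S.φEnd p (S.φEnd p u) := by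
  have h := congrArg (S.φEnd p) (S.φ_gradξ_φ u)
  rwa [φEnd_φEnd_gradξ, map_sub, map_neg, map_smul] at h

lemma dφ_ξ_left (z : TangentSpace (𝓡 (2 * n + 1)) p) : S.dφ p (S.ξ p) z = 0 := by
  rw [dφ_ξ_left_aux, gradξ_φ_add]; module

/-- The trace of an endomorphism of a tangent space. -/
abbrev tr {p : M} : Module.End ℝ (TangentSpace (𝓡 (2 * n + 1)) p) →ₗ[ℝ] ℝ :=
  LinearMap.trace ℝ (TangentSpace (𝓡 (2 * n + 1)) p)

lemma tr_mul_comm (L L' : Module.End ℝ (TangentSpace (𝓡 (2 * n + 1)) p)) :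
    tr (L * L') = tr (L' * L) := LinearMap.trace_mul_comm ℝ L L'

lemma tr_φEnd : tr (S.φEnd p) = 0 :=
  trace_eq_zero_of_skew S.g fun u v ↦ by rw [val_φ_skew', S.g.symm]

/-- Taking traces in φAφ = -A - 2φ gives tr A = -tr A, because φ²A = A and tr φ = 0. -/
lemma tr_gradξ : tr (S.gradξ p) = 0 := by
  have h1 : S.φEnd p * (S.gradξ p * S.φEnd p) = -S.gradξ p - (2 : ℝ) • S.φEnd p :=
    LinearMap.ext S.φ_gradξ_φ
  have h2 : S.φEnd p * S.φEnd p * S.gradξ p = S.gradξ p := LinearMap.ext S.φEnd_φEnd_gradξ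
  have h3 := congrArg tr h1
  rw [← mul_assoc, tr_mul_comm, ← mul_assoc, h2, map_sub, map_neg, map_smul, tr_φEnd] at h3
  simp only [smul_zero] at h3
  linarith

lemma φEnd_sq : S.φEnd p * S.φEnd p = 1 - (S.ηDual p).smulRight (S.ξ p) := by
  ext1 v
  simp [φEnd_φEnd, ηDual_apply]

lemma tr_φEnd_sq : tr (S.φEnd p * S.φEnd p) = 2 * n := by
  rw [φEnd_sq, map_sub, trace_one, trace_smulRight S.g, ηDual_apply, val_ξ_ξ]
  push_cast; ring

/-- The trace of Aφ + φA = -2φ², where tr φ² = 2n. -/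
lemma tr_φ_gradξ : tr (S.φEnd p * S.gradξ p) = -(2 * n) := by
  have h : S.gradξ p * S.φEnd p = -(S.φEnd p * S.gradξ p) - (2 : ℝ) • (S.φEnd p * S.φEnd p) :=
    LinearMap.ext S.gradξ_φ_add
  have h1 := congrArg tr h
  rw [tr_mul_comm, map_sub, map_neg, map_smul, tr_φEnd_sq, smul_eq_mul] at h1
  linarith

lemma tr_dφ (w : TangentSpace (𝓡 (2 * n + 1)) p) : tr (S.dφ p w) = 0 :=
  trace_eq_zero_of_skew S.g fun u v ↦ by rw [val_dφ_skew, S.g.symm]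

/-- The endomorphism `φ ∘ ∇_w φ + ∇_w φ ∘ φ`. -/
lemma φ_dφ_add_eq (w : TangentSpace (𝓡 (2 * n + 1)) p) :
    S.φEnd p * S.dφ p w + S.dφ p w * S.φEnd p =
      -((S.g.val p (S.gradξ p w) : TangentSpace (𝓡 (2 * n + 1)) p →ₗ[ℝ] ℝ).smulRight (S.ξ p))
      - (S.ηDual p).smulRight (S.gradξ p w) := by
  ext1 v
  simpa [ηDual_apply] using S.φ_dφ_add w v

lemma tr_φ_dφ (w : TangentSpace (𝓡 (2 * n + 1)) p) : tr (S.φEnd p * S.dφ p w) = 0 := by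
  have h := congrArg tr (S.φ_dφ_add_eq w)
  rw [map_add, tr_mul_comm (S.dφ p w), map_sub, map_neg, trace_smulRight S.g, trace_smulRight S.g,
    ηDual_apply, val_ξ_gradξ, ContinuousLinearMap.coe_coe, val_gradξ_ξ] at h
  linarith

lemma adjoint_φEnd : adjoint S.g (S.φEnd p) = -S.φEnd p := by
  ext1 u
  apply ext_val S.g
  intro v
  rw [val_adjoint, LinearMap.neg_apply, map_neg, neg_apply, val_φ_skew', neg_neg]

/-- Put B(u, v) = g(w, (∇_u φ)v). Moving φ from the first slot to the second costs a sign, as φ is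
skew; the cyclic identity moves it without a sign, up to the vanishing tr(φ ∘ ∇_w φ). Hence the
trace equals its own negative. -/
lemma trace_dφ_φ : trace S.g p (fun u v ↦ S.dφ p u (S.φEnd p v)) = 0 := by
  apply S.g.nondegenerate
  intro w
  let B : TangentSpace (𝓡 (2 * n + 1)) p →ₗ[ℝ] TangentSpace (𝓡 (2 * n + 1)) p →ₗ[ℝ] ℝ :=
    (S.dφ p).compr₂ (S.g.val p w : TangentSpace (𝓡 (2 * n + 1)) p →ₗ[ℝ] ℝ)
  have hB (u v : TangentSpace (𝓡 (2 * n + 1)) p) : B u v = S.g.val p w (S.dφ p u v) := rfl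
  have h1 := trace_bilin_comp_left S.g B (S.φEnd p)
  have h2 : trace S.g p (fun u v ↦ B (S.φEnd p u) v) =
      trace S.g p (fun u v ↦ B u (S.φEnd p v)) - tr (S.φEnd p * S.dφ p w) := by
    rw [← trace_val S.g, ← trace_swap, ← trace_sub]
    congr; funext u v
    have h := S.val_dφ_cyclic u w (S.φEnd p v)
    rw [S.val_φ_skew' v] at h
    have h3 := S.val_dφ_skew (S.φEnd p v) u w
    rw [hB, hB, Module.End.mul_apply, S.g.symm p _ v, S.g.symm p w (S.dφ p (S.φEnd p v) u)]
    linarith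
  have h4 : trace S.g p (fun u v ↦ B u (adjoint S.g (S.φEnd p) v)) =
      -trace S.g p (fun u v ↦ B u (S.φEnd p v)) := by
    rw [← trace_neg]; simp only [adjoint_φEnd, LinearMap.neg_apply, map_neg]
  have h5 : S.g.val p (trace S.g p fun u v ↦ S.dφ p u (S.φEnd p v)) w =
      trace S.g p (fun u v ↦ B u (S.φEnd p v)) := by
    rw [val_trace]; simp only [hB, S.g.symm p w]
  rw [tr_φ_dφ] at h2
  linarith

/-- Contracting `φ_dφ_add` shows that φ kills the trace D, so D is a multiple of ξ; its coefficient
g(ξ, D) equals tr(φA) = -2n. -/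
lemma trace_dφ : trace S.g p (fun u v ↦ S.dφ p u v) = -(2 * n : ℝ) • S.ξ p := by
  set D := trace S.g p (fun u v ↦ S.dφ p u v) with hD
  have h1 : S.φEnd p D = 0 := by
    have h2 : S.φEnd p D = trace S.g p (fun u v ↦ S.φEnd p (S.dφ p u v)) := map_trace S.g _ _
    have h3 : trace S.g p (fun u v ↦ S.g.val p (S.ξ p) v • S.gradξ p u) = 0 := by
      apply S.g.nondegenerate
      intro w
      have h := trace_val_smul S.g
        ((S.g.val p w : TangentSpace (𝓡 (2 * n + 1)) p →ₗ[ℝ] ℝ) ∘ₗ S.gradξ p) (S.ξ p)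
      rw [LinearMap.comp_apply, gradξ_ξ, map_zero] at h
      rw [← h, val_trace]
      congr; funext u v
      rw [map_smul, smul_apply, S.g.symm p (S.gradξ p u)]; rfl
    have h4 : trace S.g p (fun u v ↦ S.g.val p (S.gradξ p u) v • S.ξ p) = 0 := by
      have h := map_trace S.g (LinearMap.toSpanSingleton ℝ _ (S.ξ p))
        fun u v ↦ S.g.val p (S.gradξ p u) v
      rw [trace_val, S.tr_gradξ, map_zero] at h
      exact h.symm
    have h5 := trace_add S.g (fun u v ↦ S.φEnd p (S.dφ p u v)) fun u v ↦ S.dφ p u (S.φEnd p v)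
    simp only [φ_dφ_add] at h5
    rw [trace_dφ_φ, add_zero, trace_sub, trace_neg, h3, h4, neg_zero, sub_zero] at h5
    rw [h2, ← h5]
  have h5 : S.g.val p (S.ξ p) D = -(2 * n) := by
    rw [S.g.symm, hD, val_trace, ← S.tr_φ_gradξ (p := p), ← trace_val S.g]
    congr; funext u v
    rw [val_dφ_skew, dφ_ξ, map_neg, neg_neg, S.g.symm]; rfl
  have h6 := S.φEnd_φEnd D
  rw [h1, map_zero, h5] at h6
  exact (sub_eq_zero.1 h6.symm)

/-- Zero torsion and ∇_ξ φ = 0 turn the Lie derivative into φA - Aφ; the anticommutation rule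
removes Aφ. -/
lemma h_eq : (S.h p : Module.End ℝ (TangentSpace (𝓡 (2 * n + 1)) p)) =
    S.φEnd p * S.gradξ p + S.φEnd p * S.φEnd p := by
  ext1 u
  have hu := smoothAt_ext_self u
  have h1 : S.h p u = (2⁻¹ : ℝ) • S.lieφ (ext u) p := rfl
  have h2 := torsion_eq S.g (S.smoothAt_ξ (p := p)).diffAt (S.smoothAt_φ hu).diffAt
  have h3 := torsion_eq S.g (S.smoothAt_ξ (p := p)).diffAt hu.diffAt
  rw [S.leviCivita_φ hu, dφ_ξ_left, zero_add, ext_self] at h2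
  rw [ext_self] at h3
  have h4 : leviCivita S.g S.ξ p (S.φ p u) = _ := S.gradξ_φ_add u
  rw [ContinuousLinearMap.coe_coe, h1, lieφ, ← h2, ← h3, h4]
  have h5 (v : TangentSpace (𝓡 (2 * n + 1)) p) : S.φ p v = S.φEnd p v := rfl
  have h6 (v : TangentSpace (𝓡 (2 * n + 1)) p) : leviCivita S.g S.ξ p v = S.gradξ p v := rfl
  simp only [h5, h6, map_sub, LinearMap.add_apply, Module.End.mul_apply]
  module

/-- Squaring h = φA + φ² gives h² = φ² - A². -/
lemma tr_gradξ_sq : tr (S.gradξ p * S.gradξ p) = 2 * n - S.trhSq p := by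
  have h : (S.h p ∘L S.h p : TangentSpace (𝓡 (2 * n + 1)) p →L[ℝ] _) =
      S.φEnd p * S.φEnd p - S.gradξ p * S.gradξ p := by
    have h1 : ((S.h p ∘L S.h p : TangentSpace (𝓡 (2 * n + 1)) p →L[ℝ] _) :
        Module.End ℝ (TangentSpace (𝓡 (2 * n + 1)) p)) =
      (S.h p : Module.End ℝ (TangentSpace (𝓡 (2 * n + 1)) p)) *
      (S.h p : Module.End ℝ (TangentSpace (𝓡 (2 * n + 1)) p)) := rfl
    rw [h1, h_eq]
    ext1 u
    simp only [LinearMap.add_apply, Module.End.mul_apply, LinearMap.sub_apply, map_add,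
      φ_gradξ_φ, gradξ_φEnd_φEnd, φEnd_φEnd_φEnd]
    module
  rw [trhSq, h, map_sub, tr_φEnd_sq]
  ring

/-- The second derivative of g(ξ, ξ) = 1. -/
lemma val_hess_ξ_ξ (u v : TangentSpace (𝓡 (2 * n + 1)) p) :
    S.g.val p (hess S.g S.ξ p u v) (S.ξ p) = -S.g.val p (S.gradξ p u) (S.gradξ p v) := by
  have hξ := S.smoothAt_ξ (p := p)
  have h1 := deriv_deriv_pair S.g hξ hξ u v
  have h2 : pair S.g S.ξ S.ξ = fun _ ↦ 1 := by funext y; exact S.val_ξ_ξ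
  have h3 : SemiRiem.deriv (ext v) (fun _ : M ↦ (1 : ℝ)) = fun _ ↦ 0 := by
    funext y; exact SemiRiem.deriv_const 1
  have h4 : S.g.val p (leviCivita S.g S.ξ p (leviCivita S.g (ext v) p u)) (S.ξ p) = 0 :=
    S.val_gradξ_ξ _
  rw [h2, h3, SemiRiem.deriv_const, S.g.symm p (leviCivita S.g S.ξ p v), S.g.symm p (S.ξ p)] at h1
  rw [hess, map_sub, sub_apply, h4]
  simp only [gradξ, ContinuousLinearMap.coe_coe]
  linarith

/-- The left side is tr(A*A) = tr A² + 2 tr(φA) = (2n - tr h²) - 4n. -/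
lemma val_roughLaplacian_ξ :
    S.g.val p (roughLaplacian S.g S.ξ p) (S.ξ p) = -(2 * n) - S.trhSq p := by
  have h : trace S.g p (fun u v ↦ S.g.val p (S.gradξ p u) (S.gradξ p v)) =
      tr (S.gradξ p * S.gradξ p + (2 : ℝ) • (S.φEnd p * S.gradξ p)) := by
    rw [← trace_val S.g, ← trace_swap]
    congr; funext u v
    rw [val_gradξ_eq, S.g.symm]; rfl
  rw [map_add, map_smul, tr_gradξ_sq, tr_φ_gradξ, smul_eq_mul] at h
  rw [roughLaplacian_eq, map_neg, neg_apply, val_trace]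
  simp only [val_hess_ξ_ξ]
  rw [trace_neg, neg_neg, h]
  ring

/-- The derivative of ∇_ξ ξ = 0. -/
lemma hess_ξ_ξ (w : TangentSpace (𝓡 (2 * n + 1)) p) :
    hess S.g S.ξ p w (S.ξ p) = -S.gradξ p (S.gradξ p w) := by
  have hξ := S.smoothAt_ξ (p := p)
  have h := leviCivita_nabla S.g hξ hξ w
  have h1 : nabla S.g S.ξ S.ξ = 0 := by funext y; exact S.gradξ_ξ
  rw [h1, leviCivita_zero, zero_apply] at h
  exact eq_neg_of_add_eq_zero_left h.symm

/-- The endomorphism `v ↦ ∇²_{w,v} ξ`. -/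
def hessξ (w : TangentSpace (𝓡 (2 * n + 1)) p) : Module.End ℝ (TangentSpace (𝓡 (2 * n + 1)) p) :=
  hessHom S.g S.ξ p S.smoothAt_ξ w

/-- The covariant derivative of φAφ = -A - 2φ. -/
lemma φ_hessξ_φ (w v : TangentSpace (𝓡 (2 * n + 1)) p) :
    S.dφ p w (S.gradξ p (S.φEnd p v)) + S.φEnd p (S.hessξ w (S.φEnd p v))
      + S.φEnd p (S.gradξ p (S.dφ p w v)) = -S.hessξ w v - (2 : ℝ) • S.dφ p w v := by
  have hξ := S.smoothAt_ξ (p := p)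
  have hv := smoothAt_ext_self v
  have hY := S.smoothAt_φ hv
  have hZ := hY.nabla (g := S.g) hξ
  have h1 := S.leviCivita_φ hZ w
  have h2 : (fun y ↦ S.φ y (nabla S.g (fun y ↦ S.φ y (ext v y)) S.ξ y)) =
      -nabla S.g (ext v) S.ξ - (2 : ℝ) • fun y ↦ S.φ y (ext v y) := by
    funext y; exact S.φ_gradξ_φ _
  rw [h2, leviCivita_sub S.g (hv.nabla hξ).neg (hY.const_smul 2),
    leviCivita_neg S.g (hv.nabla hξ).diffAt, leviCivita_const_smul S.g 2 hY.diffAt,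
    leviCivita_nabla S.g hY hξ] at h1
  simp only [sub_apply, neg_apply, smul_apply] at h1
  rw [leviCivita_nabla S.g hv hξ, S.leviCivita_φ hv] at h1
  have h3 : nabla S.g (fun y ↦ S.φ y (ext v y)) S.ξ p = S.gradξ p (S.φEnd p v) := by
    simp only [nabla, ext_self]; rfl
  have h4 (v : TangentSpace (𝓡 (2 * n + 1)) p) : leviCivita S.g S.ξ p v = S.gradξ p v := rfl
  have h5 (v : TangentSpace (𝓡 (2 * n + 1)) p) : S.φ p v = S.φEnd p v := rfl
  have h6 (v : TangentSpace (𝓡 (2 * n + 1)) p) : hess S.g S.ξ p w v = S.hessξ w v := rfl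
  rw [h3] at h1
  simp only [h4, ext_self, map_add, h5, h6, φ_gradξ_φ] at h1
  linear_combination (norm := module) (-1 : ℝ) • h1

/-- Geometrically this is the derivative of tr A = 0. It is obtained algebraically instead, by
tracing the differentiated identity: φHφ has trace tr H, the ∇φ terms cancel, and tr H = -tr H
remains. -/
lemma tr_hessξ (w : TangentSpace (𝓡 (2 * n + 1)) p) : tr (S.hessξ w) = 0 := by
  have h1 : S.dφ p w * (S.gradξ p * S.φEnd p) + S.φEnd p * (S.hessξ w * S.φEnd p)
      + S.φEnd p * (S.gradξ p * S.dφ p w) = -S.hessξ w - (2 : ℝ) • S.dφ p w :=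
    LinearMap.ext (S.φ_hessξ_φ w)
  have h2 := congrArg tr h1
  have h3 : tr (S.dφ p w * (S.gradξ p * S.φEnd p)) + tr (S.φEnd p * (S.gradξ p * S.dφ p w)) = 0 :=
      by
    rw [tr_mul_comm, tr_mul_comm (S.φEnd p), mul_assoc, mul_assoc, ← map_add, ← mul_add,
        φ_dφ_add_eq]
    have h4 : S.gradξ p * (-((S.g.val p (S.gradξ p w) :
          TangentSpace (𝓡 (2 * n + 1)) p →ₗ[ℝ] ℝ).smulRight (S.ξ p))
        - (S.ηDual p).smulRight (S.gradξ p w)) =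
        -(S.ηDual p).smulRight (S.gradξ p (S.gradξ p w)) := by
      ext1 v; simp [gradξ_ξ]
    rw [h4, map_neg, trace_smulRight S.g, ηDual_apply, val_ξ_gradξ, neg_zero]
  have h5 : tr (S.φEnd p * (S.hessξ w * S.φEnd p)) = tr (S.hessξ w) := by
    rw [tr_mul_comm, mul_assoc, φEnd_sq, mul_sub, mul_one, map_sub, sub_eq_self]
    have h6 : S.hessξ w * (S.ηDual p).smulRight (S.ξ p) =
        (S.ηDual p).smulRight (-S.gradξ p (S.gradξ p w)) := by
      ext1 v
      have h7 : S.hessξ w (S.ξ p) = -S.gradξ p (S.gradξ p w) := S.hess_ξ_ξ w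
      simp [h7]
    rw [h6, trace_smulRight S.g, ηDual_apply, map_neg, val_ξ_gradξ, neg_zero]
  rw [map_add, map_add, map_sub, map_neg, map_smul, tr_dφ, smul_zero, h5] at h2
  linarith

/-- The covariant derivative of A* = A + 2φ. -/
lemma val_hessξ_adj (u w z : TangentSpace (𝓡 (2 * n + 1)) p) :
    S.g.val p (hess S.g S.ξ p u w) z =
      S.g.val p w (hess S.g S.ξ p u z) + 2 * S.g.val p w (S.dφ p u z) := by
  have hξ := S.smoothAt_ξ (p := p)
  have hw := smoothAt_ext_self w
  have hz := smoothAt_ext_self z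
  have hW := hw.nabla (g := S.g) hξ
  have hZ := hz.nabla (g := S.g) hξ
  have h1 : pair S.g (nabla S.g (ext w) S.ξ) (ext z) =
      pair S.g (ext w) (nabla S.g (ext z) S.ξ + (2 : ℝ) • fun y ↦ S.φ y (ext z y)) := by
    funext y; exact S.val_gradξ_eq _ _
  have h2 := deriv_pair S.g (X := ext u) hW.diffAt hz.diffAt
  have hF := (S.smoothAt_φ hz).const_smul 2
  rw [h1, deriv_pair S.g hw.diffAt (hZ.add hF).diffAt, leviCivita_add S.g hZ.diffAt hF.diffAt,
    leviCivita_const_smul S.g 2 (S.smoothAt_φ hz).diffAt, leviCivita_nabla S.g hw hξ] at h2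
  simp only [add_apply, smul_apply, Pi.add_apply, Pi.smul_apply] at h2
  rw [leviCivita_nabla S.g hz hξ, S.leviCivita_φ hz] at h2
  simp only [nabla, ext_self] at h2
  have h4 (v : TangentSpace (𝓡 (2 * n + 1)) p) : leviCivita S.g S.ξ p v = S.gradξ p v := rfl
  have h5 (v : TangentSpace (𝓡 (2 * n + 1)) p) : S.φ p v = S.φEnd p v := rfl
  simp only [h4, h5] at h2
  have h6 := S.val_gradξ_eq (leviCivita S.g (ext w) p u) z
  have h7 := S.val_gradξ_eq w (leviCivita S.g (ext z) p u)
  simp only [map_add, map_smul, add_apply, smul_eq_mul] at *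
  linarith

/-- The Ricci operator and the rough Laplacian of the Reeb vector field of a paracontact metric
manifold. -/
lemma ricciOp_ξ :
    ricciOp S.g p (S.ξ p) = -roughLaplacian S.g S.ξ p - (4 * n : ℝ) • S.ξ p := by
  apply ext_val S.g
  intro w
  have hξ := S.smoothAt_ξ (p := p)
  have h1 : trace S.g p (fun a b ↦ S.g.val p (hess S.g S.ξ p w b) a) = 0 := by
    rw [← S.tr_hessξ w, ← trace_val S.g, ← trace_swap]; rfl
  -- Taking the adjoint of ∇_b A moves the free vector w out of the Hessian, so that the trace
  -- becomes that of ∇²ξ plus twice that of ∇φ.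
  have h2 : trace S.g p (fun a b ↦ S.g.val p (hess S.g S.ξ p b w) a) =
      S.g.val p (trace S.g p (hess S.g S.ξ p)) w
        + 2 * S.g.val p (trace S.g p fun u v ↦ S.dφ p u v) w := by
    have h3 := trace_smul S.g (2 : ℝ) fun u v ↦ S.g.val p (S.dφ p u v) w
    rw [smul_eq_mul] at h3
    rw [val_trace, val_trace, ← h3, ← trace_add, ← trace_swap]
    congr; funext u z
    rw [val_hessξ_adj, S.g.symm p w, S.g.symm p w]; rfl
  rw [val_ricciOp S.g hξ, h1, h2, trace_dφ, roughLaplacian_eq]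
  simp only [neg_neg, map_sub, sub_apply, map_smul, smul_apply, smul_eq_mul]
  ring

end Structure

end ParacontactMetric

namespace SemiRiem

variable {m : ℕ} {M : Type*} [TopologicalSpace M]
  [ChartedSpace (EuclideanSpace ℝ (Fin m)) M] [IsManifold (𝓡 m) ∞ M] (g : Metric m M)


/-! ### Jacobi's formula and the divergence in coordinates -/

section Jacobi

/-- The determinant is multilinear in the rows; replacing row i by its derivative and expanding
along it produces the cofactors. -/
lemma fderiv_det {ι E : Type*} [Fintype ι] [DecidableEq ι] [NormedAddCommGroup E] [NormedSpace ℝ E]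
    {G : E → Matrix ι ι ℝ} {x : E} (hG : ∀ i j, DifferentiableAt ℝ (fun y ↦ G y i j) x) (v : E) :
    fderiv ℝ (fun y ↦ (G y).det) x v =
      ∑ i, ∑ j, (G x).adjugate j i * fderiv ℝ (fun y ↦ G y i j) x v := by
  let D : ContinuousMultilinearMap ℝ (fun _ : ι ↦ ι → ℝ) ℝ :=
    { toMultilinearMap := Matrix.detRowAlternating.toMultilinearMap
      cont := Continuous.matrix_det (A := fun M : Matrix ι ι ℝ ↦ M) continuous_id }
  let G' : E → ι → ι → ℝ := G
  have hG' : HasFDerivAt G' (ContinuousLinearMap.pi fun i ↦ ContinuousLinearMap.pi fun j ↦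
      fderiv ℝ (fun y ↦ G y i j) x) x :=
    hasFDerivAt_pi.2 fun i ↦ hasFDerivAt_pi.2 fun j ↦ (hG i j).hasFDerivAt
  have h := (D.hasFDerivAt (G' x)).comp x hG'
  have h' : HasFDerivAt (fun y ↦ (G y).det) _ x := h
  rw [h'.fderiv, ContinuousLinearMap.comp_apply, ContinuousMultilinearMap.linearDeriv_apply]
  refine Finset.sum_congr rfl fun i _ ↦ ?_
  have h1 (b : ι → ℝ) : D (Function.update (G' x) i b) = ∑ j, (G x).adjugate j i * b j := by
    have h2 : D (Function.update (G' x) i b) = ((G x).updateRow i b).det := rfl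
    rw [h2, ← Matrix.cramer_transpose_apply, Matrix.cramer_eq_adjugate_mulVec,
      ← Matrix.adjugate_transpose]
    rfl
  rw [h1]; rfl

end Jacobi

section ChartDivergence

variable {p y : M}

/-- The density `√|det g_ij|` of the volume in the chart at `p`. -/
def density (p y : M) : ℝ := √|(gramOf g y (frame p · y)).det|

variable {g} in
lemma density_pos (hy : y ∈ (chartAt (EuclideanSpace ℝ (Fin m)) p).source) : 0 < density g p y :=
  Real.sqrt_pos.2 (abs_pos.2 (gramOf_frame_det_ne_zero hy))

lemma density_sq : density g p y * density g p y = |(gramOf g y (frame p · y)).det| :=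
  Real.mul_self_sqrt (abs_nonneg _)

variable {g} in
lemma smoothAt_gramOf_det (hy : y ∈ (chartAt (EuclideanSpace ℝ (Fin m)) p).source) :
    FunSmoothAt m (fun z ↦ (gramOf g z (frame p · z)).det) y :=
  FunSmoothAt.det (smoothAt_gramOf_frame hy)

variable {g} in
lemma smoothAt_density (hy : y ∈ (chartAt (EuclideanSpace ℝ (Fin m)) p).source) :
    FunSmoothAt m (density g p) y := by
  have h0 := gramOf_frame_det_ne_zero (g := g) hy
  have h : ContDiffAt ℝ ∞ (fun t : ℝ ↦ √|t|) (gramOf g y (frame p · y)).det :=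
    (contDiffAt_abs h0).sqrt (abs_ne_zero.2 h0)
  exact ContMDiffAt.comp (g := fun t : ℝ ↦ √|t|) y h.contMDiffAt (smoothAt_gramOf_det hy)

lemma deriv_ext {f : M → ℝ} (hy : y ∈ (chartAt (EuclideanSpace ℝ (Fin m)) p).source)
    (hf : FunSmoothAt m f y)
    (v : TangentSpace (𝓡 m) p) : SemiRiem.deriv (ext v) f y =
      fderiv ℝ (f ∘ (extChartAt (𝓡 m) p).symm) (extChartAt (𝓡 m) p y) (toModel p v) :=
  mvfderiv_ext hy (FunSmoothAt.mdiffAt hf) v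

lemma deriv_gramOf_det (hy : y ∈ (chartAt (EuclideanSpace ℝ (Fin m)) p).source)
    (v : TangentSpace (𝓡 m) p) :
    SemiRiem.deriv (ext v) (fun z ↦ (gramOf g z (frame p · z)).det) y =
      (gramOf g y (frame p · y)).det * ∑ i, ∑ j, (gramOf g y (frame p · y))⁻¹ i j *
        SemiRiem.deriv (ext v) (pair g (frame p i) (frame p j)) y := by
  have hG := fun i j ↦ smoothAt_gramOf_frame (g := g) hy i j
  rw [deriv_ext hy (smoothAt_gramOf_det hy)]
  refine (fderiv_det (G := fun w ↦ gramOf g ((extChartAt (𝓡 m) p).symm w)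
    (frame p · ((extChartAt (𝓡 m) p).symm w)))
    (fun i j ↦ ((hG i j).contDiffAt hy).differentiableAt (by simp)) _).trans ?_
  rw [Finset.mul_sum]
  refine Finset.sum_congr rfl fun i _ ↦ ?_
  rw [Finset.mul_sum]
  refine Finset.sum_congr rfl fun j _ ↦ ?_
  have h1 : SemiRiem.deriv (ext v) (pair g (frame p i) (frame p j)) y =
      fderiv ℝ (fun w ↦ gramOf g ((extChartAt (𝓡 m) p).symm w)
        (frame p · ((extChartAt (𝓡 m) p).symm w)) i j) (extChartAt (𝓡 m) p y) (toModel p v) :=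
    deriv_ext hy (hG i j) v
  rw [h1, ← mul_assoc, left_inv_extChartAt hy]
  congr 1
  rw [gramOf_inv_symm, Matrix.inv_def, Matrix.smul_apply, smul_eq_mul, ← mul_assoc,
    Ring.mul_inverse_cancel _ (isUnit_iff_ne_zero.2 (gramOf_frame_det_ne_zero hy)), one_mul]

lemma deriv_density (hy : y ∈ (chartAt (EuclideanSpace ℝ (Fin m)) p).source)
    (v : TangentSpace (𝓡 m) p) :
    SemiRiem.deriv (ext v) (density g p) y =
      2⁻¹ * density g p y * ∑ i, ∑ j, (gramOf g y (frame p · y))⁻¹ i j *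
        SemiRiem.deriv (ext v) (pair g (frame p i) (frame p j)) y := by
  set s := ∑ i, ∑ j, (gramOf g y (frame p · y))⁻¹ i j *
    SemiRiem.deriv (ext v) (pair g (frame p i) (frame p j)) y with hs
  have hd := smoothAt_density (g := g) hy
  have hD := smoothAt_gramOf_det (g := g) hy
  have hdd : FunSmoothAt m (density g p * density g p) y := hd.mul hd
  -- The fourth power of the density is the polynomial det², so differentiating this relation avoids
  -- both the square root and the sign of the determinant.
  have h1 : (density g p * density g p) * (density g p * density g p) =
      (fun z ↦ (gramOf g z (frame p · z)).det) * fun z ↦ (gramOf g z (frame p · z)).det := by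
    funext z
    simp only [Pi.mul_apply, density_sq, abs_mul_abs_self]
  have h2 := congrArg (SemiRiem.deriv (ext v) · y) h1
  simp only at h2
  have h3 := congrFun h1 y
  simp only [Pi.mul_apply] at h3
  rw [SemiRiem.deriv_mul hdd hdd, SemiRiem.deriv_mul hd hd, SemiRiem.deriv_mul hD hD,
    deriv_gramOf_det g hy, ← hs, Pi.mul_apply] at h2
  have h4 := (density_pos (g := g) hy).ne'
  have h5 : 4 * (density g p y * density g p y * density g p y) *
      (SemiRiem.deriv (ext v) (density g p) y - 2⁻¹ * density g p y * s) = 0 := by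
    linear_combination h2 - 2 * s * h3
  have h6 := (mul_eq_zero.1 h5).resolve_left (by positivity)
  linarith

/-- Since ∇_i ∂_k = ∇_k ∂_i, the divergence is half the g-trace of ∂_k g_ij. This is the logarithmic
derivative found in `deriv_density`, so √|det g| div ∂_k = ∂_k √|det g|. -/
lemma divergence_frame (hy : y ∈ (chartAt (EuclideanSpace ℝ (Fin m)) p).source) (k : Fin m) :
    divergence g (frame p k) y = 2⁻¹ * ∑ i, ∑ j, (gramOf g y (frame p · y))⁻¹ i j *
      SemiRiem.deriv (frame p k) (pair g (frame p i) (frame p j)) y := by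
  let B : TangentSpace (𝓡 m) y →ₗ[ℝ] TangentSpace (𝓡 m) y →ₗ[ℝ] ℝ :=
    LinearMap.mk₂ ℝ (fun u v ↦ g.val y (leviCivita g (frame p k) y u) v) (by simp) (by simp)
      (by simp) (by simp)
  have h1 : divergence g (frame p k) y = trace g y (fun u v ↦ B u v) := divergence_eq_trace g _ y
  have h2 (i j : Fin m) : B (frame p i y) (frame p j y) =
      g.val y (leviCivita g (frame p i) y (frame p k y)) (frame p j y) := by
    rw [← leviCivita_ext_comm g hy]; rfl
  have h3 (i j : Fin m) : SemiRiem.deriv (frame p k) (pair g (frame p i) (frame p j)) y =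
      B (frame p i y) (frame p j y) + B (frame p j y) (frame p i y) := by
    rw [deriv_pair g (smoothAt_frame hy i).diffAt (smoothAt_frame hy j).diffAt, h2, h2,
      g.symm y (frame p i y)]
  have h4 : ∑ i, ∑ j, (gramOf g y (frame p · y))⁻¹ i j * B (frame p j y) (frame p i y) =
      ∑ i, ∑ j, (gramOf g y (frame p · y))⁻¹ i j * B (frame p i y) (frame p j y) := by
    rw [Finset.sum_comm]
    refine Finset.sum_congr rfl fun i _ ↦ Finset.sum_congr rfl fun j _ ↦ ?_
    rw [gramOf_inv_symm]
  simp only [h3, mul_add, Finset.sum_add_distrib, h4]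
  rw [h1, trace_eq_frame g hy]
  ring

lemma divergence_smul {f : M → ℝ} {X : VF m M} (hf : FunSmoothAt m f y) (hX : SmoothAt X y) :
    divergence g (f • X) y = f y * divergence g X y + SemiRiem.deriv X f y := by
  have h : (leviCivita g (f • X) y : TangentSpace (𝓡 m) y →ₗ[ℝ] TangentSpace (𝓡 m) y) =
      f y • (leviCivita g X y : TangentSpace (𝓡 m) y →ₗ[ℝ] TangentSpace (𝓡 m) y) +
        (mvfderiv (𝓡 m) f y : TangentSpace (𝓡 m) y →ₗ[ℝ] ℝ).smulRight (X y) := by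
    ext1 u
    exact leviCivita_smul g hf hX.diffAt u
  rw [divergence, h, map_add, map_smul, trace_smulRight g]
  rfl

lemma SmoothAt.sum {ι : Type*} (s : Finset ι) {F : ι → VF m M} (hF : ∀ i ∈ s, SmoothAt (F i) y) :
    SmoothAt (∑ i ∈ s, F i) y := by
  classical
  induction s using Finset.induction_on with
  | empty =>
    rw [Finset.sum_empty]
    exact contMDiffAt_zeroSection (𝕜 := ℝ) (F := (EuclideanSpace ℝ (Fin m)))
        (E := (TangentSpace (𝓡 m) : M → Type _)) (IB := 𝓡 m)
  | insert i s hi ih =>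
    rw [Finset.sum_insert hi]
    exact (hF i (s.mem_insert_self i)).add (ih fun j hj ↦ hF j (Finset.mem_insert_of_mem hj))

lemma divergence_sum {ι : Type*} (s : Finset ι) {F : ι → VF m M}
    (hF : ∀ i ∈ s, SmoothAt (F i) y) :
    divergence g (∑ i ∈ s, F i) y = ∑ i ∈ s, divergence g (F i) y := by
  classical
  induction s using Finset.induction_on with
  | empty => simp only [Finset.sum_empty, divergence, leviCivita_zero]; exact map_zero _
  | insert i s hi ih =>
    have h := fun j hj ↦ hF j (Finset.mem_insert_of_mem (s := s) (a := j) (b := i) hj)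
    rw [Finset.sum_insert hi, Finset.sum_insert hi, ← ih h, divergence,
      leviCivita_add g (hF i (s.mem_insert_self i)).diffAt (SmoothAt.sum s h).diffAt]
    exact map_add (LinearMap.trace ℝ (TangentSpace (𝓡 m) y)) _ _

lemma divergence_congr {Y Z : VF m M} (hY : SmoothAt Y y) (h : ∀ᶠ z in 𝓝 y, Y z = Z z) :
    divergence g Y y = divergence g Z y := by
  rw [divergence, divergence, leviCivita_congr g hY h]

/-- The divergence in a chart: `√|det g| div Z = ∑ ∂_k (√|det g| Z^k)`. -/
lemma density_mul_divergence {Z : VF m M} (hy : y ∈ (chartAt (EuclideanSpace ℝ (Fin m)) p).source)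
    (hZ : SmoothAt Z y) : density g p y * divergence g Z y =
      ∑ k, SemiRiem.deriv (frame p k) (density g p * fun z ↦ coord p k z (Z z)) y := by
  have hc := (smoothAt_iff_coord hy).1 hZ
  have hf := fun k ↦ smoothAt_frame (m := m) hy k
  have h1 : ∀ᶠ z in 𝓝 y, Z z = (∑ k, (fun z ↦ coord p k z (Z z)) • frame p k : VF m M) z := by
    filter_upwards [source_mem_nhds hy] with z hz
    rw [Finset.sum_apply]
    exact eq_sum_coord hz (Z z)
  rw [divergence_congr g hZ h1, divergence_sum g _ fun k _ ↦ SmoothAt.smul (hc k) (hf k),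
    Finset.mul_sum]
  refine Finset.sum_congr rfl fun k _ ↦ ?_
  rw [divergence_smul g (hc k) (hf k), SemiRiem.deriv_mul (smoothAt_density hy) (hc k),
    deriv_density g hy, divergence_frame g hy]
  ring

end ChartDivergence

end SemiRiem

namespace SemiRiem

variable {m : ℕ} {M : Type*} [TopologicalSpace M]
  [ChartedSpace (EuclideanSpace ℝ (Fin m)) M] [IsManifold (𝓡 m) ∞ M] (g : Metric m M)


/-! ### The volume measure in charts -/

section ChartVolume

variable {p q : M}

lemma density_nonneg {z : M} : 0 ≤ density g p z := Real.sqrt_nonneg _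

lemma symm_mem_source {y : (EuclideanSpace ℝ (Fin m))} (hy : y ∈ (extChartAt (𝓡 m) p).target) :
    (extChartAt (𝓡 m) p).symm y ∈ (chartAt (EuclideanSpace ℝ (Fin m)) p).source := by
  rw [← extChartAt_source (𝓡 m)]
  exact (extChartAt (𝓡 m) p).map_target hy

lemma mem_target {z : M} (hz : z ∈ (chartAt (EuclideanSpace ℝ (Fin m)) p).source) :
    extChartAt (𝓡 m) p z ∈ (extChartAt (𝓡 m) p).target :=
  (extChartAt (𝓡 m) p).map_source (by rwa [extChartAt_source])

lemma chartGram_eq {y : (EuclideanSpace ℝ (Fin m))} (hy : y ∈ (extChartAt (𝓡 m) p).target) :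
    chartGram g p y = gramOf g ((extChartAt (𝓡 m) p).symm y)
      (frame p · ((extChartAt (𝓡 m) p).symm y)) := by
  have h (i : Fin m) := ext_apply_mfderiv (symm_mem_source hy) (basisVec p i)
  rw [(extChartAt (𝓡 m) p).right_inv hy] at h
  ext i j
  exact (congr(g.val ((extChartAt (𝓡 m) p).symm y) $(h i) $(h j))).symm

lemma continuousOn_density_symm :
    ContinuousOn (fun y ↦ density g p ((extChartAt (𝓡 m) p).symm y)) (extChartAt (𝓡 m) p).target :=
        by
  intro y hy
  refine ContinuousAt.continuousWithinAt ?_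
  refine ContinuousAt.comp (g := density g p) (smoothAt_density (symm_mem_source hy)).continuousAt
      ?_
  exact (continuousOn_extChartAt_symm p).continuousAt ((isOpen_extChartAt_target p).mem_nhds hy)

lemma gramOf_comb {z : M} (e e' : Fin m → TangentSpace (𝓡 m) z) (J : Matrix (Fin m) (Fin m) ℝ)
    (h : ∀ i, e' i = ∑ k, J k i • e k) :
    gramOf g z e' = J.transpose * gramOf g z e * J := by
  ext i j
  simp only [gramOf, Matrix.of_apply, h, map_sum, map_smul, sum_apply, smul_apply, smul_eq_mul,
    Matrix.mul_apply, Matrix.transpose_apply, Finset.sum_mul, Finset.mul_sum]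
  refine Finset.sum_congr rfl fun k _ ↦ Finset.sum_congr rfl fun l _ ↦ ?_
  ring

lemma contDiffAt_transition {z : M} (hp : z ∈ (chartAt (EuclideanSpace ℝ (Fin m)) p).source)
    (hq : z ∈ (chartAt (EuclideanSpace ℝ (Fin m)) q).source) :
    ContDiffAt ℝ ∞ (extChartAt (𝓡 m) p ∘ (extChartAt (𝓡 m) q).symm) (extChartAt (𝓡 m) q z) := by
  rw [← contMDiffAt_iff_contDiffAt]
  exact ContMDiffAt.comp_of_eq (contMDiffAt_extChartAt' hp) (contMDiffAt_extChartAt_symm hq)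
    (left_inv_extChartAt hq)

lemma frame_transition {z : M} (hp : z ∈ (chartAt (EuclideanSpace ℝ (Fin m)) p).source)
    (hq : z ∈ (chartAt (EuclideanSpace ℝ (Fin m)) q).source) (i : Fin m) :
    frame q i z = ∑ k, (fderiv ℝ (extChartAt (𝓡 m) p ∘ (extChartAt (𝓡 m) q).symm)
      (extChartAt (𝓡 m) q z) (toModel q (basisVec q i)) : EuclideanSpace ℝ (Fin m)) k • frame p k z
          := by
  set f := extChartAt (𝓡 m) p ∘ (extChartAt (𝓡 m) q).symm
  set y := extChartAt (𝓡 m) q z with hy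
  set w := fderiv ℝ f y (toModel q (basisVec q i)) with hw
  have hf : MDifferentiableAt 𝓘(ℝ, EuclideanSpace ℝ (Fin m)) 𝓘(ℝ, EuclideanSpace ℝ (Fin m)) f y :=
    ((contDiffAt_transition hp hq).differentiableAt (by simp)).mdifferentiableAt
  have hfy : f y = extChartAt (𝓡 m) p z := congrArg _ (left_inv_extChartAt hq)
  have hg : MDifferentiableAt 𝓘(ℝ, EuclideanSpace ℝ (Fin m)) (𝓡 m) (extChartAt (𝓡 m) p).symm (f y)
      := by
    rw [hfy]; exact (contMDiffAt_extChartAt_symm hp).mdifferentiableAt (by simp)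
  have h1 : (extChartAt (𝓡 m) q).symm =ᶠ[𝓝 y] (extChartAt (𝓡 m) p).symm ∘ f := by
    have hc : Filter.Tendsto (extChartAt (𝓡 m) q).symm (𝓝 y) (𝓝 z) := by
      have := (contMDiffAt_extChartAt_symm hq).continuousAt.tendsto
      rwa [left_inv_extChartAt hq] at this
    filter_upwards [hc.eventually (source_mem_nhds hp)] with x hx
    exact (left_inv_extChartAt hx).symm
  have h2 : (frame q i z : EuclideanSpace ℝ (Fin m)) = mfderiv 𝓘(ℝ, EuclideanSpace ℝ (Fin m)) (𝓡 m)
      (extChartAt (𝓡 m) p).symm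
      (extChartAt (𝓡 m) p z) w := by
    rw [frame, ext_apply_mfderiv hq, ← hy, h1.mfderiv_eq, mfderiv_comp y hg hf, mfderiv_eq_fderiv]
    exact congr(mfderiv 𝓘(ℝ, EuclideanSpace ℝ (Fin m)) (𝓡 m) (extChartAt (𝓡 m) p).symm $hfy w)
  have h3 : (frame q i z : EuclideanSpace ℝ (Fin m)) = ext (show TangentSpace (𝓡 m) p from w) z :=
      by
    rw [h2, ext_apply_mfderiv hp]; rfl
  have h4 := eq_sum_coord hp (frame q i z)
  refine h4.trans (Finset.sum_congr rfl fun k _ ↦ ?_)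
  congr 1
  have h5 : coord p k z (frame q i z) = coord p k z (ext (show TangentSpace (𝓡 m) p from w) z) :=
    congrArg _ h3
  rw [h5, coord, triv_ext hp]
  rfl

/-- The Gram matrix changes by JᵀGJ with J the Jacobian of the coordinate change, so the square root
of its absolute determinant changes by |det J|. -/
lemma density_transition {z : M} (hp : z ∈ (chartAt (EuclideanSpace ℝ (Fin m)) p).source)
    (hq : z ∈ (chartAt (EuclideanSpace ℝ (Fin m)) q).source) :
    density g q z = |(fderiv ℝ (extChartAt (𝓡 m) p ∘ (extChartAt (𝓡 m) q).symm)
      (extChartAt (𝓡 m) q z)).det| * density g p z := by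
  set L := fderiv ℝ (extChartAt (𝓡 m) p ∘ (extChartAt (𝓡 m) q).symm) (extChartAt (𝓡 m) q z)
  let b := (EuclideanSpace.basisFun (Fin m) ℝ).toBasis
  have h1 := gramOf_comb g (frame p · z) (frame q · z)
      (LinearMap.toMatrix b b (L : (EuclideanSpace ℝ (Fin m)) →ₗ[ℝ] EuclideanSpace ℝ (Fin m)))
    fun i ↦ by
      rw [frame_transition hp hq]
      refine Finset.sum_congr rfl fun k _ ↦ ?_
      congr 1
  have h2 : L.det =
      (LinearMap.toMatrix b b (L : (EuclideanSpace ℝ (Fin m)) →ₗ[ℝ] EuclideanSpace ℝ (Fin m))).det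
          :=
    (LinearMap.det_toMatrix b _).symm
  rw [density, h1, Matrix.det_mul, Matrix.det_mul, Matrix.det_transpose, ← h2, mul_right_comm,
    abs_mul, abs_mul, Real.sqrt_mul (by positivity), Real.sqrt_mul_self (abs_nonneg _), density]

variable [MeasurableSpace M] [BorelSpace M]

lemma measurableSet_inter_preimage {X Y : Type*} [TopologicalSpace X] [TopologicalSpace Y]
    [MeasurableSpace X] [BorelSpace X] [MeasurableSpace Y] [BorelSpace Y] {f : X → Y} {s : Set X}
    (hf : ContinuousOn f s) (hs : MeasurableSet s) {B : Set Y} (hB : MeasurableSet B) :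
    MeasurableSet (s ∩ f ⁻¹' B) := by
  have h : s ∩ f ⁻¹' B = Subtype.val '' ((fun x : s ↦ f x) ⁻¹' B) := by
    ext x; simp [and_comm]
  rw [h]
  exact hs.subtype_image ((continuousOn_iff_continuous_domRestrict.1 hf).measurable hB)

lemma chartVolume_eq : chartVolume g p =
    (((volume : Measure (EuclideanSpace ℝ (Fin m))).restrict
        (extChartAt (𝓡 m) p).target).withDensity
      fun y ↦ ENNReal.ofReal (density g p ((extChartAt (𝓡 m) p).symm y))).map
      (extChartAt (𝓡 m) p).symm := by
  rw [chartVolume]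
  congr 1
  refine withDensity_congr_ae ?_
  filter_upwards [ae_restrict_mem (isOpen_extChartAt_target p).measurableSet] with y hy
  rw [chartGram_eq g hy]; rfl

variable (p) in
lemma aemeasurable_symm :
    AEMeasurable (extChartAt (𝓡 m) p).symm
      ((volume : Measure (EuclideanSpace ℝ (Fin m))).restrict (extChartAt (𝓡 m) p).target) :=
  (continuousOn_extChartAt_symm p).aemeasurable (isOpen_extChartAt_target p).measurableSet

variable (p) in
lemma aemeasurable_density_symm :
    AEMeasurable (fun y ↦ ENNReal.ofReal (density g p ((extChartAt (𝓡 m) p).symm y)))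
      ((volume : Measure (EuclideanSpace ℝ (Fin m))).restrict (extChartAt (𝓡 m) p).target) :=
  ((continuousOn_density_symm g).aemeasurable
      (isOpen_extChartAt_target p).measurableSet).ennreal_ofReal

lemma chartVolume_apply {B : Set M} (hB : MeasurableSet B) : chartVolume g p B =
    ∫⁻ y in (extChartAt (𝓡 m) p).target ∩ (extChartAt (𝓡 m) p).symm ⁻¹' B,
      ENNReal.ofReal (density g p ((extChartAt (𝓡 m) p).symm y)) := by
  have h1 := isOpen_extChartAt_target (I := 𝓡 m) p
  have h2 := measurableSet_inter_preimage (continuousOn_extChartAt_symm (I := 𝓡 m) p)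
      h1.measurableSet hB
  rw [chartVolume_eq, Measure.map_apply_of_aemeasurable
    ((aemeasurable_symm p).mono_ac (withDensity_absolutelyContinuous _ _)) hB]
  have h3 : NullMeasurableSet ((extChartAt (𝓡 m) p).symm ⁻¹' B)
      ((volume : Measure (EuclideanSpace ℝ (Fin m))).restrict (extChartAt (𝓡 m) p).target) :=
    (aemeasurable_symm p).nullMeasurableSet_preimage hB
  rw [withDensity_apply₀ _ h3, Measure.restrict_restrict₀ h3, Set.inter_comm]

/-- The change of variables formula: the Jacobian factor is exactly the one relating the two
densities. -/
lemma chartVolume_eq_of_subset {B : Set M} (hB : MeasurableSet B)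
    (hp : B ⊆ (chartAt (EuclideanSpace ℝ (Fin m)) p).source)
        (hq : B ⊆ (chartAt (EuclideanSpace ℝ (Fin m)) q).source) :
    chartVolume g p B = chartVolume g q B := by
  set f := extChartAt (𝓡 m) p ∘ (extChartAt (𝓡 m) q).symm with hf
  set s := (extChartAt (𝓡 m) q).target ∩ (extChartAt (𝓡 m) q).symm ⁻¹' B with hs
  have hsm : MeasurableSet s := measurableSet_inter_preimage
      (continuousOn_extChartAt_symm (I := 𝓡 m) q)
    (isOpen_extChartAt_target q).measurableSet hB
  have him : (extChartAt (𝓡 m) p).target ∩ (extChartAt (𝓡 m) p).symm ⁻¹' B = f '' s := by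
    ext x
    constructor
    · rintro ⟨hx, hxB⟩
      refine ⟨extChartAt (𝓡 m) q ((extChartAt (𝓡 m) p).symm x), ⟨mem_target (hq hxB), ?_⟩, ?_⟩
      · rw [Set.mem_preimage, left_inv_extChartAt (hq hxB)]; exact hxB
      · rw [hf, Function.comp_apply, left_inv_extChartAt (hq hxB), (extChartAt (𝓡 m) p).right_inv
            hx]
    · rintro ⟨y, ⟨_, hyB⟩, rfl⟩
      refine ⟨mem_target (hp hyB), ?_⟩
      rw [Set.mem_preimage, hf, Function.comp_apply, left_inv_extChartAt (hp hyB)]; exact hyB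
  have hinj : Set.InjOn f s := by
    rintro y ⟨hy, hyB⟩ y' ⟨hy', hyB'⟩ h
    have h1 := congrArg (extChartAt (𝓡 m) p).symm h
    rw [hf, Function.comp_apply, Function.comp_apply, left_inv_extChartAt (hp hyB),
      left_inv_extChartAt (hp hyB')] at h1
    rw [← (extChartAt (𝓡 m) q).right_inv hy, h1, (extChartAt (𝓡 m) q).right_inv hy']
  have hder : ∀ y ∈ s, HasFDerivWithinAt f (fderiv ℝ f y) s y := by
    rintro y ⟨hy, hyB⟩
    have h1 := (contDiffAt_transition (hp hyB) (hq hyB)).differentiableAt (by simp)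
    rw [(extChartAt (𝓡 m) q).right_inv hy] at h1
    exact h1.hasFDerivAt.hasFDerivWithinAt
  rw [chartVolume_apply g hB, chartVolume_apply g hB, him,
    lintegral_image_eq_lintegral_abs_det_fderiv_mul _ hsm hder hinj]
  refine setLIntegral_congr_fun hsm ?_
  rintro y ⟨hy, hyB⟩
  have h1 := density_transition g (hp hyB) (hq hyB)
  rw [(extChartAt (𝓡 m) q).right_inv hy] at h1
  simp only
  rw [h1, ENNReal.ofReal_mul (abs_nonneg _), hf, Function.comp_apply, left_inv_extChartAt (hp hyB)]

lemma chartVolume_compl_source : chartVolume g p (chartAt (EuclideanSpace ℝ (Fin m)) p).sourceᶜ =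
    0 := by
  rw [chartVolume_apply g (chartAt (EuclideanSpace ℝ (Fin m)) p).open_source.measurableSet.compl]
  have : (extChartAt (𝓡 m) p).target ∩
      (extChartAt (𝓡 m) p).symm ⁻¹' (chartAt (EuclideanSpace ℝ (Fin m)) p).sourceᶜ = ∅ := by
    ext y
    simp only [Set.mem_inter_iff, Set.mem_preimage, Set.mem_compl_iff, Set.mem_empty_iff_false,
      iff_false, not_and, not_not]
    exact symm_mem_source
  rw [this]; simp

variable (p) in
/-- The volume measure is given by `√|det g_ij| dy` in each chart. -/
lemma volumeMeasure_restrict_source :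
    (volumeMeasure g).restrict (chartAt (EuclideanSpace ℝ (Fin m)) p).source = chartVolume g p := by
  set s := (chartAt (EuclideanSpace ℝ (Fin m)) p).source
  have hs : MeasurableSet s := (chartAt (EuclideanSpace ℝ (Fin m)) p).open_source.measurableSet
  apply le_antisymm
  -- The right-hand side bounds every chart volume: inside the domain at p the chart volumes agree
  -- on overlaps, and outside it the supremum itself is an upper bound.
  · have hle : volumeMeasure g ≤ chartVolume g p + (volumeMeasure g).restrict sᶜ := by
      refine iSup_le fun q ↦ Measure.le_iff.2 fun B hB ↦ ?_
      set t := (chartAt (EuclideanSpace ℝ (Fin m)) q).source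
      have ht : MeasurableSet t := (chartAt (EuclideanSpace ℝ (Fin m)) q).open_source.measurableSet
      rw [Measure.add_apply, Measure.restrict_apply hB, ← measure_inter_add_sdiff B hs]
      refine add_le_add ?_ (Measure.le_iff'.1 (le_iSup (chartVolume g) q) _)
      calc chartVolume g q (B ∩ s) ≤ chartVolume g q (B ∩ s ∩ t) + chartVolume g q tᶜ := by
            rw [← measure_inter_add_sdiff (B ∩ s) ht]
            exact add_le_add le_rfl (measure_mono fun x hx ↦ hx.2)
        _ = chartVolume g p (B ∩ s ∩ t) := by
            rw [chartVolume_compl_source, add_zero]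
            exact (chartVolume_eq_of_subset g ((hB.inter hs).inter ht) (fun x hx ↦ hx.1.2)
              fun x hx ↦ hx.2).symm
        _ ≤ chartVolume g p B := measure_mono fun x hx ↦ hx.1.1
    refine (Measure.restrict_mono le_rfl hle).trans ?_
    rw [Measure.restrict_add, Measure.restrict_restrict hs, Set.inter_compl_self,
      Measure.restrict_empty, add_zero]
    exact Measure.restrict_le_self
  · have h1 : chartVolume g p = (chartVolume g p).restrict s := by
      refine (Measure.restrict_eq_self_of_ae_mem ?_).symm
      rw [ae_iff]
      exact chartVolume_compl_source g
    rw [h1]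
    exact Measure.restrict_mono le_rfl (le_iSup (chartVolume g) p)

lemma integral_volumeMeasure_of_subset {f : M → ℝ} (hf : Continuous f)
    (hs : ∀ x ∉ (chartAt (EuclideanSpace ℝ (Fin m)) p).source, f x = 0) :
    ∫ x, f x ∂(volumeMeasure g) = ∫ y in (extChartAt (𝓡 m) p).target,
      density g p ((extChartAt (𝓡 m) p).symm y) * f ((extChartAt (𝓡 m) p).symm y) := by
  rw [← setIntegral_eq_integral_of_forall_compl_eq_zero hs, volumeMeasure_restrict_source,
    chartVolume_eq, integral_map
    ((aemeasurable_symm p).mono_ac (withDensity_absolutelyContinuous _ _)) hf.aestronglyMeasurable,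
    integral_withDensity_eq_integral_toReal_smul₀ (aemeasurable_density_symm g p)
      (by simp)]
  refine integral_congr_ae ?_
  filter_upwards with y
  rw [ENNReal.toReal_ofReal (density_nonneg g), smul_eq_mul]

instance isLocallyFiniteMeasure_volumeMeasure : IsLocallyFiniteMeasure (volumeMeasure g) := by
  refine ⟨fun p ↦ ?_⟩
  set e := extChartAt (𝓡 m) p
  have hp := mem_chart_source (EuclideanSpace ℝ (Fin m)) p
  obtain ⟨K, hK, hKt, hKc⟩ := local_compact_nhds (extChartAt_target_mem_nhds' hp)
  set U := (chartAt (EuclideanSpace ℝ (Fin m)) p).source ∩ e ⁻¹' interior K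
  have hU : IsOpen U := by
    have := (continuousOn_extChartAt (I := 𝓡 m) p).isOpen_inter_preimage
      (isOpen_extChartAt_source p) isOpen_interior (t := interior K)
    rwa [extChartAt_source] at this
  refine ⟨U, hU.mem_nhds ⟨hp, mem_interior_iff_mem_nhds.2 hK⟩, ?_⟩
  have h1 : volumeMeasure g U = chartVolume g p U := by
    rw [← volumeMeasure_restrict_source g p, Measure.restrict_apply hU.measurableSet,
      Set.inter_eq_left.2 Set.inter_subset_left]
  rw [h1, chartVolume_apply g hU.measurableSet]
  refine lt_of_le_of_lt (lintegral_mono_set (t := K) ?_) ?_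
  · rintro y ⟨hy, -, hy2⟩
    rw [Set.mem_preimage, e.right_inv hy] at hy2
    exact interior_subset hy2
  · obtain ⟨C, hC⟩ := hKc.bddAbove_image ((continuousOn_density_symm g).mono hKt)
    calc _ ≤ ∫⁻ _ in K, ENNReal.ofReal C := by
          refine setLIntegral_mono' hKc.measurableSet fun y hy ↦ ENNReal.ofReal_le_ofReal ?_
          exact hC (Set.mem_image_of_mem _ hy)
      _ < ⊤ := by
          rw [setLIntegral_const]
          exact ENNReal.mul_lt_top ENNReal.ofReal_lt_top hKc.measure_lt_top

end ChartVolume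

end SemiRiem

namespace SemiRiem

variable {m : ℕ} {M : Type*} [TopologicalSpace M]
  [ChartedSpace (EuclideanSpace ℝ (Fin m)) M] [IsManifold (𝓡 m) ∞ M] (g : Metric m M)


/-! ### The divergence theorem for compactly supported fields -/

section DivergenceTheorem

variable {p y : M}

/-- Integration by parts against the constant function 1. -/
lemma integral_fderiv_eq_zero {E : Type*} [NormedAddCommGroup E] [NormedSpace ℝ E]
    [FiniteDimensional ℝ E] [MeasurableSpace E] [BorelSpace E] {μ : Measure E}
    [μ.IsAddHaarMeasure] {f : E → ℝ} (hf : ContDiff ℝ 1 f) (hc : HasCompactSupport f) (v : E) :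
    Integrable (fun x ↦ fderiv ℝ f x v) μ ∧ ∫ x, fderiv ℝ f x v ∂μ = 0 := by
  have h1 : Integrable (fun x ↦ fderiv ℝ f x v) μ :=
    ((hf.continuous_fderiv (by simp)).clm_apply continuous_const).integrable_of_hasCompactSupport
      (hc.fderiv_apply ℝ v)
  refine ⟨h1, ?_⟩
  have h2 := integral_mul_fderiv_eq_neg_fderiv_mul_of_integrable (μ := μ) (f := fun _ : E ↦ (1 : ℝ))
    (g := f) (v := v) (by simp) (by simpa using h1)
    (by simpa using hf.continuous.integrable_of_hasCompactSupport hc)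
    (fun x _ ↦ differentiableAt_const _) fun x _ ↦ hf.differentiable (by simp) x
  simpa using h2

variable {g} in
lemma SmoothAt.trace {B : Π z : M, TangentSpace (𝓡 m) z →ₗ[ℝ] TangentSpace (𝓡 m) z →ₗ[ℝ] ℝ}
    (hy : y ∈ (chartAt (EuclideanSpace ℝ (Fin m)) p).source)
    (hB : ∀ i j, FunSmoothAt m (fun z ↦ B z (frame p i z) (frame p j z)) y) :
    FunSmoothAt m (fun z ↦ trace g z fun u v ↦ B z u v) y := by
  have h : FunSmoothAt m (fun z ↦ ∑ i, ∑ j, (gramOf g z (frame p · z))⁻¹ i j *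
      B z (frame p i z) (frame p j z)) y :=
    ContMDiffAt.sum fun i _ ↦ ContMDiffAt.sum fun j _ ↦
      (smoothAt_gramOf_frame_inv hy i j).mul (hB i j)
  refine h.congr_of_eventuallyEq ?_
  filter_upwards [source_mem_nhds hy] with z hz using trace_eq_frame g hz (B z)

lemma smoothAt_divergence {Z : VF m M} (hZ : SmoothAt Z y) :
    FunSmoothAt m (divergence g Z) y := by
  have hy := mem_chart_source (EuclideanSpace ℝ (Fin m)) y
  let B (z : M) : TangentSpace (𝓡 m) z →ₗ[ℝ] TangentSpace (𝓡 m) z →ₗ[ℝ] ℝ :=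
    LinearMap.mk₂ ℝ (fun u v ↦ g.val z (leviCivita g Z z u) v) (by simp) (by simp)
      (by simp) (by simp)
  have h : divergence g Z = fun z ↦ trace g z fun u v ↦ B z u v := by
    funext z; exact divergence_eq_trace g Z z
  rw [h]
  exact SmoothAt.trace hy fun i j ↦ ((smoothAt_frame hy i).nabla hZ).pair g (smoothAt_frame hy j)

lemma divergence_eq_zero {Z : VF m M} (h : ∀ᶠ z in 𝓝 y, Z z = 0) : divergence g Z y = 0 := by
  have h0 : SmoothAt (0 : VF m M) y := contMDiffAt_zeroSection (𝕜 := ℝ)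
      (F := (EuclideanSpace ℝ (Fin m)))
    (E := (TangentSpace (𝓡 m) : M → Type _)) (IB := 𝓡 m)
  rw [divergence, ← leviCivita_congr g h0 (h.mono fun z hz ↦ hz.symm), leviCivita_zero]
  exact map_zero _

lemma coord_zero (hy : y ∈ (chartAt (EuclideanSpace ℝ (Fin m)) p).source) (k : Fin m) :
    coord p k y 0 = 0 := by
  rw [← frameBasis_repr hy, map_zero]; rfl

variable [T2Space M] [MeasurableSpace M] [BorelSpace M]

/-- In the chart, √|det g| div Z is a sum of partial derivatives of compactly supported functions,
each with zero integral. -/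
lemma integral_divergence_of_subset_source {Z : VF m M} (hZ : ∀ x, SmoothAt Z x) {K : Set M}
    (hK : IsCompact K) (h0 : ∀ x ∉ K, Z x = 0)
        (hKp : K ⊆ (chartAt (EuclideanSpace ℝ (Fin m)) p).source) :
    ∫ x, divergence g Z x ∂(volumeMeasure g) = 0 := by
  set e := extChartAt (𝓡 m) p with he
  have hdiv0 : ∀ x ∉ K, divergence g Z x = 0 := fun x hx ↦
    divergence_eq_zero g (by filter_upwards [hK.isClosed.isOpen_compl.mem_nhds hx] using h0)
  have hcont : Continuous (divergence g Z) := continuous_iff_continuousAt.2 fun x ↦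
    (smoothAt_divergence g (hZ x)).continuousAt
  rw [integral_volumeMeasure_of_subset g hcont fun x hx ↦ hdiv0 x fun h ↦ hx (hKp h)]
  set F : Fin m → M → ℝ := fun k ↦ density g p * fun z ↦ coord p k z (Z z) with hF
  -- Extension by zero to the whole model space; it stays C¹ because the functions vanish off the
  -- compact image of K.
  set Φ : Fin m → (EuclideanSpace ℝ (Fin m)) → ℝ := fun k ↦ e.target.indicator (F k ∘ e.symm) with
      hΦ
  have hopen : IsOpen e.target := isOpen_extChartAt_target p
  have hFs : ∀ k, ∀ z ∈ (chartAt (EuclideanSpace ℝ (Fin m)) p).source, FunSmoothAt m (F k) z :=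
      fun k z hz ↦
    (smoothAt_density hz).mul ((smoothAt_iff_coord hz).1 (hZ z) k)
  have hΦe : ∀ k, ∀ w ∈ e.target, Φ k =ᶠ[𝓝 w] F k ∘ e.symm := fun k w hw ↦ by
    filter_upwards [hopen.mem_nhds hw] with z hz using Set.indicator_of_mem hz _
  have hKc : IsCompact (e '' K) :=
    hK.image_of_continuousOn ((continuousOn_extChartAt p).mono (by rwa [extChartAt_source]))
  have hΦ0 : ∀ k, ∀ w ∉ e '' K, Φ k w = 0 := fun k w hw ↦ by
    by_cases hwt : w ∈ e.target
    · refine (Set.indicator_of_mem hwt _).trans ?_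
      have : e.symm w ∉ K := fun h ↦ hw ⟨_, h, e.right_inv hwt⟩
      simp only [hF, Function.comp_apply, Pi.mul_apply]
      rw [h0 _ this, coord_zero (symm_mem_source hwt), mul_zero]
    · exact Set.indicator_of_notMem hwt _
  have hΦ0' : ∀ k, ∀ w ∉ e.target, Φ k =ᶠ[𝓝 w] 0 := fun k w hw ↦ by
    have : w ∉ e '' K := by
      rintro ⟨x, hx, rfl⟩
      exact hw (mem_target (hKp hx))
    filter_upwards [hKc.isClosed.isOpen_compl.mem_nhds this] with z hz using hΦ0 k z hz
  have hΦs : ∀ k, ContDiff ℝ 1 (Φ k) := fun k ↦ contDiff_iff_contDiffAt.2 fun w ↦ by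
    by_cases hw : w ∈ e.target
    · have h1 := FunSmoothAt.contDiffAt (symm_mem_source hw) (hFs k _ (symm_mem_source hw))
      rw [e.right_inv hw] at h1
      exact (h1.of_le (by simp)).congr_of_eventuallyEq (hΦe k w hw)
    · exact contDiffAt_const.congr_of_eventuallyEq (hΦ0' k w hw)
  have hint := fun k ↦ integral_fderiv_eq_zero (μ := volume) (hΦs k)
    (HasCompactSupport.intro hKc (hΦ0 k)) (toModel p (basisVec p k))
  have h1 : ∫ w in e.target, density g p (e.symm w) * divergence g Z (e.symm w) =
      ∫ w in e.target, ∑ k, fderiv ℝ (Φ k) w (toModel p (basisVec p k)) := by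
    refine setIntegral_congr_fun hopen.measurableSet fun w hw ↦ ?_
    have hs := symm_mem_source hw
    rw [density_mul_divergence g hs (hZ _)]
    refine Finset.sum_congr rfl fun k _ ↦ ?_
    rw [(hΦe k w hw).fderiv_eq, deriv_ext hs (hFs k _ hs), ← he, e.right_inv hw]
  rw [h1, setIntegral_eq_integral_of_forall_compl_eq_zero, integral_finsetSum _ fun k _ ↦
      (hint k).1]
  · exact Finset.sum_eq_zero fun k _ ↦ (hint k).2
  · intro w hw
    refine Finset.sum_eq_zero fun k _ ↦ ?_
    rw [(hΦ0' k w hw).fderiv_eq]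
    simp

variable [SecondCountableTopology M]

/-- The divergence theorem. -/
theorem integral_divergence_eq_zero {Z : VF m M} (hZ : ∀ x, SmoothAt Z x) {K : Set M}
    (hK : IsCompact K) (h0 : ∀ x ∉ K, Z x = 0) :
    ∫ x, divergence g Z x ∂(volumeMeasure g) = 0 := by
  have : LocallyCompactSpace M := ChartedSpace.locallyCompactSpace (EuclideanSpace ℝ (Fin m)) M
  -- Only finitely many members of the partition meet K, so Z is a finite sum of fields, each
  -- compactly supported in a chart domain.
  obtain ⟨ρ, hρ⟩ := SmoothPartitionOfUnity.exists_isSubordinate_chartAt_source (𝓡 m) M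
  have hfin := ρ.locallyFinite.finite_nonempty_inter_compact hK
  set s := hfin.toFinset with hs
  have hsmul : ∀ i x, SmoothAt (⇑(ρ i) • Z) x := fun i x ↦
    SmoothAt.smul ((ρ i).contMDiff x) (hZ x)
  have hsum : Z = ∑ i ∈ s, (⇑(ρ i) • Z : VF m M) := by
    funext x
    rw [Finset.sum_apply]
    by_cases hx : x ∈ K
    · simp only [Pi.smul_apply']
      have hsub : ρ.finsupport x ⊆ s := fun i hi ↦
        hfin.mem_toFinset.2 ⟨x, (ρ.mem_finsupport x).1 hi, hx⟩
      rw [← Finset.sum_smul, ρ.sum_finsupport' x (Set.mem_univ x) hsub, one_smul]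
    · rw [h0 x hx]
      exact (Finset.sum_eq_zero fun i _ ↦ by rw [Pi.smul_apply', h0 x hx, smul_zero]).symm
  have hdiv : ∀ x, divergence g Z x = ∑ i ∈ s, divergence g (⇑(ρ i) • Z) x := fun x ↦ by
    conv_lhs => rw [hsum]
    exact divergence_sum g s fun i _ ↦ hsmul i x
  have hzero : ∀ i, ∀ x ∉ K ∩ tsupport (ρ i), (⇑(ρ i) • Z : VF m M) x = 0 := fun i x hx ↦ by
    rw [Pi.smul_apply']
    by_cases hxK : x ∈ K
    · rw [image_eq_zero_of_notMem_tsupport fun h ↦ hx ⟨hxK, h⟩, zero_smul]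
    · rw [h0 x hxK, smul_zero]
  have hc : ∀ i, IsCompact (K ∩ tsupport (ρ i)) := fun i ↦ hK.inter_right (isClosed_tsupport _)
  simp only [hdiv]
  rw [integral_finsetSum]
  · exact Finset.sum_eq_zero fun i _ ↦ integral_divergence_of_subset_source g (hsmul i) (hc i)
      (hzero i) fun x hx ↦ hρ i hx.2
  · intro i _
    have hcont : Continuous (divergence g (⇑(ρ i) • Z)) := continuous_iff_continuousAt.2 fun x ↦
      (smoothAt_divergence g (hsmul i x)).continuousAt
    refine hcont.integrable_of_hasCompactSupport (HasCompactSupport.intro (hc i) fun x hx ↦ ?_)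
    refine divergence_eq_zero g ?_
    filter_upwards [(hc i).isClosed.isOpen_compl.mem_nhds hx] using hzero i

end DivergenceTheorem

end SemiRiem

namespace SemiRiem

variable {m : ℕ} {M : Type*} [TopologicalSpace M]
  [ChartedSpace (EuclideanSpace ℝ (Fin m)) M] [IsManifold (𝓡 m) ∞ M] (g : Metric m M)


/-! ### The energy and its expansion -/

section Energy

variable {p y : M}

variable {g} in
lemma smoothAt_gradInner {X Y : VF m M} (hX : SmoothAt X y) (hY : SmoothAt Y y) :
    FunSmoothAt m (gradInner g X Y) y := by
  have hy := mem_chart_source (EuclideanSpace ℝ (Fin m)) y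
  let B (z : M) : TangentSpace (𝓡 m) z →ₗ[ℝ] TangentSpace (𝓡 m) z →ₗ[ℝ] ℝ :=
    LinearMap.mk₂ ℝ (fun u v ↦ g.val z (leviCivita g X z u) (leviCivita g Y z v)) (by simp)
      (by simp) (by simp) (by simp)
  exact SmoothAt.trace (g := g) (B := B) hy fun i j ↦
    ((smoothAt_frame hy i).nabla hX).pair g ((smoothAt_frame hy j).nabla hY)

variable {g} in
-- The definition of Δ̄ uses extensions chosen anew at each point, so its smoothness is not visible;
-- Green's identity expresses g(Δ̄V, X) through manifestly smooth functions.
lemma smoothAt_pair_roughLaplacian {V X : VF m M} (hV : ∀ x, SmoothAt V x)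
    (hX : ∀ x, SmoothAt X x) : FunSmoothAt m (pair g (roughLaplacian g V) X) y := by
  have h : pair g (roughLaplacian g V) X = gradInner g V X - divergence g (adjField g V X) := by
    funext x
    rw [Pi.sub_apply, divergence_adjField g (hV x) (hX x), sub_sub_cancel]
    rfl
  rw [h]
  exact (smoothAt_gradInner (hV y) (hX y)).sub (smoothAt_divergence g ((hV y).adjField (hX y)))

lemma gradInner_add_self {V X : VF m M} (hV : SmoothAt V y) (hX : SmoothAt X y) :
    gradInner g (V + X) (V + X) y =
      gradInner g V V y + 2 * gradInner g V X y + gradInner g X X y := by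
  have h : gradInner g X V y = gradInner g V X y := by
    rw [gradInner, gradInner, ← trace_swap]
    simp only [g.symm y (leviCivita g X y _)]
  have h1 : gradInner g (V + X) (V + X) y =
      gradInner g V V y + gradInner g X V y + (gradInner g V X y + gradInner g X X y) := by
    simp only [gradInner, leviCivita_add g hV.diffAt hX.diffAt, add_apply, map_add, ← trace_add]
  rw [h1, h]
  ring

lemma trace_sasakiPullback (V : VF m M) :
    trace g y (sasakiPullback g V y) = m + gradInner g V V y := by
  have h := trace_val g (1 : TangentSpace (𝓡 m) y →ₗ[ℝ] TangentSpace (𝓡 m) y)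
  rw [trace_one] at h
  rw [← h, gradInner, ← trace_add]
  rfl

lemma continuous_of_smoothAt {f : M → ℝ} (hf : ∀ x, FunSmoothAt m f x) : Continuous f :=
  continuous_iff_continuousAt.2 fun x ↦ (hf x).continuousAt

lemma gradInner_eq_zero_right {V X : VF m M} (h : ∀ᶠ z in 𝓝 y, X z = 0) :
    gradInner g V X y = 0 := by
  have h0 : SmoothAt (0 : VF m M) y := contMDiffAt_zeroSection (𝕜 := ℝ)
      (F := (EuclideanSpace ℝ (Fin m)))
    (E := (TangentSpace (𝓡 m) : M → Type _)) (IB := 𝓡 m)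
  have h1 : leviCivita g X y = 0 := by
    rw [← leviCivita_congr g h0 (h.mono fun z hz ↦ hz.symm), leviCivita_zero]
  simp [gradInner, h1, trace]

variable [T2Space M] [SecondCountableTopology M] [MeasurableSpace M] [BorelSpace M]

lemma integrable_of_smoothAt {f : M → ℝ} (hf : ∀ x, FunSmoothAt m f x) {K : Set M}
    (hK : IsCompact K) (h0 : ∀ x ∉ K, f x = 0) : Integrable f (volumeMeasure g) :=
  (continuous_of_smoothAt hf).integrable_of_hasCompactSupport (HasCompactSupport.intro hK h0)

/-- The energy of a compactly supported perturbation of a vector field. -/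
lemma energy_add_sub {V X : VF m M} (hV : ∀ x, SmoothAt V x) (hX : ∀ x, SmoothAt X x)
    {D K : Set M} (hD : IsCompact (closure D)) (hK : IsCompact K) (hKD : K ⊆ D)
    (h0 : ∀ x ∉ K, X x = 0) :
    energy g D (V + X) - energy g D V = ∫ x, pair g (roughLaplacian g V) X x ∂(volumeMeasure g) +
      2⁻¹ * ∫ x, gradInner g X X x ∂(volumeMeasure g) := by
  have hint {f : M → ℝ} (hf : ∀ x, FunSmoothAt m f x) : IntegrableOn f D (volumeMeasure g) :=
    ((continuous_of_smoothAt hf).continuousOn.integrableOn_compact hD).mono_set subset_closure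
  have h0' : ∀ x ∉ K, ∀ᶠ z in 𝓝 x, X z = 0 := fun x hx ↦ by
    filter_upwards [hK.isClosed.isOpen_compl.mem_nhds hx] using h0
  have e1 := hint fun x ↦ smoothAt_gradInner (g := g) (hV x) (hV x)
  have e2 := hint fun x ↦ smoothAt_gradInner (g := g) (hV x) (hX x)
  have e3 := hint fun x ↦ smoothAt_gradInner (g := g) (hX x) (hX x)
  have e4 : IntegrableOn (fun _ ↦ (m : ℝ)) D (volumeMeasure g) := hint fun x ↦ contMDiffAt_const
  have i1 : ∫ x in D, gradInner g V X x ∂(volumeMeasure g) =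
      ∫ x, gradInner g V X x ∂(volumeMeasure g) :=
    setIntegral_eq_integral_of_forall_compl_eq_zero fun x hx ↦
      gradInner_eq_zero_right g (h0' x fun h ↦ hx (hKD h))
  have i2 : ∫ x in D, gradInner g X X x ∂(volumeMeasure g) =
      ∫ x, gradInner g X X x ∂(volumeMeasure g) :=
    setIntegral_eq_integral_of_forall_compl_eq_zero fun x hx ↦
      gradInner_eq_zero_right g (h0' x fun h ↦ hx (hKD h))
  have i3 : ∫ x, gradInner g V X x ∂(volumeMeasure g) =
      ∫ x, pair g (roughLaplacian g V) X x ∂(volumeMeasure g) := by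
    have h1 := integral_divergence_eq_zero g (fun x ↦ (hV x).adjField (g := g) (hX x)) hK fun x hx ↦
        by
      rw [adjField, h0 x hx, map_zero]
    have h2 : ∀ x, divergence g (adjField g V X) x =
        gradInner g V X x - pair g (roughLaplacian g V) X x := fun x ↦
      divergence_adjField g (hV x) (hX x)
    simp only [h2] at h1
    rw [integral_sub] at h1
    · linarith
    · exact integrable_of_smoothAt g (fun x ↦ smoothAt_gradInner (hV x) (hX x)) hK fun x hx ↦
        gradInner_eq_zero_right g (h0' x hx)
    · refine integrable_of_smoothAt g (fun x ↦ smoothAt_pair_roughLaplacian hV hX) hK fun x hx ↦ ?_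
      rw [pair, h0 x hx, map_zero]
  rw [energy, energy]
  simp only [trace_sasakiPullback, fun x ↦ gradInner_add_self g (hV x) (hX x)]
  have e5 : IntegrableOn (fun x ↦ 2 * gradInner g V X x) D (volumeMeasure g) := e2.const_mul 2
  have e6 : IntegrableOn (fun x ↦ gradInner g V V x + 2 * gradInner g V X x) D (volumeMeasure g) :=
    e1.add e5
  have e7 : IntegrableOn (fun x ↦ gradInner g V V x + 2 * gradInner g V X x + gradInner g X X x) D
    (volumeMeasure g) := e6.add e3
  rw [integral_add e4 e7, integral_add e6 e3, integral_add e1 e5, integral_add e4 e1,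
    integral_const_mul, i1, i2, i3]
  ring

end Energy

/-! ### Quadratic estimates along smooth variations -/

section Asymptotics

open Asymptotics

variable {p : M}

/-- Strict differentiability bounds f(t, w) - f(0, w) by a multiple of |t| uniformly for w near y.
-/
lemma isBigO_fst {E : Type*} [NormedAddCommGroup E] [NormedSpace ℝ E] {f : ℝ × E → ℝ} {y : E}
    (hf : ContDiffAt ℝ 1 f (0, y)) (h0 : ∀ᶠ w in 𝓝 y, f (0, w) = 0) :
    f =O[𝓝 (0, y)] Prod.fst := by
  have h1 := (hf.hasStrictFDerivAt (by simp)).isBigO_sub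
  have h2 : Filter.Tendsto (fun z : ℝ × E ↦ (z, ((0 : ℝ), z.2))) (𝓝 (0, y)) (𝓝 ((0, y), (0, y))) :=
      by
    have : Continuous fun z : ℝ × E ↦ (z, ((0 : ℝ), z.2)) := by fun_prop
    exact this.tendsto' _ _ rfl
  have h3 := h1.comp_tendsto h2
  have h4 : (fun z : ℝ × E ↦ f z) =ᶠ[𝓝 (0, y)] fun z ↦ f z - f (0, z.2) := by
    filter_upwards [(continuous_snd.tendsto ((0 : ℝ), y)).eventually h0] with z hz
    rw [hz, sub_zero]
  refine h4.trans_isBigO (h3.trans (IsBigO.of_bound 1 (Filter.Eventually.of_forall fun z ↦ ?_)))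
  simp [Prod.norm_def]

/-- The model with corners of the product of the time axis and the manifold. -/
abbrev timeModel (m : ℕ) := (𝓘(ℝ, ℝ)).prod (𝓡 m)

lemma contDiffAt_timeChart {A : ℝ × M → ℝ} {t : ℝ} {x : M}
    (hx : x ∈ (chartAt (EuclideanSpace ℝ (Fin m)) p).source)
    (hA : ContMDiffAt (timeModel m) 𝓘(ℝ) ∞ A (t, x)) :
    ContDiffAt ℝ ∞ (fun z : ℝ × (EuclideanSpace ℝ (Fin m)) ↦ A (z.1, (extChartAt (𝓡 m) p).symm z.2))
      (t, extChartAt (𝓡 m) p x) := by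
  rw [← contMDiffAt_iff_contDiffAt]
  have h1 : ContMDiffAt 𝓘(ℝ, ℝ × (EuclideanSpace ℝ (Fin m))) 𝓘(ℝ, ℝ) ∞ (Prod.fst :
      ℝ × (EuclideanSpace ℝ (Fin m)) → ℝ)
      (t, extChartAt (𝓡 m) p x) := contDiffAt_fst.contMDiffAt
  have h2 : ContMDiffAt 𝓘(ℝ, ℝ × (EuclideanSpace ℝ (Fin m))) 𝓘(ℝ, EuclideanSpace ℝ (Fin m)) ∞
      (Prod.snd : ℝ × (EuclideanSpace ℝ (Fin m)) → EuclideanSpace ℝ (Fin m))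
      (t, extChartAt (𝓡 m) p x) := contDiffAt_snd.contMDiffAt
  have h3 := h1.prodMk (ContMDiffAt.comp (g := (extChartAt (𝓡 m) p).symm)
    (t, extChartAt (𝓡 m) p x) (contMDiffAt_extChartAt_symm hx) h2)
  exact ContMDiffAt.comp_of_eq (g := A) hA h3 (Prod.ext rfl (left_inv_extChartAt hx))

lemma tendsto_timeChart :
    Filter.Tendsto (fun z : ℝ × M ↦ (z.1, extChartAt (𝓡 m) p z.2)) (𝓝 (0, p))
      (𝓝 (0, extChartAt (𝓡 m) p p)) := by
  have : ContinuousAt (fun z : ℝ × M ↦ (z.1, extChartAt (𝓡 m) p z.2)) (0, p) :=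
    continuousAt_fst.prodMk
      ((continuousAt_extChartAt (I := 𝓡 m) p).comp_of_eq continuousAt_snd rfl)
  exact this.tendsto

lemma eventually_source : ∀ᶠ z in 𝓝 ((0 : ℝ), p),
    z.2 ∈ (chartAt (EuclideanSpace ℝ (Fin m)) p).source :=
  (continuous_snd.tendsto ((0 : ℝ), p)).eventually (source_mem_nhds (mem_chart_source _ p))

/-- A smooth function of time and position which vanishes at time `0` is `O(t)`. -/
lemma isBigO_time {A : ℝ × M → ℝ} (hA : ContMDiffAt (timeModel m) 𝓘(ℝ) ∞ A (0, p))
    (h0 : ∀ x, A (0, x) = 0) : A =O[𝓝 (0, p)] Prod.fst := by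
  have hp := mem_chart_source (EuclideanSpace ℝ (Fin m)) p
  have h1 := (isBigO_fst ((contDiffAt_timeChart hp hA).of_le (by simp))
    (Filter.Eventually.of_forall fun w ↦ h0 _)).comp_tendsto tendsto_timeChart
  refine Filter.EventuallyEq.trans_isBigO ?_ h1
  filter_upwards [eventually_source (m := m)] with z hz
  simp only [Function.comp_apply]
  rw [left_inv_extChartAt hz]

/-- The spatial derivatives of a smooth function of time and position which vanishes at time `0`
are `O(t)`. -/
lemma isBigO_time_deriv {A : ℝ × M → ℝ} (hA : ContMDiffAt (timeModel m) 𝓘(ℝ) ∞ A (0, p))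
    (h0 : ∀ x, A (0, x) = 0) (v : TangentSpace (𝓡 m) p) :
    (fun z : ℝ × M ↦ SemiRiem.deriv (ext v) (fun x ↦ A (z.1, x)) z.2) =O[𝓝 (0, p)] Prod.fst := by
  have hp := mem_chart_source (EuclideanSpace ℝ (Fin m)) p
  set e := extChartAt (𝓡 m) p with he
  set f : ℝ × (EuclideanSpace ℝ (Fin m)) → ℝ := fun z ↦ A (z.1, e.symm z.2) with hf
  have hfs : ContDiffAt ℝ ∞ f (0, e p) := contDiffAt_timeChart hp hA
  have hf1 : ∀ᶠ z in 𝓝 ((0 : ℝ), e p), DifferentiableAt ℝ f z := by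
    filter_upwards [(hfs.of_le (m := 1) (by simp)).eventually (by simp)] with z hz
      using hz.differentiableAt (by simp)
  have hpart {z : ℝ × (EuclideanSpace ℝ (Fin m))} (hz : DifferentiableAt ℝ f z) :
      fderiv ℝ (fun w ↦ f (z.1, w)) z.2 (toModel p v) = fderiv ℝ f z (0, toModel p v) := by
    have h := HasFDerivAt.comp z.2 (g := f) (f := fun w ↦ (z.1, w)) hz.hasFDerivAt
      (hasFDerivAt_prodMk_right z.1 z.2)
    have h' : fderiv ℝ (fun w ↦ f (z.1, w)) z.2 = _ := h.fderiv
    rw [h']; rfl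
  have h1 : (fun z ↦ fderiv ℝ f z (0, toModel p v)) =O[𝓝 (0, e p)] Prod.fst := by
    refine isBigO_fst ((hfs.fderiv_right (m := 1)
      (by rw [one_add_one_eq_two]; exact two_le_infty)).clm_apply contDiffAt_const) ?_
    have hc : Filter.Tendsto (fun w : (EuclideanSpace ℝ (Fin m)) ↦ ((0 : ℝ), w)) (𝓝 (e p))
        (𝓝 (0, e p)) :=
      (Continuous.prodMk_right (0 : ℝ)).tendsto _
    filter_upwards [hc.eventually hf1] with w hw
    rw [← hpart hw]
    simp only [hf, h0]
    simp
  refine Filter.EventuallyEq.trans_isBigO ?_ (h1.comp_tendsto tendsto_timeChart)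
  have hA1 : ∀ᶠ z in 𝓝 ((0 : ℝ), p), ContMDiffAt (timeModel m) 𝓘(ℝ) 1 A z :=
    (contMDiffAt_iff_contMDiffAt_nhds (by simp)).1 (hA.of_le (by simp))
  filter_upwards [eventually_source (m := m), hA1, tendsto_timeChart.eventually hf1]
    with z hz hz1 hz2
  have hd : MDifferentiableAt (𝓡 m) 𝓘(ℝ) (fun x ↦ A (z.1, x)) z.2 :=
    (ContMDiffAt.comp (I := 𝓡 m) z.2 (g := A) (f := fun x ↦ (z.1, x)) hz1
      (contMDiffAt_const.prodMk contMDiffAt_id)).mdifferentiableAt (by simp)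
  rw [SemiRiem.deriv, mvfderiv_ext hz hd, Function.comp_apply, ← hpart hz2]
  rfl

lemma isBigO_one_snd {f : M → ℝ} (hf : ContinuousAt f p) :
    (fun z : ℝ × M ↦ f z.2) =O[𝓝 (0, p)] fun _ ↦ (1 : ℝ) :=
  (hf.comp_of_eq (f := fun z : ℝ × M ↦ z.2) continuousAt_snd rfl).tendsto.isBigO_one ℝ

lemma val_eq_sum_frame {y : M} (hy : y ∈ (chartAt (EuclideanSpace ℝ (Fin m)) p).source)
    (a b : TangentSpace (𝓡 m) y) :
    g.val y a b = ∑ k, ∑ l, (gramOf g y (frame p · y))⁻¹ k l *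
      (g.val y a (frame p l y) * g.val y b (frame p k y)) := by
  conv_lhs => rw [eq_sum_coord hy a]
  rw [map_sum, sum_apply]
  refine Finset.sum_congr rfl fun k _ ↦ ?_
  rw [map_smul, smul_apply, smul_eq_mul, coord_eq_sum hy, Finset.sum_mul, g.symm y _ b]
  exact Finset.sum_congr rfl fun l _ ↦ by ring

lemma isBigO_quadratic {F F' : Fin m → ℝ × M → ℝ} (hF : ∀ k, F k =O[𝓝 (0, p)] Prod.fst)
    (hF' : ∀ k, F' k =O[𝓝 (0, p)] Prod.fst) :
    (fun z : ℝ × M ↦ ∑ k, ∑ l, (gramOf g z.2 (frame p · z.2))⁻¹ k l * (F l z * F' k z))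
      =O[𝓝 (0, p)] fun z ↦ z.1 ^ 2 := by
  refine IsBigO.fun_sum fun k _ ↦ IsBigO.fun_sum fun l _ ↦ ?_
  have h :=
      (isBigO_one_snd (smoothAt_gramOf_frame_inv (g := g)
          (mem_chart_source (EuclideanSpace ℝ (Fin m)) p) k l).continuousAt).mul
    ((hF l).mul (hF' k))
  refine h.congr_right fun z ↦ by ring

variable {X : ℝ → VF m M}

lemma isBigO_val_self (hX0 : ∀ x, X 0 x = 0)
    (hX : ∀ Y : VF m M, SmoothAt Y p →
      ContMDiffAt (timeModel m) 𝓘(ℝ) ∞ (fun z : ℝ × M ↦ pair g (X z.1) Y z.2) (0, p)) :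
    (fun z : ℝ × M ↦ g.val z.2 (X z.1 z.2) (X z.1 z.2)) =O[𝓝 (0, p)] fun z ↦ z.1 ^ 2 := by
  have hF (k : Fin m) :=
      isBigO_time (hX _ (smoothAt_frame (mem_chart_source (EuclideanSpace ℝ (Fin m)) p) k))
    fun x ↦ by simp [pair, hX0]
  refine Filter.EventuallyEq.trans_isBigO ?_ (isBigO_quadratic g hF hF)
  filter_upwards [eventually_source (m := m)] with z hz using val_eq_sum_frame g hz _ _

lemma isBigO_gradInner_self (hX0 : ∀ x, X 0 x = 0)
    (hX : ∀ Y : VF m M, SmoothAt Y p →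
      ContMDiffAt (timeModel m) 𝓘(ℝ) ∞ (fun z : ℝ × M ↦ pair g (X z.1) Y z.2) (0, p))
    (hXs : ∀ᶠ t in 𝓝 0, ∀ x, SmoothAt (X t) x) :
    (fun z : ℝ × M ↦ gradInner g (X z.1) (X z.1) z.2) =O[𝓝 (0, p)] fun z ↦ z.1 ^ 2 := by
  have hp := mem_chart_source (EuclideanSpace ℝ (Fin m)) p
  -- These are the components g(∇_i X, ∂_k), rewritten as ∂_i g(X, ∂_k) - g(X, ∇_i ∂_k) so that only
  -- scalar functions of time and position are differentiated.
  set F : Fin m → Fin m → ℝ × M → ℝ := fun i k z ↦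
    SemiRiem.deriv (frame p i) (pair g (X z.1) (frame p k)) z.2
      - pair g (X z.1) (nabla g (frame p i) (frame p k)) z.2 with hFdef
  have hF : ∀ i k, F i k =O[𝓝 (0, p)] Prod.fst := fun i k ↦
    (isBigO_time_deriv (hX _ (smoothAt_frame hp k)) (fun x ↦ by simp [pair, hX0]) _).sub
      (isBigO_time (hX _ ((smoothAt_frame hp i).nabla (smoothAt_frame hp k)))
        fun x ↦ by simp [pair, hX0])
  have h1 : (fun z : ℝ × M ↦ ∑ i, ∑ j, (gramOf g z.2 (frame p · z.2))⁻¹ i j *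
      ∑ k, ∑ l, (gramOf g z.2 (frame p · z.2))⁻¹ k l * (F i l z * F j k z))
      =O[𝓝 (0, p)] fun z ↦ z.1 ^ 2 := by
    refine IsBigO.fun_sum fun i _ ↦ IsBigO.fun_sum fun j _ ↦ ?_
    have h := (isBigO_one_snd (smoothAt_gramOf_frame_inv (g := g) hp i j).continuousAt).mul
      (isBigO_quadratic g (hF i) (hF j))
    exact h.congr_right fun z ↦ by ring
  refine Filter.EventuallyEq.trans_isBigO ?_ h1
  filter_upwards [eventually_source (m := m), (continuous_fst.tendsto ((0 : ℝ), p)).eventually hXs]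
    with z hz hzs
  let B : TangentSpace (𝓡 m) z.2 →ₗ[ℝ] TangentSpace (𝓡 m) z.2 →ₗ[ℝ] ℝ :=
    LinearMap.mk₂ ℝ (fun u v ↦ g.val z.2 (leviCivita g (X z.1) z.2 u) (leviCivita g (X z.1) z.2 v))
      (by simp) (by simp) (by simp) (by simp)
  have h2 := trace_eq_frame g hz B
  refine Eq.trans (show _ = trace g z.2 fun u v ↦ B u v from rfl) (h2.trans ?_)
  refine Finset.sum_congr rfl fun i _ ↦ Finset.sum_congr rfl fun j _ ↦ ?_
  have h3 (i k : Fin m) : g.val z.2 (leviCivita g (X z.1) z.2 (frame p i z.2)) (frame p k z.2) =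
      F i k z := by
    simp only [hFdef]
    rw [deriv_pair g (hzs z.2).diffAt (smoothAt_frame hz k).diffAt]
    simp [pair, nabla]
  simp only [B, LinearMap.mk₂_apply]
  rw [val_eq_sum_frame g hz]
  simp only [h3]

variable [T2Space M] [MeasurableSpace M] [BorelSpace M]

lemma isBigO_integral {K : Set M} (hK : IsCompact K) {q : ℝ → M → ℝ}
    (h0 : ∀ᶠ t in 𝓝 0, ∀ x ∉ K, q t x = 0)
    (hq : ∀ p ∈ K, (fun z : ℝ × M ↦ q z.1 z.2) =O[𝓝 (0, p)] fun z ↦ z.1 ^ 2) :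
    (fun t ↦ ∫ x, q t x ∂(volumeMeasure g)) =O[𝓝 0] fun t : ℝ ↦ t ^ 2 := by
  -- Compactness of K turns the local bounds into one uniform bound.
  have hb : ∃ C : ℝ, ∀ᶠ t in 𝓝 (0 : ℝ), ∀ x ∈ K, ‖q t x‖ ≤ C * t ^ 2 := by
    refine hK.induction_on (p := fun s ↦ ∃ C : ℝ, ∀ᶠ t in 𝓝 (0 : ℝ), ∀ x ∈ s, ‖q t x‖ ≤ C * t ^ 2)
      ⟨0, by simp⟩ ?_ ?_ ?_
    · rintro s s' hs ⟨C, hC⟩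
      exact ⟨C, hC.mono fun t ht x hx ↦ ht x (hs hx)⟩
    · rintro s s' ⟨C, hC⟩ ⟨C', hC'⟩
      refine ⟨max C C', ?_⟩
      filter_upwards [hC, hC'] with t ht ht' x hx
      rcases hx with hx | hx
      · exact (ht x hx).trans (by gcongr; exact le_max_left _ _)
      · exact (ht' x hx).trans (by gcongr; exact le_max_right _ _)
    · intro p hp
      obtain ⟨C, hC⟩ := (hq p hp).bound
      rw [nhds_prod_eq, Filter.eventually_prod_iff] at hC
      obtain ⟨P, hP, P', hP', h⟩ := hC
      refine ⟨{x | P' x}, mem_nhdsWithin_of_mem_nhds hP', C, ?_⟩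
      filter_upwards [hP] with t ht x hx
      simpa using h ht hx
  obtain ⟨C, hC⟩ := hb
  refine IsBigO.of_bound (C * (volumeMeasure g).real K) ?_
  filter_upwards [hC, h0] with t ht h0t
  rw [← setIntegral_eq_integral_of_forall_compl_eq_zero h0t]
  refine (norm_setIntegral_le_of_norm_le_const hK.measure_lt_top ht).trans (le_of_eq ?_)
  simp
  ring

end Asymptotics

end SemiRiem

namespace SemiRiem

variable {m : ℕ} {M : Type*} [TopologicalSpace M]
  [ChartedSpace (EuclideanSpace ℝ (Fin m)) M] [IsManifold (𝓡 m) ∞ M] (g : Metric m M)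


/-! ### First variation and the Euler-Lagrange equation -/

section Variations

open Asymptotics

variable {p : M}

lemma hasDerivAt_of_isBigO {f : ℝ → ℝ} {c : ℝ}
    (h : (fun t ↦ f t - f 0 - t * c) =O[𝓝 0] fun t : ℝ ↦ t ^ 2) : HasDerivAt f c 0 := by
  rw [hasDerivAt_iff_isLittleO_nhds_zero]
  simpa using h.trans_isLittleO (isLittleO_pow_id one_lt_two)

lemma contMDiffAt_pair_time {W : ℝ → VF m M} {z : ℝ × M}
    (hW : ContMDiffAt (timeModel m) ((𝓡 m).prod 𝓘(ℝ, EuclideanSpace ℝ (Fin m))) ∞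
      (fun p : ℝ × M ↦ TotalSpace.mk' (EuclideanSpace ℝ (Fin m)) p.2 (W p.1 p.2)) z) {Y : VF m M}
    (hY : SmoothAt Y z.2) :
    ContMDiffAt (timeModel m) 𝓘(ℝ) ∞ (fun p : ℝ × M ↦ pair g (W p.1) Y p.2) z := by
  have h1 : ContMDiffAt (timeModel m) (𝓡 m) ∞ (Prod.snd : ℝ × M → M) z := contMDiffAt_snd
  have h2 : ContMDiffAt (timeModel m) ((𝓡 m).prod 𝓘(ℝ)) ∞
      (fun p : ℝ × M ↦ TotalSpace.mk' ℝ (E := Bundle.Trivial M ℝ) p.2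
        (g.val p.2 (W p.1 p.2) (Y p.2))) z :=
    ContMDiffAt.clm_bundle_apply₂ (F₁ := (EuclideanSpace ℝ (Fin m)))
        (F₂ := (EuclideanSpace ℝ (Fin m)))
      (ContMDiffAt.comp z (g.smooth z.2) h1) hW (ContMDiffAt.comp z hY h1)
  rw [contMDiffAt_totalSpace] at h2
  exact h2.2

lemma contMDiffAt_comp_snd {f : M → ℝ} {z : ℝ × M} (hf : FunSmoothAt m f z.2) :
    ContMDiffAt (timeModel m) 𝓘(ℝ) ∞ (fun p : ℝ × M ↦ f p.2) z :=
  ContMDiffAt.comp (g := f) z hf contMDiffAt_snd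

lemma contMDiffAt_pair_time_sub {W : ℝ → VF m M} {z : ℝ × M}
    (hW : ContMDiffAt (timeModel m) ((𝓡 m).prod 𝓘(ℝ, EuclideanSpace ℝ (Fin m))) ∞
      (fun p : ℝ × M ↦ TotalSpace.mk' (EuclideanSpace ℝ (Fin m)) p.2 (W p.1 p.2)) z) {V Y : VF m M}
    (hV : SmoothAt V z.2) (hY : SmoothAt Y z.2) :
    ContMDiffAt (timeModel m) 𝓘(ℝ) ∞ (fun p : ℝ × M ↦ pair g (W p.1 - V) Y p.2) z := by
  have h := (contMDiffAt_pair_time g hW hY).sub (contMDiffAt_comp_snd (hV.pair g hY))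
  have e : (fun p : ℝ × M ↦ pair g (W p.1 - V) Y p.2) =
      (fun p : ℝ × M ↦ pair g (W p.1) Y p.2) - fun p : ℝ × M ↦ pair g V Y p.2 := by
    funext z; simp [pair]
  rw [e]
  exact h

lemma smoothAt_time {W : ℝ → VF m M} {t : ℝ} {x : M}
    (hW : ContMDiffAt (timeModel m) ((𝓡 m).prod 𝓘(ℝ, EuclideanSpace ℝ (Fin m))) ∞
      (fun p : ℝ × M ↦ TotalSpace.mk' (EuclideanSpace ℝ (Fin m)) p.2 (W p.1 p.2)) (t, x)) :
          SmoothAt (W t) x :=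
  ContMDiffAt.comp (I := 𝓡 m) x (f := fun y ↦ (t, y)) hW (contMDiffAt_const.prodMk contMDiffAt_id)

lemma triv_comb {y : M} (hy : y ∈ (chartAt (EuclideanSpace ℝ (Fin m)) p).source) (a b : ℝ)
    (v w : TangentSpace (𝓡 m) y) :
    (triv p (⟨y, a • v + b • w⟩ : TangentBundle (𝓡 m) M)).2 =
      a • (triv p (⟨y, v⟩ : TangentBundle (𝓡 m) M)).2 +
      b • (triv p (⟨y, w⟩ : TangentBundle (𝓡 m) M)).2 := by
  have h := (triv p : Trivialization (EuclideanSpace ℝ (Fin m)) (TotalSpace.proj :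
      TangentBundle (𝓡 m) M → M)).linear ℝ
    (mem_triv_baseSet.2 hy)
  rw [← h.map_smul, ← h.map_smul, ← h.map_add]

lemma contMDiffAt_comb {a b : ℝ × M → ℝ} {z : ℝ × M} {V X : VF m M}
    (ha : ContMDiffAt (timeModel m) 𝓘(ℝ) ∞ a z) (hb : ContMDiffAt (timeModel m) 𝓘(ℝ) ∞ b z)
    (hV : SmoothAt V z.2) (hX : SmoothAt X z.2) :
    ContMDiffAt (timeModel m) ((𝓡 m).prod 𝓘(ℝ, EuclideanSpace ℝ (Fin m))) ∞
      (fun p : ℝ × M ↦ TotalSpace.mk' (EuclideanSpace ℝ (Fin m)) p.2 (a p • V p.2 + b p • X p.2)) z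
          := by
  have h1 : ContMDiffAt (timeModel m) (𝓡 m) ∞ (Prod.snd : ℝ × M → M) z := contMDiffAt_snd
  have hs := mem_chart_source (EuclideanSpace ℝ (Fin m)) z.2
  have hV' := ContMDiffAt.comp z ((smoothAt_iff hs).1 hV) h1
  have hX' := ContMDiffAt.comp z ((smoothAt_iff hs).1 hX) h1
  rw [contMDiffAt_totalSpace]
  refine ⟨h1, ((ha.smul hV').add (hb.smul hX')).congr_of_eventuallyEq ?_⟩
  filter_upwards [(continuous_snd.tendsto z).eventually (source_mem_nhds hs)] with w hw
  exact triv_comb hw _ _ _ _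

variable [T2Space M] [SecondCountableTopology M] [MeasurableSpace M] [BorelSpace M]

/-- The first variation of the energy. -/
lemma energy_variation {V : VF m M} (hV : ∀ x, SmoothAt V x) {D K : Set M}
    (hD : IsCompact (closure D)) (hK : IsCompact K) (hKD : K ⊆ D) {ε : ℝ} (hε : 0 < ε)
    {W : ℝ → VF m M}
    (hW : ContMDiffOn (𝓘(ℝ).prod (𝓡 m)) ((𝓡 m).prod 𝓘(ℝ, EuclideanSpace ℝ (Fin m))) ∞
      (fun p : ℝ × M ↦ TotalSpace.mk' (EuclideanSpace ℝ (Fin m)) p.2 (W p.1 p.2))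
          (Set.Ioo (-ε) ε ×ˢ Set.univ))
    (hW0 : ∀ x, W 0 x = V x) (hWK : ∀ t ∈ Set.Ioo (-ε) ε, ∀ x ∉ K, W t x = V x) :
    (fun t ↦ energy g D (W t) - energy g D V
      - ∫ x, pair g (roughLaplacian g V) (W t - V) x ∂(volumeMeasure g))
      =O[𝓝 0] fun t : ℝ ↦ t ^ 2 := by
  have hWat : ∀ t ∈ Set.Ioo (-ε) ε, ∀ x : M, ContMDiffAt (timeModel m)
      ((𝓡 m).prod 𝓘(ℝ, EuclideanSpace ℝ (Fin m))) ∞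
      (fun p : ℝ × M ↦ TotalSpace.mk' (EuclideanSpace ℝ (Fin m)) p.2 (W p.1 p.2)) (t, x) :=
          fun t ht x ↦
    hW.contMDiffAt (prod_mem_nhds (Ioo_mem_nhds ht.1 ht.2) Filter.univ_mem)
  have hmem : ∀ᶠ t in 𝓝 (0 : ℝ), t ∈ Set.Ioo (-ε) ε := Ioo_mem_nhds (by linarith) hε
  have hX : ∀ t ∈ Set.Ioo (-ε) ε, ∀ x, SmoothAt (W t - V) x := fun t ht x ↦
    (smoothAt_time (hWat t ht x)).sub (hV x)
  have hX0 : ∀ t ∈ Set.Ioo (-ε) ε, ∀ x ∉ K, (W t - V) x = 0 := fun t ht x hx ↦ by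
    rw [Pi.sub_apply, hWK t ht x hx, sub_self]
  have h1 : (fun t ↦ 2⁻¹ * ∫ x, gradInner g (W t - V) (W t - V) x ∂(volumeMeasure g))
      =O[𝓝 0] fun t : ℝ ↦ t ^ 2 := by
    refine (isBigO_integral g hK ?_ fun p hp ↦ ?_).const_mul_left _
    · filter_upwards [hmem] with t ht x hx
      refine gradInner_eq_zero_right g ?_
      filter_upwards [hK.isClosed.isOpen_compl.mem_nhds hx] using hX0 t ht
    · refine isBigO_gradInner_self g (X := fun t ↦ W t - V)
          (fun x ↦ by rw [Pi.sub_apply, hW0, sub_self])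
        (fun Y hY ↦ ?_) (hmem.mono hX)
      exact contMDiffAt_pair_time_sub g (hWat 0 hmem.self_of_nhds p) (hV p) hY
  refine Filter.EventuallyEq.trans_isBigO ?_ h1
  filter_upwards [hmem] with t ht
  have h3 := energy_add_sub g hV (hX t ht) hD hK hKD (hX0 t ht)
  rw [add_sub_cancel] at h3
  rw [h3]
  ring

/-- A vector field of constant length which is an eigenvector of the rough Laplacian is harmonic. -/
theorem isHarmonicVF_of_roughLaplacian_eq {V : VF m M} (hV : IsSmooth V) {r c : ℝ} (hr : r ≠ 0)
    (hVr : ∀ x, g.val x (V x) (V x) = r) (hc : ∀ x, roughLaplacian g V x = c • V x) :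
    IsHarmonicVF g V := by
  refine ⟨hV, r, hr, hVr, fun D K _ hD hK hKD ε hε W hW hW0 hWr hWK ↦ hasDerivAt_of_isBigO ?_⟩
  have h1 := energy_variation g hV hD hK hKD hε hW hW0 hWK
  have hmem : ∀ᶠ t in 𝓝 (0 : ℝ), t ∈ Set.Ioo (-ε) ε := Ioo_mem_nhds (by linarith) hε
  have hWat : ∀ x : M, ContMDiffAt (timeModel m) ((𝓡 m).prod 𝓘(ℝ, EuclideanSpace ℝ (Fin m))) ∞
      (fun p : ℝ × M ↦ TotalSpace.mk' (EuclideanSpace ℝ (Fin m)) p.2 (W p.1 p.2)) (0, x) := fun x ↦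
    hW.contMDiffAt (prod_mem_nhds hmem Filter.univ_mem)
  have h2 : (fun t ↦ ∫ x, pair g (roughLaplacian g V) (W t - V) x ∂(volumeMeasure g))
      =O[𝓝 0] fun t : ℝ ↦ t ^ 2 := by
    have h3 : (fun t ↦ ∫ x, g.val x ((W t - V) x) ((W t - V) x) ∂(volumeMeasure g))
        =O[𝓝 0] fun t : ℝ ↦ t ^ 2 := by
      refine isBigO_integral g hK ?_ fun p hp ↦ ?_
      · filter_upwards [hmem] with t ht x hx
        rw [Pi.sub_apply, hWK t ht x hx, sub_self, map_zero]
      · refine isBigO_val_self g (X := fun t ↦ W t - V)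
          (fun x ↦ by rw [Pi.sub_apply, hW0, sub_self]) fun Y hY ↦ ?_
        exact contMDiffAt_pair_time_sub g (hWat p) (hV p) hY
    refine Filter.EventuallyEq.trans_isBigO ?_ (h3.const_mul_left (-(c / 2)))
    -- Since V and V + X have the same length, g(V, X) = -½ g(X, X) with X = W t - V; hence the
    -- factor -c/2.
    filter_upwards [hmem] with t ht
    rw [← integral_const_mul]
    congr; funext x
    have h4 := hWr t ht x
    have h5 : W t x = V x + (W t - V) x := by simp
    rw [h5] at h4
    simp only [map_add, add_apply, hVr x, g.symm x ((W t - V) x) (V x)] at h4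
    rw [pair, hc, map_smul, smul_apply, smul_eq_mul]
    linear_combination (c / 2) * h4
  have h3 := h1.add h2
  have hW0' : W 0 = V := funext hW0
  simpa [hW0'] using h3

/-- The density is positive on chart domains. This is needed to conclude from ∫ F² = 0 that F
vanishes. -/
instance isOpenPosMeasure_volumeMeasure : (volumeMeasure g).IsOpenPosMeasure := by
  refine ⟨fun U hU ⟨p, hp⟩ h0 ↦ ?_⟩
  set s := (extChartAt (𝓡 m) p).target ∩ (extChartAt (𝓡 m) p).symm ⁻¹' U with hs
  have hso : IsOpen s :=
    (continuousOn_extChartAt_symm p).isOpen_inter_preimage (isOpen_extChartAt_target p) hU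
  have hps : extChartAt (𝓡 m) p p ∈ s := by
    refine ⟨mem_extChartAt_target p, ?_⟩
    rw [Set.mem_preimage, left_inv_extChartAt (mem_chart_source _ p)]
    exact hp
  have h1 : chartVolume g p U = 0 :=
    le_antisymm ((Measure.le_iff'.1 (le_iSup (chartVolume g) p) U).trans h0.le) zero_le
  rw [chartVolume_apply g hU.measurableSet, lintegral_eq_zero_iff'
    ((aemeasurable_density_symm g p).mono_measure (Measure.restrict_mono Set.inter_subset_left
        le_rfl)),
    Filter.EventuallyEq, ae_restrict_iff' hso.measurableSet] at h1
  have h2 : (volume : Measure (EuclideanSpace ℝ (Fin m))) s = 0 := by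
    refine measure_mono_null (fun y hy ↦ ?_) (ae_iff.1 h1)
    simp only [Set.mem_ofPred_eq, Classical.not_imp, Pi.zero_apply, ENNReal.ofReal_eq_zero, not_le]
    exact ⟨hy, density_pos (symm_mem_source hy.1)⟩
  exact (hso.measure_pos volume ⟨_, hps⟩).ne' h2

/-- The Euler-Lagrange equation of harmonic vector fields, in weak form. -/
lemma IsHarmonicVF.integral_eq_zero {V : VF m M} (hV : IsHarmonicVF g V) {X : VF m M}
    (hX : ∀ x, SmoothAt X x) {K : Set M} (hK : IsCompact K) (h0 : ∀ x ∉ K, X x = 0)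
    (hVX : ∀ x, g.val x (V x) (X x) = 0) :
    ∫ x, pair g (roughLaplacian g V) X x ∂(volumeMeasure g) = 0 := by
  obtain ⟨hVs, r, hr, hVr, hcrit⟩ := hV
  have : LocallyCompactSpace M := ChartedSpace.locallyCompactSpace (EuclideanSpace ℝ (Fin m)) M
  obtain ⟨D, hDo, hKD, hD⟩ := exists_isOpen_superset_and_isCompact_closure hK
  set s : M → ℝ := pair g X X with hs
  have hss : ∀ x, FunSmoothAt m s x := fun x ↦ (hX x).pair g (hX x)
  obtain ⟨B, hB0, hB⟩ : ∃ B : ℝ, 0 < B ∧ ∀ x, |s x| ≤ B := by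
    obtain ⟨B, hB⟩ := hK.exists_bound_of_continuousOn (continuous_of_smoothAt hss).continuousOn
    refine ⟨max B 1, by positivity, fun x ↦ ?_⟩
    by_cases hx : x ∈ K
    · exact (hB x hx).trans (le_max_left _ _)
    · rw [hs, pair, h0 x hx, map_zero, abs_zero]; positivity
  set ε := √(|r| / B) with hε
  have hε0 : 0 < ε := by positivity
  -- Rational parametrization of the quadric g(Y, Y) = r: the field ((2 - w)V + tX)/w has length r
  -- exactly when 4r(w - 1) = t² g(X, X). No square root or sign condition on g(X, X) is needed; the
  -- choice of ε gives w ≥ 3/4.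
  set w : ℝ × M → ℝ := fun z ↦ 1 + z.1 ^ 2 * s z.2 / r / 4 with hw
  have hwpos : ∀ z : ℝ × M, z.1 ∈ Set.Ioo (-ε) ε → 0 < w z := fun z hz ↦ by
    have h1 : z.1 ^ 2 < |r| / B := by
      have := sq_lt_sq' hz.1 hz.2
      rwa [hε, Real.sq_sqrt (by positivity)] at this
    have h2 : |z.1 ^ 2 * s z.2 / r| ≤ 1 := by
      rw [abs_div, abs_mul, abs_of_nonneg (sq_nonneg z.1), div_le_one (by positivity)]
      rw [lt_div_iff₀ hB0] at h1
      calc z.1 ^ 2 * |s z.2| ≤ z.1 ^ 2 * B := by gcongr; exact hB z.2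
        _ ≤ |r| := h1.le
    have h3 := (abs_le.1 h2).1
    simp only [hw]; linarith
  set a : ℝ × M → ℝ := fun z ↦ (2 - w z) * (w z)⁻¹ with ha
  set b : ℝ × M → ℝ := fun z ↦ z.1 * (w z)⁻¹ with hb
  have hws : ∀ z : ℝ × M, ContMDiffAt (timeModel m) 𝓘(ℝ) ∞ w z := fun z ↦ by
    have h1 := contMDiffAt_comp_snd (hss z.2)
    have h2 : ContMDiffAt (timeModel m) 𝓘(ℝ, ℝ) ∞ (fun z : ℝ × M ↦ z.1) z := contMDiffAt_fst
    have h3 := contMDiffAt_const (c := (1 : ℝ)) (I := timeModel m) (I' := 𝓘(ℝ)) (n := ∞) (x := z)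
      |>.add ((((h2.mul h2).mul h1).mul (contMDiffAt_const (c := r⁻¹))).mul
        (contMDiffAt_const (c := (4 : ℝ)⁻¹)))
    refine h3.congr_of_eventuallyEq (Filter.Eventually.of_forall fun z ↦ ?_)
    simp only [hw, Pi.add_apply, Pi.mul_apply]
    ring
  have hwi : ∀ z : ℝ × M, z.1 ∈ Set.Ioo (-ε) ε →
      ContMDiffAt (timeModel m) 𝓘(ℝ) ∞ (fun z ↦ (w z)⁻¹) z := fun z hz ↦
    (hws z).inv₀ (hwpos z hz).ne'
  set W : ℝ → VF m M := fun t x ↦ a (t, x) • V x + b (t, x) • X x with hWdef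
  have hW : ContMDiffOn (𝓘(ℝ).prod (𝓡 m)) ((𝓡 m).prod 𝓘(ℝ, EuclideanSpace ℝ (Fin m))) ∞
      (fun p : ℝ × M ↦ TotalSpace.mk' (EuclideanSpace ℝ (Fin m)) p.2 (W p.1 p.2))
          (Set.Ioo (-ε) ε ×ˢ Set.univ) := by
    rintro z ⟨hz, -⟩
    exact (contMDiffAt_comb ((contMDiffAt_const.sub (hws z)).mul (hwi z hz))
      (contMDiffAt_fst.mul (hwi z hz)) (hVs z.2) (hX z.2)).contMDiffWithinAt
  have hw0 : ∀ x, w (0, x) = 1 := fun x ↦ by simp [hw]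
  have hW0 : ∀ x, W 0 x = V x := fun x ↦ by
    simp only [hWdef, ha, hb, hw0]; norm_num
  have hWr : ∀ t ∈ Set.Ioo (-ε) ε, ∀ x, g.val x (W t x) (W t x) = r := fun t ht x ↦ by
    have h1 := (hwpos (t, x) ht).ne'
    have h2 : g.val x (X x) (X x) = s x := rfl
    have h3 : t ^ 2 * s x = 4 * r * (w (t, x) - 1) := by
      simp only [hw]; field_simp; ring
    simp only [hWdef, map_add, map_smul, add_apply, smul_apply, smul_eq_mul, hVr, hVX,
      g.symm x (X x) (V x), h2, ha, hb]
    field_simp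
    linear_combination h3
  have hWK : ∀ t ∈ Set.Ioo (-ε) ε, ∀ x ∉ K, W t x = V x := fun t ht x hx ↦ by
    have h1 : w (t, x) = 1 := by simp [hw, hs, pair, h0 x hx]
    simp only [hWdef, ha, hb, h1, h0 x hx]; norm_num
  have h1 := energy_variation g hVs hD hK hKD hε0 hW hW0 hWK
  have hmem : ∀ᶠ t in 𝓝 (0 : ℝ), t ∈ Set.Ioo (-ε) ε := Ioo_mem_nhds (by linarith) hε0
  have hLV := fun x ↦ (smoothAt_pair_roughLaplacian (g := g) (y := x) hVs hVs).continuousAt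
  have hLX := fun x ↦ (smoothAt_pair_roughLaplacian (g := g) (y := x) hVs hX).continuousAt
  -- The velocity at t = 0 is X, and the remainder is t² times a continuous function.
  have hWX : ∀ t ∈ Set.Ioo (-ε) ε, ∀ x, pair g (roughLaplacian g V) (W t - V) x =
      t * pair g (roughLaplacian g V) X x + t ^ 2 * (-(w (t, x))⁻¹ * (s x / r) *
        (2⁻¹ * pair g (roughLaplacian g V) V x + 4⁻¹ * t * pair g (roughLaplacian g V) X x)) :=
    fun t ht x ↦ by
      have h2 := mul_inv_cancel₀ (hwpos (t, x) ht).ne'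
      have h3 : t ^ 2 * (s x / r) = 4 * (w (t, x) - 1) := by
        simp only [hw]; ring
      simp only [pair, hWdef, Pi.sub_apply, map_sub, map_add, map_smul, smul_eq_mul, ha, hb]
      set LV := g.val x (roughLaplacian g V x) (V x)
      set LX := g.val x (roughLaplacian g V x) (X x)
      linear_combination (LV + t * LX) * h2 + (w (t, x))⁻¹ * (2⁻¹ * LV + 4⁻¹ * t * LX) * h3
  set q : ℝ → M → ℝ := fun t x ↦ pair g (roughLaplacian g V) (W t - V) x -
    t * pair g (roughLaplacian g V) X x with hq
  have h2 : (fun t ↦ ∫ x, q t x ∂(volumeMeasure g)) =O[𝓝 0] fun t : ℝ ↦ t ^ 2 := by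
    refine isBigO_integral g hK ?_ fun p hp ↦ ?_
    · filter_upwards [hmem] with t ht x hx
      simp [hq, pair, hWK t ht x hx, h0 x hx]
    · have h3 : ContinuousAt (fun z : ℝ × M ↦ -(w z)⁻¹ * (s z.2 / r) *
          (2⁻¹ * pair g (roughLaplacian g V) V z.2 +
            4⁻¹ * z.1 * pair g (roughLaplacian g V) X z.2)) (0, p) := by
        have c1 := (hwi (0, p) hmem.self_of_nhds).continuousAt
        have c2 := (contMDiffAt_comp_snd (z := ((0 : ℝ), p)) (hss p)).continuousAt
        have c3 : ContinuousAt (fun z : ℝ × M ↦ pair g (roughLaplacian g V) V z.2) (0, p) :=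
          (hLV p).comp_of_eq continuousAt_snd rfl
        have c4 : ContinuousAt (fun z : ℝ × M ↦ pair g (roughLaplacian g V) X z.2) (0, p) :=
          (hLX p).comp_of_eq continuousAt_snd rfl
        exact (c1.neg.mul (c2.div_const r)).mul ((continuousAt_const.mul c3).add
          ((continuousAt_const.mul continuousAt_fst).mul c4))
      have h4 := (isBigO_refl (fun z : ℝ × M ↦ z.1 ^ 2) (𝓝 (0, p))).mul (h3.tendsto.isBigO_one ℝ)
      simp only [mul_one] at h4
      refine Filter.EventuallyEq.trans_isBigO ?_ h4
      filter_upwards [(continuous_fst.tendsto ((0 : ℝ), p)).eventually hmem] with z hz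
      simp only [hq]
      rw [hWX z.1 hz z.2]
      ring
  have hint : Integrable (pair g (roughLaplacian g V) X) (volumeMeasure g) :=
    integrable_of_smoothAt g (fun x ↦ smoothAt_pair_roughLaplacian hVs hX) hK fun x hx ↦ by
      rw [pair, h0 x hx, map_zero]
  have h3 : (fun t ↦ energy g D (W t) - energy g D (W 0)
      - t * ∫ x, pair g (roughLaplacian g V) X x ∂(volumeMeasure g)) =O[𝓝 0] fun t : ℝ ↦ t ^ 2 := by
    refine Filter.EventuallyEq.trans_isBigO ?_ (h1.add h2)
    filter_upwards [hmem] with t ht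
    have hWs : ∀ x, SmoothAt (W t - V) x := fun x ↦
      (smoothAt_time (hW.contMDiffAt (prod_mem_nhds (Ioo_mem_nhds ht.1 ht.2)
        Filter.univ_mem))).sub (hVs x)
    have hint' : Integrable (pair g (roughLaplacian g V) (W t - V)) (volumeMeasure g) :=
      integrable_of_smoothAt g (fun x ↦ smoothAt_pair_roughLaplacian hVs hWs) hK fun x hx ↦ by
        rw [pair, Pi.sub_apply, hWK t ht x hx, sub_self, map_zero]
    have hW0' : W 0 = V := funext hW0
    simp only [hq]
    rw [hW0', integral_sub hint' (hint.const_mul t), integral_const_mul]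
    ring
  exact (hasDerivAt_of_isBigO h3).unique
    (hcrit D K hDo hD hK hKD ε hε0 W hW hW0 hWr hWK)

/-- The rough Laplacian of a harmonic vector field is collinear with it. -/
theorem IsHarmonicVF.val_roughLaplacian_eq_zero {V : VF m M} (hV : IsHarmonicVF g V)
    (u : TangentSpace (𝓡 m) p) (hu : g.val p u (V p) = 0) :
    g.val p (roughLaplacian g V p) u = 0 := by
  obtain ⟨hVs, r, hr, hVr, -⟩ := id hV
  have hp := mem_chart_source (EuclideanSpace ℝ (Fin m)) p
  obtain ⟨f⟩ : Nonempty (SmoothBumpFunction (𝓡 m) p) := inferInstance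
  -- Projection of the extension of u onto the orthogonal complement of V; at p it is u itself, by
  -- `hu`. The bump function then makes it global.
  set Y₀ : VF m M := ext u - (fun x ↦ pair g (ext u) V x / r) • V with hY₀
  set Y : VF m M := (f : M → ℝ) • Y₀ with hY
  have hYs : ∀ x, SmoothAt Y x := fun x ↦ by
    by_cases hx : x ∈ (chartAt (EuclideanSpace ℝ (Fin m)) p).source
    · refine SmoothAt.smul f.contMDiffAt ((smoothAt_ext hx u).sub (SmoothAt.smul ?_ (hVs x)))
      exact ((smoothAt_ext hx u).pair g (hVs x)).div_const r
    · have h0 : SmoothAt (0 : VF m M) x := contMDiffAt_zeroSection (𝕜 := ℝ)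
          (F := (EuclideanSpace ℝ (Fin m)))
        (E := (TangentSpace (𝓡 m) : M → Type _)) (IB := 𝓡 m)
      refine h0.congr_of_eventuallyEq ?_
      have hx' : x ∉ tsupport f := fun h ↦ hx (f.tsupport_subset_chartAt_source h)
      filter_upwards [(isClosed_tsupport f).isOpen_compl.mem_nhds hx'] with z hz
      rw [hY, Pi.smul_apply', image_eq_zero_of_notMem_tsupport hz, zero_smul]
      rfl
  set F : M → ℝ := pair g (roughLaplacian g V) Y with hF
  have hFs : ∀ x, FunSmoothAt m F x := fun x ↦ smoothAt_pair_roughLaplacian hVs hYs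
  have hY0 : ∀ x ∉ tsupport f, Y x = 0 := fun x hx ↦ by
    rw [hY, Pi.smul_apply', image_eq_zero_of_notMem_tsupport hx, zero_smul]
  have hVY : ∀ x, g.val x (V x) (Y x) = 0 := fun x ↦ by
    simp only [hY, hY₀, Pi.smul_apply', Pi.sub_apply, map_smul, map_sub, smul_eq_mul, hVr, pair,
      g.symm x (V x) (ext u x)]
    field_simp
    ring
  -- With FY as the test field the integrand is F², which is nonnegative whatever the signature of
  -- g.
  have h1 := hV.integral_eq_zero g (X := F • Y) (fun x ↦ SmoothAt.smul (hFs x) (hYs x))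
    f.hasCompactSupport (fun x hx ↦ by rw [Pi.smul_apply', hY0 x hx, smul_zero])
    fun x ↦ by rw [Pi.smul_apply', map_smul, hVY, smul_zero]
  have h2 : pair g (roughLaplacian g V) (F • Y) = fun x ↦ F x * F x := by
    funext x
    rw [pair, Pi.smul_apply', map_smul, smul_eq_mul]
    rfl
  have hc := continuous_of_smoothAt hFs
  have h3 : F p = 0 := by
    by_contra hne
    have h4 := (hc.mul hc).integral_pos_of_hasCompactSupport_nonneg_nonzero (μ := volumeMeasure g)
      (HasCompactSupport.intro f.hasCompactSupport fun x hx ↦ by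
        simp only [hF, Pi.mul_apply, pair, hY0 x hx, map_zero, mul_zero])
      (fun x ↦ mul_self_nonneg _) (x := p) (mul_ne_zero hne hne)
    rw [h2] at h1
    exact h4.ne' h1
  have h5 : Y p = u := by
    simp [hY, hY₀, pair, hu]
  rwa [hF, pair, h5] at h3

end Variations

end SemiRiem

namespace ParacontactMetric

open SemiRiem

/-! ### The equivalences for the Reeb vector field -/

section Ricci

variable {n : ℕ} {M : Type*} [TopologicalSpace M]
  [ChartedSpace (EuclideanSpace ℝ (Fin (2 * n + 1))) M]
  [IsManifold (𝓡 (2 * n + 1)) ∞ M] (S : ParacontactMetric n M)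

lemma ricciOp_ξ_eq_iff (p : M) : ricciOp S.g p (S.ξ p) = -(2 * (n : ℝ)) • S.ξ p ↔
    roughLaplacian S.g S.ξ p = -(2 * (n : ℝ)) • S.ξ p := by
  rw [S.ricciOp_ξ]
  constructor <;> intro h
  · rw [neg_eq_iff_eq_neg.mp (sub_eq_iff_eq_add.mp h)]
    module
  · rw [h]
    module

/-- Equality with Qξ = -Δ̄ξ - 4nξ means 2Δ̄ξ = -4nξ. -/
lemma roughLaplacian_ξ_eq_ricciOp_iff (p : M) :
    roughLaplacian S.g S.ξ p = ricciOp S.g p (S.ξ p) ↔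
      ricciOp S.g p (S.ξ p) = -(2 * (n : ℝ)) • S.ξ p := by
  rw [ricciOp_ξ_eq_iff, S.ricciOp_ξ]
  constructor <;> intro h
  · have h2 : (2 : ℝ) • roughLaplacian S.g S.ξ p = -(4 * n : ℝ) • S.ξ p := by
      rw [two_smul]
      nth_rw 1 [h]
      module
    rw [← inv_smul_smul₀ (two_ne_zero (α := ℝ)) (roughLaplacian S.g S.ξ p), h2]
    module
  · rw [h]
    module

lemma isInfinitesimalHarmonic_ξ_iff : IsInfinitesimalHarmonic S.g S.ξ ↔
    ∀ p, roughLaplacian S.g S.ξ p = ricciOp S.g p (S.ξ p) := by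
  refine forall_congr' fun p ↦ ?_
  rw [trace_lieDerivConnection S.g S.smoothAt_ξ, sub_eq_zero, eq_comm]

lemma trhSq_eq_zero_of_roughLaplacian_ξ {p : M}
    (h : roughLaplacian S.g S.ξ p = -(2 * (n : ℝ)) • S.ξ p) : S.trhSq p = 0 := by
  have h1 := S.val_roughLaplacian_ξ (p := p)
  rw [h, map_smul, smul_apply, S.val_ξ_ξ, smul_eq_mul] at h1
  linarith

/-- The hypothesis `ho` makes Δ̄ξ collinear with ξ, and its ξ-component is -2n - tr h² = -2n. -/
lemma roughLaplacian_ξ_of_trhSq_eq_zero {p : M} (h : S.trhSq p = 0)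
    (ho : ∀ u, S.g.val p u (S.ξ p) = 0 → S.g.val p (roughLaplacian S.g S.ξ p) u = 0) :
    roughLaplacian S.g S.ξ p = -(2 * (n : ℝ)) • S.ξ p := by
  have h1 := S.val_roughLaplacian_ξ (p := p)
  refine ext_val S.g fun w ↦ ?_
  have h2 := ho (w - S.g.val p w (S.ξ p) • S.ξ p) (by simp [S.val_ξ_ξ])
  rw [map_sub, map_smul, smul_eq_mul, h1, h, S.g.symm p w] at h2
  rw [map_smul, smul_apply, smul_eq_mul]
  linarith

end Ricci

variable {n : ℕ} {M : Type*} [TopologicalSpace M] [T2Space M] [SecondCountableTopology M]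
  [ChartedSpace (EuclideanSpace ℝ (Fin (2 * n + 1))) M] [IsManifold (𝓡 (2 * n + 1)) ∞ M]
  [MeasurableSpace M] [BorelSpace M] (S : ParacontactMetric n M)

lemma isHParacontact_and_trhSq_iff : (S.IsHParacontact ∧ ∀ p, S.trhSq p = 0) ↔
    ∀ p, roughLaplacian S.g S.ξ p = -(2 * (n : ℝ)) • S.ξ p :=
  ⟨fun ⟨h, h0⟩ p ↦ S.roughLaplacian_ξ_of_trhSq_eq_zero (h0 p)
    fun u hu ↦ IsHarmonicVF.val_roughLaplacian_eq_zero S.g h u hu,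
  fun h ↦ ⟨isHarmonicVF_of_roughLaplacian_eq S.g S.smooth_ξ one_ne_zero (fun _ ↦ S.val_ξ_ξ) h,
    fun p ↦ S.trhSq_eq_zero_of_roughLaplacian_ξ (h p)⟩⟩

end ParacontactMetric

end

theorem theorem6 (n : ℕ) (M : Type*) [TopologicalSpace M] [T2Space M]
    [SecondCountableTopology M] [ConnectedSpace M]
    [ChartedSpace (EuclideanSpace ℝ (Fin (2 * n + 1))) M]
    [IsManifold (𝓡 (2 * n + 1)) ∞ M] [MeasurableSpace M] [BorelSpace M]
    (S : ParacontactMetric n M) :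
    List.TFAE [
      ∀ x, SemiRiem.ricciOp S.g x (S.ξ x) = -(2 * (n : ℝ)) • S.ξ x,
      SemiRiem.IsInfinitesimalHarmonic S.g S.ξ,
      ∀ x, SemiRiem.roughLaplacian S.g S.ξ x = SemiRiem.ricciOp S.g x (S.ξ x),
      S.IsHParacontact ∧ ∀ x, S.trhSq x = 0] := by
  have h21 := forall_congr' S.roughLaplacian_ξ_eq_ricciOp_iff
  tfae_have 2 ↔ 3 := S.isInfinitesimalHarmonic_ξ_iff
  tfae_have 3 ↔ 1 := h21
  tfae_have 4 ↔ 1 := S.isHParacontact_and_trhSq_iff.trans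
    (forall_congr' S.ricciOp_ξ_eq_iff).symm
  tfae_finish
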